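/- Let $n\ge 1$. Consider complex formal power series in $z=(z_1,\dots,z_n)$, $\bar z=(\bar z_1,\dots,\bar z_n)$, $u$, with the formal conjugation that conjugates coefficients, exchanges $z_j$ and $\bar z_j$, and fixes $u$; a series is real if it equals its conjugate. Let $L=(L^{\bar z},L^w)(z,\bar z,u)\colon \mathbb C^n_z\to\mathbb C^n_{\bar z}\times\mathbb C_w$ be a formal power series map with $L(0)=0$. It defines a formal hypersurface-type almost CR structure on $\mathbb C^n_z\times\mathbb R_u$, where $H^{1,0}$ is the graph of $L$, spanned by $$X_k=\frac{\partial}{\partial z_k}+\sum_j L^{\bar z}_{jk}\frac{\partial}{\partial \bar z_j}+L^w_k\frac{\partial}{\partial u},\qquad k=1,\dots,n.$$ Let $\mathcal L(\bar\xi,\eta)=\sum_{j,k} c_{jk}\bar\xi_j\eta_k$ be the Levi form at $0$, where $c_{jk}$ is the $u$-component of $\frac1{2i}[\bar X_j,X_k]$ at $0$, and let $\mathcal N^w(\xi,\eta)=\sum_{j,k} N_{jk}\xi_j\eta_k$, where $N_{jk}$ is the $u$-component of $[X_j,X_k]$ at $0$. Assume that $L$ is strongly nondegenerate: $\mathcal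 L$ is nondegenerate, and $6i\mathcal L(\bar\xi,\eta)+\mathcal N^w(\xi,\eta)=0$ for all $\eta$ implies $\xi=0$. Let $r\in\mathbb R$. Then there exist unique formal power series $f(z,\bar z,u)\in\mathbb C^n$ and real $g(z,\bar z,u)$, without constant and linear terms, such that $g_{u^2}(0)=r$ and the map $h={\sf id}+(f,g)$, $(z,u)\mapsto(z+f,u+g)$, transforms $L$ into some $L'$ (that is, $dh$ maps the bundle $H^{1,0}$ of $L$ to that of $L'$) satisfying, for all $a,b,c\ge0$, $$\tilde L'^{\bar z}_{z^a\bar z^bu^c}=0,\qquad \tilde L'^{w}_{z^a\bar z^bu^c}+\overline{\tilde L'^{w}_{z^b\bar z^au^c}}=0,\qquad \tilde L'^{w}_{z\bar zu^{c+1}}=0,\qquad \tilde L'^{w}_{z^{a+2}\bar zu^c}=0,$$ $$\mathbf{tr}\,\tilde L'^{w}_{z^2\bar z^2u^c}=0,\qquad \mathbf{tr}^2\,\tilde L'^{w}_{z^3\bar z^2u^c}=0,\qquad \mathbf{tr}^3\,\tilde L'^{w}_{z^3\bar z^3u^c}=0.$$ Here $\tilde L'=(\tilde L'^{\bar z},\tilde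 L'^{w})=L'(z,\bar z,u)(\sum_k z_k\,\partial/\partial z_k)$ is the radial part of $L'$. For a power series $p$, $p_{z^a\bar z^bu^c}$ is the derivative at $0$ of order $a$ in $z$, $b$ in $\bar z$, $c$ in $u$, regarded as a multihomogeneous polynomial, i.e. $a!\,b!\,c!$ times the component of $p$ of multidegree $(a,b,c)$. Finally $\mathbf{tr}=\sum_{j,k}c^{jk}\frac{\partial^2}{\partial\bar z_j\partial z_k}$, where $(c_{jk})$ is the matrix of the Levi form of $L'$ at $0$ and $\sum_k c^{jk}c_{lk}=\delta_{jl}$. Furthermore, each partial derivative at $0$ of each component of $L'$, $f$, $g$ is given by a universal polynomial, depending only on $n$, the component and the multi-index, in $r$, finitely many partial derivatives of $L$ at $0$ and their complex conjugates, and the reciprocals of two nonzero determinants: $\det(c_{jk})$ and the determinant of the real-linear map $\xi\mapsto 6i\mathcal L(\bar\xi,\cdot)+\mathcal N^w(\xi,\cdot)$, the latter being written in the coordinates $(\xi,\bar\xi)$ as the matrix $$\begin{pmatrix} N & -6i\,\overline{C}\\ 6i\,C & \overline{N}\end{pmatrix},\qquad C=(c_{jk}),\ N=(N_{jk}).$$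 -/

import Mathlib

noncomputable section

namespace FormalCR

open MvPowerSeries

/-- The formal variables `(z, z̄, u)` on `ℂⁿ × ℝ`: `z_1, …, z_n`, then `z̄_1, …, z̄_n`, then `u`. -/
abbrev Var (n : ℕ) : Type := Fin n ⊕ Fin n ⊕ Unit

/-- The index of the variable `z_j`. -/
abbrev iz {n : ℕ} (j : Fin n) : Var n := Sum.inl j

/-- The index of the variable `z̄_j`. -/
abbrev izb {n : ℕ} (j : Fin n) : Var n := Sum.inr (Sum.inl j)

/-- The index of the variable `u`. -/
abbrev iu {n : ℕ} : Var n := Sum.inr (Sum.inr ())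

/-- Complex-valued formal power series in `(z, z̄, u)`. -/
abbrev FPS (n : ℕ) : Type := MvPowerSeries (Var n) ℂ

/-- Multi-indices in the variables `(z, z̄, u)`. -/
abbrev MIdx (n : ℕ) : Type := Var n →₀ ℕ

/-- The exchange of `z_j` with `z̄_j`, fixing `u`. -/
def swapVar (n : ℕ) : Var n ≃ Var n where
  toFun
    | Sum.inl j => Sum.inr (Sum.inl j)
    | Sum.inr (Sum.inl j) => Sum.inl j
    | Sum.inr (Sum.inr t) => Sum.inr (Sum.inr t)
  invFun
    | Sum.inl j => Sum.inr (Sum.inl j)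
    | Sum.inr (Sum.inl j) => Sum.inl j
    | Sum.inr (Sum.inr t) => Sum.inr (Sum.inr t)
  left_inv := by rintro (j | j | t) <;> rfl
  right_inv := by rintro (j | j | t) <;> rfl

/-- Complex conjugation of a formal power series in `(z, z̄, u)`: the coefficients are conjugated,
`z_j` and `z̄_j` are exchanged, and `u` is real. -/
def conj {n : ℕ} (p : FPS n) : FPS n :=
  MvPowerSeries.map (starRingEnd ℂ) (renameEquiv (R := ℂ) (swapVar n) p)

/-- A formal power series is real-valued if it is equal to its conjugate. -/
def IsReal {n : ℕ} (p : FPS n) : Prop := conj p = p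

/-- The value at `0` of the partial derivative of `p` of multi-index `α`. -/
def deriv0 {n : ℕ} (α : MIdx n) (p : FPS n) : ℂ :=
  (∏ i, ((α i).factorial : ℂ)) * coeff α p

/-- `p` has no constant and no linear terms. -/
def NoConstLin {n : ℕ} (p : FPS n) : Prop :=
  ∀ α : MIdx n, α.degree ≤ 1 → coeff α p = 0

/-- A formal power series map `L(z, z̄, u) : ℂⁿ_z → ℂⁿ_z̄ × ℂ_w`.  `zb j k` is the `z̄_j`-component and
`w k` is the `w`-component of the image of `∂/∂z_k`. -/
structure FormalMap (n : ℕ) where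
  zb : Fin n → Fin n → FPS n
  w : Fin n → FPS n

namespace FormalMap

variable {n : ℕ}

/-- `L(0) = 0`. -/
def NoConst (L : FormalMap n) : Prop :=
  (∀ j k, constantCoeff (L.zb j k) = 0) ∧ ∀ k, constantCoeff (L.w k) = 0

/-- The basis
`X_k = ∂/∂z_k + ∑_j L^{z̄}_{jk} ∂/∂z̄_j + L^w_k ∂/∂u`
of formal sections of the bundle `H^{1,0}` which is the graph of `L`, acting on power series. -/
def X (L : FormalMap n) (k : Fin n) (p : FPS n) : FPS n :=
  pderiv ℂ (iz k) p + (∑ j, L.zb j k * pderiv ℂ (izb j) p) + L.w k * pderiv ℂ iu p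

/-- The conjugate fields `X̄_k`, a basis of sections of `H^{0,1}`. -/
def Xbar (L : FormalMap n) (k : Fin n) (p : FPS n) : FPS n :=
  conj (L.X k (conj p))

/-- The Levi form at `0` in the basis `∂/∂z_1, …, ∂/∂z_n`: `(1 / 2i) [X̄_j, X_k]` at `0`
modulo `H^{1,0} ⊕ H^{0,1}`.  As `L(0) = 0`, the quotient at `0` is `ℂ_w` and the class of a vector is
its `∂/∂u`-component, that is, the value of the bracket on the coordinate `u`. -/
def levi (L : FormalMap n) : Matrix (Fin n) (Fin n) ℂ :=
  Matrix.of fun j k => (1 / (2 * Complex.I)) *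
    constantCoeff (L.Xbar j (L.X k (MvPowerSeries.X iu)) - L.X k (L.Xbar j (MvPowerSeries.X iu)))

/-- The transversal (that is, `w`-) component at `0` of the non-integrability tensor
`[X_j, X_k] mod H^{1,0}`. -/
def nonint (L : FormalMap n) : Matrix (Fin n) (Fin n) ℂ :=
  Matrix.of fun j k =>
    constantCoeff (L.X j (L.X k (MvPowerSeries.X iu)) - L.X k (L.X j (MvPowerSeries.X iu)))

/-- The Levi form `𝓛(ξ̄, η)`, antilinear in `ξ` and linear in `η`. -/
def leviForm (L : FormalMap n) (ξ η : Fin n → ℂ) : ℂ :=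
  ∑ j, ∑ k, L.levi j k * (starRingEnd ℂ) (ξ j) * η k

/-- The bilinear form `𝓝^w(ξ, η)`. -/
def nonintForm (L : FormalMap n) (ξ η : Fin n → ℂ) : ℂ :=
  ∑ j, ∑ k, L.nonint j k * ξ j * η k

/-- Strong nondegeneracy at `0`: both `𝓛` and `6i𝓛 + 𝓝^w` are nondegenerate. -/
def StronglyNondegenerate (L : FormalMap n) : Prop :=
  (∀ ξ : Fin n → ℂ, (∀ η, L.leviForm ξ η = 0) → ξ = 0) ∧
  ∀ ξ : Fin n → ℂ, (∀ η, 6 * Complex.I * L.leviForm ξ η + L.nonintForm ξ η = 0) → ξ = 0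

/-- The evaluation of `L^{z̄}` along the Euler field `e(z) = ∑ z_k ∂/∂z_k`, `z̄_j`-component. -/
def radialZb (L : FormalMap n) (j : Fin n) : FPS n :=
  ∑ k, L.zb j k * MvPowerSeries.X (iz k)

/-- The evaluation of `L^w` along the Euler field. -/
def radialW (L : FormalMap n) : FPS n :=
  ∑ k, L.w k * MvPowerSeries.X (iz k)

/-- The trace operator `tr = ∑_{j,k} c^{jk} ∂²/∂z̄_j ∂z_k` of the hermitian form
`∑ c_{jk} z̄_j z_k` given by the Levi form of `L` at `0`.  Here `(c^{jk})` is the inverse in the sense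
of tensors, `∑_k c^{jk} c_{lk} = δ_{jl}`, which makes `tr` independent of the linear coordinates and
gives `tr (∑ c_{jk} z̄_j z_k) = n`. -/
def tr (L : FormalMap n) (p : FPS n) : FPS n :=
  ∑ j, ∑ k, (L.levi⁻¹ k j) • pderiv ℂ (izb j) (pderiv ℂ (iz k) p)

/-- The images `(z + f, z̄ + f̄, u + g)` of the coordinates under the formal map `id + (f, g)`. -/
def coordChange (f : Fin n → FPS n) (g : FPS n) : Var n → FPS n
  | Sum.inl j => MvPowerSeries.X (iz j) + f j
  | Sum.inr (Sum.inl j) => MvPowerSeries.X (izb j) + conj (f j)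
  | Sum.inr (Sum.inr _) => MvPowerSeries.X iu + g

/-- The formal map `h = id + (f, g)` transforms `L` into `L'`: the differential of `h` sends the
`H^{1,0}`-bundle of `L` at each point into that of `L'` at the image point, where the latter is given
by `dz̄' = L'^{z̄'} dz'`, `dw' = L'^{w'} dz'`. -/
def Transforms (L : FormalMap n) (f : Fin n → FPS n) (g : FPS n) (L' : FormalMap n) : Prop :=
  (∀ k, L.X k (coordChange f g iu) =
    ∑ m, subst (coordChange f g) (L'.w m) * L.X k (coordChange f g (iz m))) ∧
  ∀ j k, L.X k (coordChange f g (izb j)) =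
    ∑ m, subst (coordChange f g) (L'.zb j m) * L.X k (coordChange f g (iz m))

end FormalMap

/-- The derivative `p_{z^a z̄^b u^c}` at `0`, as a multihomogeneous polynomial in `(z, z̄, u)`: the sum
of `p_{z_{i_1} … z_{i_a} z̄_{j_1} … z̄_{j_b} u^c}(0) z_{i_1} ⋯ z_{i_a} z̄_{j_1} ⋯ z̄_{j_b} u^c` over all
indices, which is `a! b! c!` times the component of `p` of multidegree `(a, b, c)`. -/
def derPart {n : ℕ} (a b c : ℕ) (p : FPS n) : FPS n := fun α =>
  if (∑ j, α (iz j)) = a ∧ (∑ j, α (izb j)) = b ∧ α iu = c then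
    (a.factorial : ℂ) * b.factorial * c.factorial * coeff α p
  else 0

namespace FormalMap

variable {n : ℕ}

/-- The normalization conditions on `L`, with `tr` the trace operator of the Levi form of `L`. -/
structure IsNormal (L : FormalMap n) : Prop where
  tangential : ∀ (a b c : ℕ) (j : Fin n), derPart a b c (L.radialZb j) = 0
  reality : ∀ a b c : ℕ, derPart a b c L.radialW + conj (derPart b a c L.radialW) = 0
  deg_one_one : ∀ c : ℕ, derPart 1 1 (c + 1) L.radialW = 0
  deg_one : ∀ a c : ℕ, derPart (a + 2) 1 c L.radialW = 0
  trace_one : ∀ c : ℕ, L.tr (derPart 2 2 c L.radialW) = 0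
  trace_two : ∀ c : ℕ, L.tr (L.tr (derPart 3 2 c L.radialW)) = 0
  trace_three : ∀ c : ℕ, L.tr (L.tr (L.tr (derPart 3 3 c L.radialW))) = 0

/-- `f` and `g` are formal power series without constant and linear terms, `g` is real,
`g_{u²}(0) = r`, and `id + (f, g)` transforms `L` into `L'`, which is normalized. -/
structure Normalizes (L : FormalMap n) (r : ℝ) (f : Fin n → FPS n) (g : FPS n)
    (L' : FormalMap n) : Prop where
  noConstLin_f : ∀ j, NoConstLin (f j)
  noConstLin_g : NoConstLin g
  real_g : IsReal g
  second_g : deriv0 (Finsupp.single iu 2) g = (r : ℂ)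
  transforms : L.Transforms f g L'
  normal : L'.IsNormal

/-- The matrix of the real-linear map sending `ξ` to the linear form `6i𝓛(ξ̄, ·) + 𝓝^w(ξ, ·)`,
written in the coordinates `(ξ, ξ̄)` and acting on row vectors: the first block column is the form,
the second one its conjugate. -/
def strongMatrix (L : FormalMap n) : Matrix (Fin n ⊕ Fin n) (Fin n ⊕ Fin n) ℂ :=
  Matrix.fromBlocks
    L.nonint ((-6 * Complex.I) • L.levi.map (starRingEnd ℂ))
    ((6 * Complex.I) • L.levi) (L.nonint.map (starRingEnd ℂ))

end FormalMap

/-- The variables of the universal polynomials: `r`, the partial derivatives of (the components of)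
`L` at `0` and their conjugates, and the reciprocals of the determinants of the two forms that are
nondegenerate by assumption. -/
inductive Datum (n : ℕ) : Type
  | r : Datum n
  | zb (j k : Fin n) (α : MIdx n) : Datum n
  | zbConj (j k : Fin n) (α : MIdx n) : Datum n
  | w (k : Fin n) (α : MIdx n) : Datum n
  | wConj (k : Fin n) (α : MIdx n) : Datum n
  | leviDetInv : Datum n
  | strongDetInv : Datum n

/-- The values of these variables at a given `L` and `r`. -/
def Datum.value {n : ℕ} (L : FormalMap n) (r : ℝ) : Datum n → ℂ
  | .r => (r : ℂ)
  | .zb j k α => deriv0 α (L.zb j k)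
  | .zbConj j k α => (starRingEnd ℂ) (deriv0 α (L.zb j k))
  | .w k α => deriv0 α (L.w k)
  | .wConj k α => (starRingEnd ℂ) (deriv0 α (L.w k))
  | .leviDetInv => (L.levi.det)⁻¹
  | .strongDetInv => (L.strongMatrix.det)⁻¹

end FormalCR

end

/-! Let ℓ_k = i ∑ c_{jk} z̄_j + ½ ∑ N_{jk} z_j, and call "model" the structure with z̄-component 0
and w-component ℓ. Give z, z̄ the weight 1 and u the weight 2. A shear u ↦ u + q(z, z̄) with q real
and quadratic makes L^w agree with ℓ up to terms of weight two or more (`exists_shearFn`), so that L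
becomes a perturbation of the model by terms of higher weight. With L' = model + (zb, w), the
transformation equation reads linear(f, g, zb, w) = nonlinear(f, g, zb, w). The linear side respects
the weights, and the nonlinear side gains one weight (`nonlinZb_sub_mem`, `nonlinW_sub_mem`). Once
the linear problem with the normalization conditions is known to be uniquely solvable weight by
weight, the normalization is the only fixed point of a contraction for the weight filtration
(`exists_perturb`, `perturb_unique`).

In the linear problem only the radial parts matter, because zb and w absorb everything else. Let Q =
∑ c_{jk} z̄_j z_k, and let subscripts denote bidegrees in (z, z̄). The z̄-part says that (∑ z̄_k
∂/∂z̄_k − iQ ∂/∂u) f is prescribed; this determines f up to the components f_{a0}. For the w-part,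
whose radial part is `TT`, skewness determines g up to g_{00}. The other conditions form a
triangular system for what is left. Bidegree (a,1) with a ≥ 2 gives f_{a0}, because the Levi form is
nondegenerate. The double trace in bidegree (3,2), with f_{20} eliminated by (2,1), gives 6i conj
𝓛(z̄, f_{00}'') − 𝓝(z, f_{00}''), hence f_{00}'' by the second nondegeneracy condition. Bidegrees
(1,1), (2,2), (3,3) give f_{10}' and g_{00}'''; here the traces are inverted by the commutation rule
`tr_Q_mul`. The integration constants are constant terms, linear terms and g_{u²}(0), all of which
are prescribed. Injectivity is `eq_zero_of_radNormal`; surjectivity is `exists_parameters` and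
`exists_radNormal`.

All this works over any commutative ℂ-algebra with a compatible involution in which the two
determinants are invertible, and this yields the polynomial formulas. Take the algebra `dataAlg` of
functions of (L, r) that are polynomial in the data. Existence over it is a universal normalization.
Its value at each (L, r) is a normalization over ℂ, hence by uniqueness the given one
(`exists_universal`). -/

noncomputable section

namespace FormalCR

open MvPowerSeries

/-! ### Weighted gradings and filtrations, substitution and the chain rule -/

section Graded

variable {σ R : Type*} [CommRing R]

/-- The power series with prescribed coefficients. -/
def ofCoeff (F : (σ →₀ ℕ) → R) : MvPowerSeries σ R := F

@[simp]
theorem coeff_ofCoeff (F : (σ →₀ ℕ) → R) (α : σ →₀ ℕ) : coeff α (ofCoeff F) = F α := rfl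

/-- The homogeneous component of degree `m` for the grading in which `X i` has degree `w i`. -/
def comp {M : Type*} [AddCommMonoid M] [DecidableEq M] (w : σ → M) (m : M) :
    MvPowerSeries σ R →ₗ[R] MvPowerSeries σ R where
  toFun p := ofCoeff fun α => if Finsupp.weight (R := ℕ) w α = m then coeff α p else 0
  map_add' p q := by
    ext α
    simp only [map_add, coeff_ofCoeff]
    split_ifs <;> simp
  map_smul' r p := by
    ext α
    simp only [coeff_ofCoeff, RingHom.id_apply, coeff_smul]
    split_ifs <;> simp

theorem coeff_comp {M : Type*} [AddCommMonoid M] [DecidableEq M] (w : σ → M) (m : M)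
    (p : MvPowerSeries σ R) (α : σ →₀ ℕ) :
    coeff α (comp w m p) = if Finsupp.weight (R := ℕ) w α = m then coeff α p else 0 := rfl

theorem weight_add_single {M : Type*} [AddCommMonoid M] (w : σ → M) (α : σ →₀ ℕ) (i : σ) :
    Finsupp.weight (R := ℕ) w (α + Finsupp.single i 1) = Finsupp.weight (R := ℕ) w α + w i := by
  rw [map_add, Finsupp.weight_single, one_smul]

theorem eq_of_comp_eq {M : Type*} [AddCommMonoid M] [DecidableEq M] (w : σ → M)
    {p q : MvPowerSeries σ R} (h : ∀ m, comp w m p = comp w m q) : p = q := by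
  ext α
  have := congrArg (coeff α) (h (Finsupp.weight (R := ℕ) w α))
  simpa [coeff_comp] using this

theorem comp_comp_self {M : Type*} [AddCommMonoid M] [DecidableEq M] (w : σ → M) (m m' : M)
    (p : MvPowerSeries σ R) : comp w m (comp w m' p) = if m = m' then comp w m p else 0 := by
  ext α
  split_ifs with h
  · subst h
    simp only [coeff_comp]
    split_ifs <;> rfl
  · simp only [coeff_comp, coeff_zero]
    split_ifs with h1 h2
    · exact absurd (h1.symm.trans h2) h
    all_goals rfl

theorem comp_comm {M M' : Type*} [AddCommMonoid M] [DecidableEq M] [AddCommMonoid M']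
    [DecidableEq M'] (w : σ → M) (m : M) (w' : σ → M') (m' : M') (p : MvPowerSeries σ R) :
    comp w m (comp w' m' p) = comp w' m' (comp w m p) := by
  ext α
  simp only [coeff_comp]
  split_ifs <;> rfl

theorem comp_C_mul {M : Type*} [AddCommMonoid M] [DecidableEq M] (w : σ → M) (m : M) (r : R)
    (p : MvPowerSeries σ R) : comp w m (C r * p) = C r * comp w m p := by
  rw [← smul_eq_C_mul, ← smul_eq_C_mul, map_smul]

theorem comp_X_mul {M : Type*} [AddCommGroup M] [DecidableEq M] (w : σ → M) (m : M) (i : σ)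
    (p : MvPowerSeries σ R) : comp w m (X i * p) = X i * comp w (m - w i) p := by
  classical
  ext α
  rw [coeff_comp, X, coeff_monomial_mul, coeff_monomial_mul]
  by_cases h : Finsupp.single i 1 ≤ α
  · rw [if_pos h, if_pos h, coeff_comp]
    obtain ⟨β, rfl⟩ := exists_add_of_le h
    rw [add_tsub_cancel_left, add_comm (Finsupp.single i 1), weight_add_single]
    simp only [eq_sub_iff_add_eq]
    split_ifs <;> simp
  · rw [if_neg h, if_neg h, ite_self]

theorem comp_pderiv {M : Type*} [AddCommGroup M] [DecidableEq M] (w : σ → M) (m : M) (i : σ)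
    (p : MvPowerSeries σ R) : comp w m (pderiv R i p) = pderiv R i (comp w (m + w i) p) := by
  ext α
  rw [coeff_comp, coeff_pderiv, coeff_pderiv, coeff_comp, weight_add_single]
  simp only [add_left_inj]
  split_ifs <;> simp

theorem comp_mul_of_eq_zero {M : Type*} [AddCommMonoid M] [DecidableEq M] (w : σ → M) (m : M)
    {p : MvPowerSeries σ R} (h : ∀ α, Finsupp.weight (R := ℕ) w α = m → coeff α p = 0) :
    comp w m p = 0 := by
  ext α
  rw [coeff_comp, coeff_zero]
  split_ifs with h1
  · exact h α h1
  · rfl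

theorem coeff_X_mul_pderiv (i : σ) (p : MvPowerSeries σ R) (α : σ →₀ ℕ) :
    coeff α (X i * pderiv R i p) = α i * coeff α p := by
  classical
  rw [X, coeff_monomial_mul]
  by_cases h : Finsupp.single i 1 ≤ α
  · rw [if_pos h]
    obtain ⟨β, rfl⟩ := exists_add_of_le h
    rw [add_tsub_cancel_left, coeff_pderiv, one_mul, add_comm β, mul_comm]
    simp [add_comm]
  · rw [if_neg h]
    have : α i = 0 := by
      by_contra h0
      exact h (Finsupp.single_le_iff.2 (Nat.one_le_iff_ne_zero.2 h0))
    simp [this]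

/-- The power series of weighted order at least `d`. -/
def wfil (R : Type*) [CommRing R] (w : σ → ℤ) (d : ℤ) : Submodule R (MvPowerSeries σ R) where
  carrier := {p | ∀ α, Finsupp.weight (R := ℕ) w α < d → coeff α p = 0}
  add_mem' hp hq α hα := by rw [map_add, hp α hα, hq α hα, add_zero]
  zero_mem' α _ := coeff_zero α
  smul_mem' r p hp α hα := by rw [coeff_smul, hp α hα, mul_zero]

theorem mem_wfil {w : σ → ℤ} {d : ℤ} {p : MvPowerSeries σ R} :
    p ∈ wfil R w d ↔ ∀ α, Finsupp.weight (R := ℕ) w α < d → coeff α p = 0 := Iff.rfl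

theorem wfil_anti {w : σ → ℤ} {d e : ℤ} (h : d ≤ e) : wfil R w e ≤ wfil R w d :=
  fun _ hp α hα => hp α (hα.trans_le h)

theorem mem_wfil_iff_comp {w : σ → ℤ} {d : ℤ} {p : MvPowerSeries σ R} :
    p ∈ wfil R w d ↔ ∀ m < d, comp w m p = 0 := by
  constructor
  · intro hp m hm
    exact comp_mul_of_eq_zero w m fun α hα => hp α (hα ▸ hm)
  · intro h α hα
    have := congrArg (coeff α) (h _ hα)
    simpa [coeff_comp] using this

theorem wfil_mul {w : σ → ℤ} {d e : ℤ} {p q : MvPowerSeries σ R} (hp : p ∈ wfil R w d)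
    (hq : q ∈ wfil R w e) : p * q ∈ wfil R w (d + e) := by
  classical
  intro α hα
  rw [coeff_mul]
  refine Finset.sum_eq_zero fun x hx => ?_
  have hx' := Finset.HasAntidiagonal.mem_antidiagonal.1 hx
  rw [← hx', map_add] at hα
  by_cases h : Finsupp.weight (R := ℕ) w x.1 < d
  · rw [hp _ h, zero_mul]
  · rw [hq x.2 (by linarith), mul_zero]

theorem wfil_mul' {w : σ → ℤ} {d e k : ℤ} {p q : MvPowerSeries σ R} (hp : p ∈ wfil R w d)
    (hq : q ∈ wfil R w e) (h : k ≤ d + e) : p * q ∈ wfil R w k :=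
  wfil_anti h (wfil_mul hp hq)

theorem wfil_X {w : σ → ℤ} (i : σ) : (X i : MvPowerSeries σ R) ∈ wfil R w (w i) := by
  classical
  intro α hα
  rw [coeff_X, if_neg]
  rintro rfl
  simp [Finsupp.weight_single] at hα

theorem weight_nonneg {w : σ → ℤ} (hw : ∀ i, 0 ≤ w i) (α : σ →₀ ℕ) :
    0 ≤ Finsupp.weight (R := ℕ) w α := by
  rw [Finsupp.weight_apply]
  exact Finset.sum_nonneg fun i _ => by positivity [hw i]

theorem mem_wfil_of_nonpos {w : σ → ℤ} (hw : ∀ i, 0 ≤ w i) {d : ℤ} (hd : d ≤ 0)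
    (p : MvPowerSeries σ R) : p ∈ wfil R w d :=
  fun α hα => absurd hα (not_lt.2 (hd.trans (weight_nonneg hw α)))

theorem wfil_pderiv {w : σ → ℤ} {d : ℤ} {p : MvPowerSeries σ R} (hp : p ∈ wfil R w d) (i : σ) :
    pderiv R i p ∈ wfil R w (d - w i) := by
  intro α hα
  rw [coeff_pderiv, hp _ (by rw [weight_add_single]; linarith), zero_mul]

theorem wfil_pderiv' {w : σ → ℤ} {d k : ℤ} {p : MvPowerSeries σ R} (hp : p ∈ wfil R w d) (i : σ)
    (h : k ≤ d - w i) : pderiv R i p ∈ wfil R w k :=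
  wfil_anti h (wfil_pderiv hp i)

theorem eq_zero_of_mem_wfil {w : σ → ℤ} {p : MvPowerSeries σ R}
    (h : ∀ k : ℕ, p ∈ wfil R w k) : p = 0 := by
  ext α
  refine h ((Finsupp.weight (R := ℕ) w α).toNat + 1) α ?_
  push_cast
  linarith [Int.self_le_toNat (Finsupp.weight (R := ℕ) w α)]

/-- Completeness of the filtration. The coefficient at α no longer changes once the index plus s
exceeds the weight of α, so it can be read off from a single term of the sequence. -/
theorem exists_limit {w : σ → ℤ} (P : ℕ → MvPowerSeries σ R) (s : ℤ)
    (h : ∀ k : ℕ, P (k + 1) - P k ∈ wfil R w (k + s)) :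
    ∃ p, ∀ k : ℕ, p - P k ∈ wfil R w (k + s) := by
  have key : ∀ k l : ℕ, k ≤ l → P l - P k ∈ wfil R w (k + s) := by
    intro k l hkl
    induction l, hkl using Nat.le_induction with
    | base => simp
    | succ l hl ih =>
      have := add_mem (wfil_anti (by gcongr) (h l)) ih
      simpa using this
  let N : (σ →₀ ℕ) → ℕ := fun α => (Finsupp.weight (R := ℕ) w α - s).toNat + 1
  have hN : ∀ α, Finsupp.weight (R := ℕ) w α < (N α : ℤ) + s := fun α => by
    have := Int.self_le_toNat (Finsupp.weight (R := ℕ) w α - s)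
    simp only [N]; push_cast; linarith
  refine ⟨ofCoeff fun α => coeff α (P (N α)), fun k α hα => ?_⟩
  rw [map_sub, sub_eq_zero, coeff_ofCoeff]
  rcases le_total k (N α) with hk | hk
  · have := key _ _ hk α hα
    rwa [map_sub, sub_eq_zero] at this
  · have := key _ _ hk α (hN α)
    rw [map_sub, sub_eq_zero] at this
    exact this.symm

theorem wfil_finsupp_prod {τ : Type*} {w : σ → ℤ} {v : τ → ℤ} {h : σ → MvPowerSeries τ R}
    (hh : ∀ i, h i ∈ wfil R v (w i)) (hv : ∀ i, 0 ≤ v i) (d : σ →₀ ℕ) :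
    (d.prod fun s e => h s ^ e) ∈ wfil R v (Finsupp.weight (R := ℕ) w d) := by
  classical
  induction d using Finsupp.induction_linear with
  | zero => simpa using mem_wfil_of_nonpos hv le_rfl 1
  | add f g hf hg =>
    rw [Finsupp.prod_add_index' (by simp) (fun _ _ _ => pow_add _ _ _), map_add]
    exact wfil_mul hf hg
  | single i k =>
    rw [Finsupp.prod_single_index (by simp), Finsupp.weight_single]
    induction k with
    | zero => simpa using mem_wfil_of_nonpos hv le_rfl 1
    | succ k ih => exact wfil_mul' ih (hh i) (by simp; linarith)

/-- Telescoping: pq − p'q' = p(q − q') + (p − p')q', so exchanging the factors one by one keeps the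
gain e. -/
theorem wfil_finsupp_prod_sub {τ : Type*} {w : σ → ℤ} {v : τ → ℤ} {h h' : σ → MvPowerSeries τ R}
    {e : ℤ} (hh : ∀ i, h i ∈ wfil R v (w i)) (hh' : ∀ i, h' i ∈ wfil R v (w i))
    (hd : ∀ i, h i - h' i ∈ wfil R v (w i + e)) (hv : ∀ i, 0 ≤ v i) (d : σ →₀ ℕ) :
    ((d.prod fun s e => h s ^ e) - d.prod fun s e => h' s ^ e) ∈
      wfil R v (Finsupp.weight (R := ℕ) w d + e) := by
  classical
  have key : ∀ {p p' q q' : MvPowerSeries τ R} {a b : ℤ}, p ∈ wfil R v a → q' ∈ wfil R v b →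
      p - p' ∈ wfil R v (a + e) → q - q' ∈ wfil R v (b + e) →
      p * q - p' * q' ∈ wfil R v (a + b + e) := by
    intro p p' q q' a b hp hq' hpp hqq
    have : p * q - p' * q' = p * (q - q') + (p - p') * q' := by ring
    rw [this]
    exact add_mem (wfil_mul' hp hqq (by linarith)) (wfil_mul' hpp hq' (by linarith))
  induction d using Finsupp.induction_linear with
  | zero => simp
  | add f g hf hg =>
    rw [Finsupp.prod_add_index' (by simp) (fun _ _ _ => pow_add _ _ _),
      Finsupp.prod_add_index' (by simp) (fun _ _ _ => pow_add _ _ _), map_add]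
    exact key (wfil_finsupp_prod hh hv f) (wfil_finsupp_prod hh' hv g) hf hg
  | single i k =>
    rw [Finsupp.prod_single_index (by simp), Finsupp.prod_single_index (by simp),
      Finsupp.weight_single]
    induction k with
    | zero => simp
    | succ k ih =>
      rw [pow_succ, pow_succ, add_smul, one_smul]
      refine key ?_ (hh' i) ih (hd i)
      have := wfil_finsupp_prod hh hv (Finsupp.single i k)
      rwa [Finsupp.prod_single_index (by simp), Finsupp.weight_single] at this

theorem subst_one {τ : Type*} {h : σ → MvPowerSeries τ R} (hs : HasSubst h) :
    subst h (1 : MvPowerSeries σ R) = 1 := by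
  rw [← coe_substAlgHom hs, map_one]

theorem subst_zero {τ : Type*} {h : σ → MvPowerSeries τ R} (hs : HasSubst h) :
    subst h (0 : MvPowerSeries σ R) = 0 := by
  rw [← coe_substAlgHom hs, map_zero]

theorem subst_C_eq {τ : Type*} {h : σ → MvPowerSeries τ R} (hs : HasSubst h) (r : R) :
    subst h (C r : MvPowerSeries σ R) = C r := by
  rw [← coe_substAlgHom hs]
  exact (substAlgHom hs).commutes r

theorem subst_sum {τ ι : Type*} {h : σ → MvPowerSeries τ R} (hs : HasSubst h) (s : Finset ι)
    (f : ι → MvPowerSeries σ R) : subst h (∑ i ∈ s, f i) = ∑ i ∈ s, subst h (f i) := by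
  simp only [← coe_substAlgHom hs, map_sum]

theorem subst_mem_wfil {τ : Type*} {w : σ → ℤ} {v : τ → ℤ} {h : σ → MvPowerSeries τ R}
    (hs : HasSubst h) (hh : ∀ i, h i ∈ wfil R v (w i)) (hv : ∀ i, 0 ≤ v i) {a : ℤ}
    {p : MvPowerSeries σ R} (hp : p ∈ wfil R w a) : subst h p ∈ wfil R v a := by
  intro α hα
  rw [coeff_subst hs]
  refine finsum_eq_zero_of_forall_eq_zero fun d => ?_
  by_cases hd : Finsupp.weight (R := ℕ) w d < a
  · rw [hp d hd, zero_smul]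
  · rw [wfil_finsupp_prod hh hv d α (by linarith), smul_zero]

/-- Substitution is Lipschitz in the substituted map: if two maps agree up to a gain of e, so do the
substituted series, monomial by monomial. This drives all estimates of the nonlinear terms. -/
theorem subst_sub_mem_wfil {τ : Type*} {w : σ → ℤ} {v : τ → ℤ} {h h' : σ → MvPowerSeries τ R}
    {e : ℤ} (hs : HasSubst h) (hs' : HasSubst h') (hh : ∀ i, h i ∈ wfil R v (w i))
    (hh' : ∀ i, h' i ∈ wfil R v (w i)) (hd : ∀ i, h i - h' i ∈ wfil R v (w i + e))
    (hv : ∀ i, 0 ≤ v i) {a : ℤ} {p : MvPowerSeries σ R} (hp : p ∈ wfil R w a) :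
    subst h p - subst h' p ∈ wfil R v (a + e) := by
  intro α hα
  rw [map_sub, coeff_subst hs, coeff_subst hs', ← finsum_sub_distrib (coeff_subst_finite hs p α)
    (coeff_subst_finite hs' p α)]
  refine finsum_eq_zero_of_forall_eq_zero fun d => ?_
  rw [← smul_sub, ← map_sub]
  by_cases hd' : Finsupp.weight (R := ℕ) w d < a
  · rw [hp d hd', zero_smul]
  · rw [wfil_finsupp_prod_sub hh hh' hd hv d α (by linarith), smul_zero]

theorem degree_le_weight {w : σ → ℤ} (hw : ∀ i, 1 ≤ w i) (α : σ →₀ ℕ) :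
    (α.degree : ℤ) ≤ Finsupp.weight (R := ℕ) w α := by
  rw [Finsupp.weight_apply, Finsupp.degree_apply, Finsupp.sum, Nat.cast_sum]
  exact Finset.sum_le_sum fun i _ => by
    rw [nsmul_eq_mul]; nlinarith [hw i, Int.natCast_nonneg (α i)]

/-- An additive map that raises filtration to within a fixed shift and kills polynomials is zero. -/
theorem eq_zero_of_polynomial [Finite σ] {w : σ → ℤ} (hw : ∀ i, 1 ≤ w i)
    (Δ : MvPowerSeries σ R →+ MvPowerSeries σ R) (s : ℤ)
    (hΔ : ∀ (d : ℤ) (p), p ∈ wfil R w d → Δ p ∈ wfil R w (d - s))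
    (h0 : ∀ p : MvPolynomial σ R, Δ p = 0) : Δ = 0 := by
  ext1 p
  refine eq_zero_of_mem_wfil (w := w) fun k => ?_
  -- As all weights are at least 1, the remainder after truncation at total degree N has weighted
  -- order at least N; Δ loses at most s of it.
  let N : ℕ := k + s.toNat
  have : Δ p = Δ (p - (truncTotal N p : MvPolynomial σ R)) := by rw [map_sub, h0, sub_zero]
  rw [this]
  refine wfil_anti (e := (N : ℤ) - s) ?_ (hΔ N _ ?_)
  · simp only [N]; push_cast; linarith [Int.self_le_toNat s]
  · intro α hα
    have h1 := degree_le_weight hw α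
    rw [map_sub, MvPolynomial.coeff_coe, coeff_truncTotal _ (by exact_mod_cast h1.trans_lt hα),
      sub_self]

/-- The difference of the two sides is additive in p and lowers the filtration by at most `w i`, so
`eq_zero_of_polynomial` reduces the chain rule to polynomials, where it follows from the Leibniz
rule by induction. -/
theorem pderiv_subst [Fintype σ] {w : σ → ℤ} (hw : ∀ i, 1 ≤ w i) {h : σ → MvPowerSeries σ R}
    (hs : HasSubst h) (hh : ∀ i, h i ∈ wfil R w (w i)) (i : σ) (p : MvPowerSeries σ R) :
    pderiv R i (subst h p) = ∑ j, subst h (pderiv R j p) * pderiv R i (h j) := by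
  have hw0 : ∀ i, 0 ≤ w i := fun i => by linarith [hw i]
  let Δ : MvPowerSeries σ R →+ MvPowerSeries σ R :=
    AddMonoidHom.mk' (fun p => pderiv R i (subst h p) -
      ∑ j, subst h (pderiv R j p) * pderiv R i (h j)) fun p q => by
        simp only [subst_add hs, map_add, add_mul, Finset.sum_add_distrib]; ring
  have : Δ = 0 := by
    refine eq_zero_of_polynomial hw Δ (w i) (fun d p hp => ?_) fun p => ?_
    · refine sub_mem (wfil_pderiv (subst_mem_wfil hs hh hw0 hp) i) (sum_mem fun j _ => ?_)
      exact wfil_mul' (subst_mem_wfil hs hh hw0 (wfil_pderiv hp j)) (wfil_pderiv (hh j) i)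
        (by linarith)
    · induction p using MvPolynomial.induction_on with
      | C r =>
        change pderiv R i (subst h _) - _ = 0
        rw [MvPolynomial.coe_C, subst_C_eq hs]
        simp [subst_zero hs]
      | add p q hp hq => rw [MvPolynomial.coe_add, map_add, hp, hq, add_zero]
      | mul_X p k hp =>
        classical
        replace hp : pderiv R i (subst h (p : MvPowerSeries σ R)) -
          ∑ j, subst h (pderiv R j (p : MvPowerSeries σ R)) * pderiv R i (h j) = 0 := hp
        change pderiv R i (subst h _) - ∑ j, _ = 0
        simp only [MvPolynomial.coe_mul, MvPolynomial.coe_X, Derivation.leibniz, subst_mul hs,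
          subst_add hs, subst_X hs, smul_eq_mul, add_mul, Finset.sum_add_distrib, pderiv_X]
        rw [Finset.sum_eq_single k]
        · rw [sub_eq_zero] at hp
          rw [hp]
          simp only [Pi.single_eq_same, subst_one hs, Finset.mul_sum]
          simp only [mul_one, mul_assoc]
          ring
        · intro j _ hj
          simp [Pi.single_eq_of_ne hj.symm, subst_zero hs]
        · simp
  have h1 := DFunLike.congr_fun this p
  exact sub_eq_zero.1 h1

end Graded

end FormalCR

/-! ### Power series in z, z̄, u: weights, conjugation, bidegrees and Euler operators -/

namespace FormalCR

open MvPowerSeries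

/-- Formal power series in `(z, z̄, u)` with coefficients in `R`. -/
abbrev PS (n : ℕ) (R : Type*) : Type _ := MvPowerSeries (Var n) R

/-- The weights `1, 1, 2` of `z`, `z̄`, `u`. -/
def wwt {n : ℕ} : Var n → ℤ := Sum.elim 1 (Sum.elim 1 2)

/-- The bidegree in `z` and `z̄`. -/
def wbi {n : ℕ} : Var n → ℤ × ℤ := Sum.elim (fun _ => (1, 0)) (Sum.elim (fun _ => (0, 1)) 0)

theorem wwt_z {n : ℕ} (j : Fin n) : wwt (iz j) = 1 := rfl
theorem wwt_zb {n : ℕ} (j : Fin n) : wwt (izb j) = 1 := rfl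
theorem wwt_u {n : ℕ} : wwt (iu : Var n) = 2 := rfl
theorem wbi_z {n : ℕ} (j : Fin n) : wbi (iz j) = (1, 0) := rfl
theorem wbi_zb {n : ℕ} (j : Fin n) : wbi (izb j) = (0, 1) := rfl
theorem wbi_u {n : ℕ} : wbi (iu : Var n) = 0 := rfl

theorem one_le_wwt {n : ℕ} (i : Var n) : 1 ≤ wwt i := by
  rcases i with i | i | i <;> simp [wwt]

theorem wwt_nonneg {n : ℕ} (i : Var n) : 0 ≤ wwt i := zero_le_one.trans (one_le_wwt i)

theorem weight_wwt {n : ℕ} (α : MIdx n) : Finsupp.weight (R := ℕ) wwt α =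
    ((∑ j, α (iz j) : ℕ) : ℤ) + ((∑ j, α (izb j) : ℕ) : ℤ) + 2 * (α iu : ℕ) := by
  rw [Finsupp.weight_eq_sum, Fintype.sum_sum_type, Fintype.sum_sum_type]
  simp [wwt, mul_comm, add_assoc]

theorem weight_wbi {n : ℕ} (α : MIdx n) : Finsupp.weight (R := ℕ) wbi α =
    (((∑ j, α (iz j) : ℕ) : ℤ), ((∑ j, α (izb j) : ℕ) : ℤ)) := by
  rw [Finsupp.weight_eq_sum, Fintype.sum_sum_type, Fintype.sum_sum_type]
  ext <;> simp [wbi, Prod.fst_sum, Prod.snd_sum]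

section Bar

variable {n : ℕ} {R : Type*} [CommRing R] [StarRing R]

/-- Complex conjugation of power series in `(z, z̄, u)`. -/
def bar : PS n R →+* PS n R :=
  (map (starRingEnd R)).comp
    (renameEquiv R (swapVar n) : PS n R ≃ₐ[R] PS n R).toRingEquiv.toRingHom

/-- The exchange of the exponents of `z_j` and `z̄_j`. -/
def swapIdx (α : MIdx n) : MIdx n := Finsupp.equivMapDomain (swapVar n) α

theorem swapVar_swapVar (i : Var n) : swapVar n (swapVar n i) = i := (swapVar n).left_inv i

theorem swapVar_symm : (swapVar n).symm = swapVar n := rfl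

theorem swapIdx_apply (α : MIdx n) (i : Var n) : swapIdx α i = α (swapVar n i) := by
  rw [swapIdx, Finsupp.equivMapDomain_apply, swapVar_symm]

@[simp]
theorem swapIdx_swapIdx (α : MIdx n) : swapIdx (swapIdx α) = α := by
  ext i; rw [swapIdx_apply, swapIdx_apply, swapVar_swapVar]

theorem swapIdx_add (α β : MIdx n) : swapIdx (α + β) = swapIdx α + swapIdx β := by
  ext i; simp [swapIdx_apply]

theorem swapIdx_single (i : Var n) (k : ℕ) :
    swapIdx (Finsupp.single i k) = Finsupp.single (swapVar n i) k := by
  rw [swapIdx, Finsupp.equivMapDomain_single]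

theorem coeff_bar (α : MIdx n) (p : PS n R) : coeff α (bar p) = star (coeff (swapIdx α) p) := by
  have h : α = Finsupp.embDomain (swapVar n).toEmbedding (swapIdx α) := by
    rw [Finsupp.embDomain_eq_mapDomain]
    ext i
    conv_rhs => rw [← swapVar_swapVar i]
    erw [Finsupp.mapDomain_apply (swapVar n).injective, swapIdx_apply, swapVar_swapVar]
  change starRingEnd R (coeff α (rename (swapVar n) p)) = _
  conv_lhs => rw [h]
  erw [coeff_embDomain_rename]
  rfl

@[simp]
theorem bar_bar (p : PS n R) : bar (bar p) = p := by
  ext α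
  simp [coeff_bar]

theorem bar_injective : Function.Injective (bar : PS n R → PS n R) := fun p q h => by
  rw [← bar_bar p, h, bar_bar]

@[simp]
theorem bar_X (i : Var n) : bar (X i : PS n R) = X (swapVar n i) := by
  change MvPowerSeries.map (starRingEnd R) (rename (swapVar n) (X i : PS n R)) = _
  rw [rename_X, map_X]

theorem bar_X_z (j : Fin n) : bar (X (iz j) : PS n R) = X (izb j) := bar_X _
theorem bar_X_zb (j : Fin n) : bar (X (izb j) : PS n R) = X (iz j) := bar_X _
theorem bar_X_u : bar (X iu : PS n R) = X iu := bar_X _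

@[simp]
theorem bar_C (r : R) : bar (C r : PS n R) = C (star r) := by
  change MvPowerSeries.map (starRingEnd R) (rename (swapVar n) (C r : PS n R)) = _
  rw [rename_C, map_C]
  rfl

theorem bar_pderiv (i : Var n) (p : PS n R) :
    bar (pderiv R i p) = pderiv R (swapVar n i) (bar p) := by
  ext α
  rw [coeff_bar, coeff_pderiv, coeff_pderiv, coeff_bar, swapIdx_add, swapIdx_single,
    swapVar_swapVar, star_mul', swapIdx_apply]
  simp

theorem bar_pderiv_z (j : Fin n) (p : PS n R) :
    bar (pderiv R (iz j) p) = pderiv R (izb j) (bar p) := bar_pderiv _ _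
theorem bar_pderiv_zb (j : Fin n) (p : PS n R) :
    bar (pderiv R (izb j) p) = pderiv R (iz j) (bar p) := bar_pderiv _ _
theorem bar_pderiv_u (p : PS n R) : bar (pderiv R iu p) = pderiv R iu (bar p) := bar_pderiv _ _

theorem weight_wwt_swapIdx (α : MIdx n) :
    Finsupp.weight (R := ℕ) wwt (swapIdx α) = Finsupp.weight (R := ℕ) wwt α := by
  simp only [weight_wwt, swapIdx_apply]
  simp only [swapVar, Equiv.coe_fn_mk]
  ring

theorem weight_wbi_swapIdx (α : MIdx n) :
    Finsupp.weight (R := ℕ) wbi (swapIdx α) = (Finsupp.weight (R := ℕ) wbi α).swap := by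
  simp only [weight_wbi, swapIdx_apply]
  simp [swapVar]

theorem bar_mem_wfil {d : ℤ} {p : PS n R} (hp : p ∈ wfil R wwt d) : bar p ∈ wfil R wwt d := by
  intro α hα
  rw [coeff_bar, hp _ (by rwa [weight_wwt_swapIdx]), star_zero]

theorem comp_wwt_bar (d : ℤ) (p : PS n R) : comp wwt d (bar p) = bar (comp wwt d p) := by
  ext α
  simp only [coeff_comp, coeff_bar, weight_wwt_swapIdx]
  split_ifs <;> simp

/-- The component of bidegree `(a, b)` in `(z, z̄)`. -/
def cp (a b : ℤ) : PS n R →ₗ[R] PS n R := comp wbi (a, b)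

theorem cp_bar (a b : ℤ) (p : PS n R) : cp a b (bar p) = bar (cp b a p) := by
  ext α
  have h : (b, a) = Prod.swap (a, b) := rfl
  simp only [cp, coeff_comp, coeff_bar, weight_wbi_swapIdx, h, Prod.swap_inj]
  split_ifs <;> simp

end Bar

section Components

variable {n : ℕ} {R : Type*} [CommRing R]

theorem coeff_cp (a b : ℤ) (p : PS n R) (α : MIdx n) : coeff α (cp a b p) =
    if ((∑ j, α (iz j) : ℕ) : ℤ) = a ∧ ((∑ j, α (izb j) : ℕ) : ℤ) = b then coeff α p else 0 := by
  simp only [cp, coeff_comp, weight_wbi, Prod.mk.injEq]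

theorem cp_C_mul (a b : ℤ) (r : R) (p : PS n R) : cp a b (C r * p) = C r * cp a b p :=
  comp_C_mul _ _ _ _

theorem cp_z_mul (a b : ℤ) (j : Fin n) (p : PS n R) :
    cp a b (X (iz j) * p) = X (iz j) * cp (a - 1) b p := by
  rw [cp, comp_X_mul, wbi_z, Prod.mk_sub_mk, sub_zero, cp]

theorem cp_zb_mul (a b : ℤ) (j : Fin n) (p : PS n R) :
    cp a b (X (izb j) * p) = X (izb j) * cp a (b - 1) p := by
  rw [cp, comp_X_mul, wbi_zb, Prod.mk_sub_mk, sub_zero, cp]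

theorem cp_pderiv_z (a b : ℤ) (j : Fin n) (p : PS n R) :
    cp a b (pderiv R (iz j) p) = pderiv R (iz j) (cp (a + 1) b p) := by
  rw [cp, comp_pderiv, wbi_z, Prod.mk_add_mk, add_zero, cp]

theorem cp_pderiv_zb (a b : ℤ) (j : Fin n) (p : PS n R) :
    cp a b (pderiv R (izb j) p) = pderiv R (izb j) (cp a (b + 1) p) := by
  rw [cp, comp_pderiv, wbi_zb, Prod.mk_add_mk, add_zero, cp]

theorem cp_pderiv_u (a b : ℤ) (p : PS n R) :
    cp a b (pderiv R iu p) = pderiv R iu (cp a b p) := by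
  rw [cp, comp_pderiv, wbi_u, add_zero]

theorem cp_of_neg_left {a b : ℤ} (h : a < 0) (p : PS n R) : cp a b p = 0 := by
  ext α
  rw [coeff_cp, coeff_zero, if_neg]
  rintro ⟨h1, -⟩
  omega

theorem cp_of_neg_right {a b : ℤ} (h : b < 0) (p : PS n R) : cp a b p = 0 := by
  ext α
  rw [coeff_cp, coeff_zero, if_neg]
  rintro ⟨-, h1⟩
  omega

theorem cp_cp (a b a' b' : ℤ) (p : PS n R) :
    cp a b (cp a' b' p) = if a = a' ∧ b = b' then cp a b p else 0 := by
  rw [cp, cp, comp_comp_self]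
  simp only [Prod.mk.injEq]

theorem cp_cp_self (a b : ℤ) (p : PS n R) : cp a b (cp a b p) = cp a b p := by
  simp [cp_cp]

theorem cp_ext {p q : PS n R} (h : ∀ a b : ℕ, cp a b p = cp a b q) : p = q := by
  refine eq_of_comp_eq wbi fun m => ?_
  obtain ⟨a, b⟩ := m
  change cp a b p = cp a b q
  rcases lt_or_ge a 0 with ha | ha
  · rw [cp_of_neg_left ha, cp_of_neg_left ha]
  rcases lt_or_ge b 0 with hb | hb
  · rw [cp_of_neg_right hb, cp_of_neg_right hb]
  lift a to ℕ using ha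
  lift b to ℕ using hb
  exact h a b

/-- The Euler operator `∑ z_k ∂/∂z_k`. -/
def ee : PS n R →ₗ[R] PS n R :=
  ∑ k, (LinearMap.mulLeft R (X (iz k))).comp (pderiv R (iz k)).toLinearMap

/-- The conjugate Euler operator `∑ z̄_k ∂/∂z̄_k`. -/
def eb : PS n R →ₗ[R] PS n R :=
  ∑ k, (LinearMap.mulLeft R (X (izb k))).comp (pderiv R (izb k)).toLinearMap

theorem ee_apply (p : PS n R) : ee p = ∑ k, X (iz k) * pderiv R (iz k) p := by
  simp [ee, LinearMap.sum_apply]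

theorem eb_apply (p : PS n R) : eb p = ∑ k, X (izb k) * pderiv R (izb k) p := by
  simp [eb, LinearMap.sum_apply]

theorem coeff_ee (p : PS n R) (α : MIdx n) :
    coeff α (ee p) = ((∑ j, α (iz j) : ℕ) : R) * coeff α p := by
  simp only [ee_apply, map_sum, coeff_X_mul_pderiv, Nat.cast_sum, Finset.sum_mul]

theorem coeff_eb (p : PS n R) (α : MIdx n) :
    coeff α (eb p) = ((∑ j, α (izb j) : ℕ) : R) * coeff α p := by
  simp only [eb_apply, map_sum, coeff_X_mul_pderiv, Nat.cast_sum, Finset.sum_mul]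

theorem coeff_intCast_mul (a : ℤ) (p : PS n R) (α : MIdx n) :
    coeff α ((a : PS n R) * p) = (a : R) * coeff α p := by
  rw [← map_intCast (C : R →+* PS n R), coeff_C_mul]

theorem cp_ee (a b : ℤ) (p : PS n R) : cp a b (ee p) = (a : PS n R) * cp a b p := by
  ext α
  rw [coeff_intCast_mul]
  simp only [coeff_cp, coeff_ee]
  split_ifs with h
  · rw [← h.1, Int.cast_natCast]
  · rw [mul_zero]

theorem cp_eb (a b : ℤ) (p : PS n R) : cp a b (eb p) = (b : PS n R) * cp a b p := by
  ext α
  rw [coeff_intCast_mul]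
  simp only [coeff_cp, coeff_eb]
  split_ifs with h
  · rw [← h.2, Int.cast_natCast]
  · rw [mul_zero]

theorem ee_cp (a b : ℤ) (p : PS n R) : ee (cp a b p) = (a : PS n R) * cp a b p := by
  ext α
  rw [coeff_intCast_mul, coeff_ee]
  simp only [coeff_cp]
  split_ifs with h
  · rw [← h.1, Int.cast_natCast]
  · rw [mul_zero, mul_zero]

theorem eb_cp (a b : ℤ) (p : PS n R) : eb (cp a b p) = (b : PS n R) * cp a b p := by
  ext α
  rw [coeff_intCast_mul, coeff_eb]
  simp only [coeff_cp]
  split_ifs with h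
  · rw [← h.2, Int.cast_natCast]
  · rw [mul_zero, mul_zero]

theorem bar_ee [StarRing R] (p : PS n R) : bar (ee p) = eb (bar p) := by
  simp only [ee_apply, eb_apply, map_sum, map_mul, bar_X_z, bar_pderiv_z]

theorem bar_eb [StarRing R] (p : PS n R) : bar (eb p) = ee (bar p) := by
  simp only [ee_apply, eb_apply, map_sum, map_mul, bar_X_zb, bar_pderiv_zb]

theorem pderiv_comm (i j : Var n) (p : PS n R) :
    pderiv R i (pderiv R j p) = pderiv R j (pderiv R i p) := by
  classical
  ext α
  simp only [coeff_pderiv, Finsupp.add_apply]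
  rw [add_right_comm]
  by_cases h : i = j
  · subst h; ring
  · rw [Finsupp.single_apply, Finsupp.single_apply, if_neg h, if_neg (Ne.symm h)]
    push_cast; ring

theorem pderiv_C_mul (i : Var n) (r : R) (p : PS n R) :
    pderiv R i (C r * p) = C r * pderiv R i p := by
  rw [← smul_eq_C_mul, ← smul_eq_C_mul, Derivation.map_smul]

end Components

section Scalars

variable {n : ℕ} {R : Type*} [CommRing R] [Algebra ℂ R]

/-- Complex constants as power series. -/
def cst : ℂ →+* PS n R := C.comp (algebraMap ℂ R)

theorem cst_def (x : ℂ) : (cst x : PS n R) = C (algebraMap ℂ R x) := rfl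

/-- The constant power series `i`. -/
def Ic : PS n R := cst Complex.I

theorem Ic_mul_Ic : (Ic : PS n R) * Ic = -1 := by
  rw [Ic, ← map_mul, Complex.I_mul_I, map_neg, map_one]

theorem cp_cst_mul (a b : ℤ) (x : ℂ) (p : PS n R) : cp a b (cst x * p) = cst x * cp a b p :=
  cp_C_mul _ _ _ _

theorem cp_Ic_mul (a b : ℤ) (p : PS n R) : cp a b (Ic * p) = Ic * cp a b p :=
  cp_C_mul _ _ _ _

theorem pderiv_cst_mul (i : Var n) (x : ℂ) (p : PS n R) :
    pderiv R i (cst x * p) = cst x * pderiv R i p := pderiv_C_mul _ _ _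

theorem pderiv_Ic_mul (i : Var n) (p : PS n R) :
    pderiv R i (Ic * p) = Ic * pderiv R i p := pderiv_C_mul _ _ _

theorem bar_cst [StarRing R] [StarModule ℂ R] (x : ℂ) : bar (cst x : PS n R) = cst (star x) := by
  rw [cst_def, bar_C, cst_def, algebraMap_star_comm]

theorem bar_Ic [StarRing R] [StarModule ℂ R] : bar (Ic : PS n R) = -Ic := by
  rw [Ic, bar_cst, ← map_neg]
  simp

/-- Nonzero integers are invertible because R is a ℂ-algebra; no assumption on zero divisors is
needed. -/
theorem intCast_mul_cancel {a : ℤ} (ha : a ≠ 0) {p q : PS n R} (h : (a : PS n R) * p = a * q) :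
    p = q := by
  have h1 : (cst ((a : ℂ)⁻¹) : PS n R) * a = 1 := by
    rw [← map_intCast (cst : ℂ →+* PS n R), ← map_mul, inv_mul_cancel₀ (by exact_mod_cast ha),
      map_one]
  linear_combination (cst ((a : ℂ)⁻¹) : PS n R) * h - (p - q) * h1

theorem two_mul_cancel {p q : PS n R} (h : 2 * p = 2 * q) : p = q :=
  intCast_mul_cancel (a := 2) (by norm_num) (by exact_mod_cast h)

theorem Ic_mul_cancel {p q : PS n R} (h : Ic * p = Ic * q) : p = q := by
  linear_combination (-Ic : PS n R) * h + (p - q) * (Ic_mul_Ic : (Ic : PS n R) * Ic = -1)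

theorem two_mul_half : (2 : PS n R) * cst (1 / 2) = 1 := by
  rw [← map_ofNat (cst : ℂ →+* PS n R) 2, ← map_mul]; norm_num

end Scalars

end FormalCR

/-! ### The model: its radial operators and the components of the linearized transformation -/

namespace FormalCR

open MvPowerSeries

/-- The Levi form and the transversal non-integrability form at `0`, with the inverses that strong
nondegeneracy provides. -/
structure Frame (n : ℕ) (R : Type*) [CommRing R] [StarRing R] [Algebra ℂ R] where
  c : Matrix (Fin n) (Fin n) R
  nn : Matrix (Fin n) (Fin n) R
  cinv : Matrix (Fin n) (Fin n) R
  star_c : ∀ j k, star (c j k) = c k j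
  nn_anti : ∀ j k, nn j k = -nn k j
  c_mul_cinv : c * cinv = 1
  strong : IsUnit (Matrix.fromBlocks nn (algebraMap ℂ R (-6 * Complex.I) • c.map (starRingEnd R))
    (algebraMap ℂ R (6 * Complex.I) • c) (nn.map (starRingEnd R))).det

section Vectors

variable {n : ℕ} {R : Type*} [CommRing R]

/-- Components of bidegree `(a, b)` of a vector of power series. -/
def cpv (a b : ℤ) (f : Fin n → PS n R) : Fin n → PS n R := fun k => cp a b (f k)

/-- The `u`-derivative of a vector of power series. -/
def duv (f : Fin n → PS n R) : Fin n → PS n R := fun k => pderiv R iu (f k)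

theorem cpv_of_neg_left {a b : ℤ} (h : a < 0) (f : Fin n → PS n R) : cpv a b f = 0 :=
  funext fun _ => cp_of_neg_left h _

theorem cpv_of_neg_right {a b : ℤ} (h : b < 0) (f : Fin n → PS n R) : cpv a b f = 0 :=
  funext fun _ => cp_of_neg_right h _

theorem cpv_duv (a b : ℤ) (f : Fin n → PS n R) : cpv a b (duv f) = duv (cpv a b f) :=
  funext fun _ => cp_pderiv_u _ _ _

end Vectors

namespace Frame

variable {n : ℕ} {R : Type*} [CommRing R] [StarRing R] [Algebra ℂ R] (Φ : Frame n R)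

/-- The hermitian form `∑ c_{jk} z̄_j z_k`. -/
def Q : PS n R := ∑ j, ∑ k, C (Φ.c j k) * (X (izb j) * X (iz k))

/-- `𝓛(z̄, f) = ∑ c_{jk} z̄_j f_k`. -/
def CC : (Fin n → PS n R) →ₗ[PS n R] PS n R :=
  ∑ j, ∑ k, LinearMap.mulLeft (PS n R) (C (Φ.c j k) * X (izb j)) ∘ₗ LinearMap.proj k

/-- `𝓝(z, f) = ∑ N_{jk} z_j f_k`. -/
def NN : (Fin n → PS n R) →ₗ[PS n R] PS n R :=
  ∑ j, ∑ k, LinearMap.mulLeft (PS n R) (C (Φ.nn j k) * X (iz j)) ∘ₗ LinearMap.proj k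

theorem CC_apply (f : Fin n → PS n R) :
    Φ.CC f = ∑ j, ∑ k, C (Φ.c j k) * (X (izb j) * f k) := by
  simp [CC, LinearMap.sum_apply]

theorem NN_apply (f : Fin n → PS n R) :
    Φ.NN f = ∑ j, ∑ k, C (Φ.nn j k) * (X (iz j) * f k) := by
  simp [NN, LinearMap.sum_apply]

theorem cp_CC (a b : ℤ) (f : Fin n → PS n R) :
    cp a b (Φ.CC f) = Φ.CC (cpv a (b - 1) f) := by
  simp only [CC_apply, map_sum, cp_C_mul, cp_zb_mul, cpv]

theorem cp_NN (a b : ℤ) (f : Fin n → PS n R) :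
    cp a b (Φ.NN f) = Φ.NN (cpv (a - 1) b f) := by
  simp only [NN_apply, map_sum, cp_C_mul, cp_z_mul, cpv]

theorem CC_duv (f : Fin n → PS n R) : Φ.CC (duv f) = pderiv R iu (Φ.CC f) := by
  simp [CC_apply, map_sum, duv]

theorem NN_duv (f : Fin n → PS n R) : Φ.NN (duv f) = pderiv R iu (Φ.NN f) := by
  simp [NN_apply, map_sum, duv]

theorem bar_Q : bar Φ.Q = Φ.Q := by
  simp only [Q, map_sum, map_mul, bar_C, bar_X_z, bar_X_zb, Φ.star_c]
  rw [Finset.sum_comm]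
  exact Finset.sum_congr rfl fun j _ => Finset.sum_congr rfl fun k _ => by rw [mul_comm (X _)]

theorem cp_Q_mul (a b : ℤ) (p : PS n R) :
    cp a b (Φ.Q * p) = Φ.Q * cp (a - 1) (b - 1) p := by
  simp only [Q, Finset.sum_mul, map_sum, mul_assoc, cp_C_mul, cp_zb_mul, cp_z_mul]

theorem pderiv_u_Q_mul (p : PS n R) : pderiv R iu (Φ.Q * p) = Φ.Q * pderiv R iu p := by
  have : pderiv R iu Φ.Q = 0 := by
    simp [Q, map_sum]
  rw [Derivation.leibniz, this, smul_zero, add_zero, smul_eq_mul]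

/-- The operator `∑ z_k ∂/∂z_k + iQ ∂/∂u`. -/
def DD (p : PS n R) : PS n R := ee p + Ic * Φ.Q * pderiv R iu p

/-- The conjugate operator `∑ z̄_k ∂/∂z̄_k - iQ ∂/∂u`. -/
def DDb (p : PS n R) : PS n R := eb p - Ic * Φ.Q * pderiv R iu p

theorem DD_add (p q : PS n R) : Φ.DD (p + q) = Φ.DD p + Φ.DD q := by
  simp only [DD, map_add]; ring

theorem DDb_add (p q : PS n R) : Φ.DDb (p + q) = Φ.DDb p + Φ.DDb q := by
  simp only [DDb, map_add]; ring

theorem bar_DD [StarModule ℂ R] (p : PS n R) : bar (Φ.DD p) = Φ.DDb (bar p) := by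
  simp only [DD, DDb, map_add, map_mul, bar_Ic, bar_Q, bar_ee, bar_pderiv_u]; ring

theorem bar_DDb [StarModule ℂ R] (p : PS n R) : bar (Φ.DDb p) = Φ.DD (bar p) := by
  rw [← bar_injective.eq_iff, bar_DD, bar_bar, bar_bar]

/-- The radial part of the `w`-component of the linearized transformation. -/
def TT (f : Fin n → PS n R) (g : PS n R) : PS n R :=
  Φ.DD g - Ic * Φ.CC (fun k => Φ.DD (f k)) - Ic * bar (Φ.CC f)
    - cst (1 / 2) * Φ.NN (fun k => Φ.DD (f k) - f k)

theorem TT_add (f f' : Fin n → PS n R) (g g' : PS n R) :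
    Φ.TT (f + f') (g + g') = Φ.TT f g + Φ.TT f' g' := by
  have h1 : (fun k => Φ.DD ((f + f') k)) = (fun k => Φ.DD (f k)) + fun k => Φ.DD (f' k) :=
    funext fun k => Φ.DD_add _ _
  have h2 : (fun k => Φ.DD ((f + f') k) - (f + f') k) =
      (fun k => Φ.DD (f k) - f k) + fun k => Φ.DD (f' k) - f' k :=
    funext fun k => by simp only [Pi.add_apply, DD_add]; ring
  simp only [TT, h1, h2, map_add, DD_add]
  ring

section Homogeneous

variable {f : Fin n → PS n R} (hf : ∀ k, Φ.DDb (f k) = 0)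

include hf

/-- The bidegree (a,b) part of `DDb` f = 0. It expresses f_{ab} with b > 0 through the u-derivative
of f_{a−1,b−1}, hence all of f through the components f_{a0}. -/
theorem natCast_smul_cpv (a b : ℤ) :
    (b : PS n R) • cpv a b f = (Ic * Φ.Q) • duv (cpv (a - 1) (b - 1) f) := by
  funext k
  have h := congrArg (cp a b) (hf k)
  simp only [DDb, map_sub, mul_assoc, cp_Ic_mul, cp_Q_mul, cp_pderiv_u, cp_eb, map_zero] at h
  simp only [Pi.smul_apply, smul_eq_mul, cpv, duv, mul_assoc]
  linear_combination h

/-- On the kernel of `DDb` the term iQ ∂/∂u is the conjugate Euler operator. Hence `DD` multiplies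
f_{ab} by a + b, which makes every component of `TT` explicit. -/
theorem DD_eq (k : Fin n) : Φ.DD (f k) = ee (f k) + eb (f k) := by
  have h := hf k
  simp only [DDb] at h
  simp only [DD]
  linear_combination -h

theorem cp_TT (g : PS n R) (a b : ℤ) : cp a b (Φ.TT f g) =
    (a : PS n R) * cp a b g + Ic * Φ.Q * pderiv R iu (cp (a - 1) (b - 1) g)
      - (a + b - 1 : PS n R) * Ic * Φ.CC (cpv a (b - 1) f) - Ic * bar (Φ.CC (cpv b (a - 1) f))
      - (a + b - 2 : PS n R) * cst (1 / 2) * Φ.NN (cpv (a - 1) b f) := by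
  have h1 : cpv a (b - 1) (fun k => Φ.DD (f k)) = (a + b - 1 : PS n R) • cpv a (b - 1) f := by
    funext k
    simp only [cpv, Φ.DD_eq hf, map_add, cp_ee, cp_eb, Pi.smul_apply, smul_eq_mul]
    push_cast; ring
  have h2 : cpv (a - 1) b (fun k => Φ.DD (f k) - f k) =
      (a + b - 2 : PS n R) • cpv (a - 1) b f := by
    funext k
    simp only [cpv, Φ.DD_eq hf, map_add, map_sub, cp_ee, cp_eb, Pi.smul_apply, smul_eq_mul]
    push_cast; ring
  simp only [TT, DD, map_sub, map_add, mul_assoc, cp_Ic_mul, cp_cst_mul, cp_Q_mul, cp_pderiv_u,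
    cp_ee, cp_bar]
  simp only [cp_CC, cp_NN] at *
  simp only [DD] at h1 h2
  simp only [mul_assoc] at h1 h2
  rw [h1, h2, map_smul, map_smul, smul_eq_mul, smul_eq_mul]
  ring

/-- The recursion lowers both degrees by one, so for b > a it ends at a negative degree in z; the
divisor b stays positive on the way. -/
theorem cpv_of_lt {a b : ℤ} (h : a < b) : cpv a b f = 0 := by
  rcases lt_or_ge a 0 with ha | ha
  · exact cpv_of_neg_left ha f
  lift a to ℕ using ha
  have hd : duv (0 : Fin n → PS n R) = 0 := by funext k; simp [duv]
  have key : ∀ (a b : ℤ), a < b → 0 ≤ a → cpv (a - 1) (b - 1) f = 0 → cpv a b f = 0 := by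
    intro a b hab ha h0
    have h := Φ.natCast_smul_cpv hf a b
    rw [h0, hd, smul_zero] at h
    funext k
    refine intCast_mul_cancel (a := b) (by omega) ?_
    simpa using congrFun h k
  induction a generalizing b with
  | zero => exact key _ _ h le_rfl (cpv_of_neg_left (by simp) f)
  | succ a ih => exact key _ _ h (by positivity) (by simpa using ih (b := b - 1) (by push_cast at h; omega))

theorem mul_CC_cpv (a b : ℤ) : (b : PS n R) * Φ.CC (cpv a b f) =
    Ic * (Φ.Q * pderiv R iu (Φ.CC (cpv (a - 1) (b - 1) f))) := by
  rw [← smul_eq_mul, ← map_smul, Φ.natCast_smul_cpv hf, map_smul, smul_eq_mul, CC_duv, mul_assoc]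

theorem mul_NN_cpv (a b : ℤ) : (b : PS n R) * Φ.NN (cpv a b f) =
    Ic * (Φ.Q * pderiv R iu (Φ.NN (cpv (a - 1) (b - 1) f))) := by
  rw [← smul_eq_mul, ← map_smul, Φ.natCast_smul_cpv hf, map_smul, smul_eq_mul, NN_duv, mul_assoc]

theorem pderiv_CC_cpv (a : ℤ) : pderiv R iu (Φ.CC (cpv a 1 f)) =
    Ic * (Φ.Q * pderiv R iu (pderiv R iu (Φ.CC (cpv (a - 1) 0 f)))) := by
  have h := congrArg (pderiv R iu) (Φ.mul_CC_cpv hf a 1)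
  simpa [pderiv_Ic_mul, pderiv_u_Q_mul, -Derivation.leibniz] using h

theorem pderiv_NN_cpv (a : ℤ) : pderiv R iu (Φ.NN (cpv a 1 f)) =
    Ic * (Φ.Q * pderiv R iu (pderiv R iu (Φ.NN (cpv (a - 1) 0 f)))) := by
  have h := congrArg (pderiv R iu) (Φ.mul_NN_cpv hf a 1)
  simpa [pderiv_Ic_mul, pderiv_u_Q_mul, -Derivation.leibniz] using h

/-- Two steps of the recursion: the factors iQ multiply to −Q² and two u-derivatives of the
component of degree zero in z̄ appear. -/
theorem two_mul_CC_cpv (a : ℤ) : 2 * Φ.CC (cpv a 2 f) =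
    -(Φ.Q * (Φ.Q * pderiv R iu (pderiv R iu (Φ.CC (cpv (a - 1 - 1) 0 f))))) := by
  have h := Φ.mul_CC_cpv hf a 2
  norm_num [Φ.pderiv_CC_cpv hf, -Derivation.leibniz] at h
  rw [h]
  linear_combination (Φ.Q * (Φ.Q * pderiv R iu (pderiv R iu (Φ.CC (cpv (a - 1 - 1) 0 f))))) *
    (Ic_mul_Ic : (Ic : PS n R) * Ic = -1)

theorem two_mul_NN_cpv (a : ℤ) : 2 * Φ.NN (cpv a 2 f) =
    -(Φ.Q * (Φ.Q * pderiv R iu (pderiv R iu (Φ.NN (cpv (a - 1 - 1) 0 f))))) := by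
  have h := Φ.mul_NN_cpv hf a 2
  norm_num [Φ.pderiv_NN_cpv hf, -Derivation.leibniz] at h
  rw [h]
  linear_combination (Φ.Q * (Φ.Q * pderiv R iu (pderiv R iu (Φ.NN (cpv (a - 1 - 1) 0 f))))) *
    (Ic_mul_Ic : (Ic : PS n R) * Ic = -1)

variable [StarModule ℂ R] {g : PS n R} (hg : bar g = g)
  (hT : Φ.TT f g + bar (Φ.TT f g) = 0)

include hg hT

/-- As g and Q are real, the terms iQ ∂g/∂u of `TT` and of its conjugate cancel, and the two Euler
terms add up to (a + b) g_{ab}. Skewness therefore expresses g through f, except in bidegree (0,0).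
-/
theorem add_mul_cp (a b : ℤ) : (a + b : PS n R) * cp a b g = (a + b - 2 : PS n R) *
    (Ic * Φ.CC (cpv a (b - 1) f) - Ic * bar (Φ.CC (cpv b (a - 1) f))
      + cst (1 / 2) * Φ.NN (cpv (a - 1) b f)
      + cst (1 / 2) * bar (Φ.NN (cpv (b - 1) a f))) := by
  have h := congrArg (cp a b) hT
  have hg1 : bar (cp b a g) = cp a b g := by rw [← cp_bar, hg]
  have hg2 : bar (cp (b - 1) (a - 1) g) = cp (a - 1) (b - 1) g := by rw [← cp_bar, hg]
  have hc : (starRingEnd ℂ) (1 / 2) = 1 / 2 := by rw [map_div₀, map_one, map_ofNat]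
  rw [map_add, cp_bar, Φ.cp_TT hf, Φ.cp_TT hf, map_zero] at h
  simp only [map_add, map_sub, map_mul, bar_Ic, bar_Q, bar_pderiv_u, hg1, hg2, bar_cst, bar_bar,
    map_intCast, map_one, map_ofNat, RCLike.star_def, hc] at h
  linear_combination h

/-- Serves to eliminate the derivative of g_{a−1,b−1} that occurs in the (a,b) component of `TT`. -/
theorem add_mul_pderiv_cp (a b : ℤ) : (a + b : PS n R) * pderiv R iu (cp a b g) =
    (a + b - 2 : PS n R) *
    (Ic * pderiv R iu (Φ.CC (cpv a (b - 1) f)) - Ic * bar (pderiv R iu (Φ.CC (cpv b (a - 1) f)))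
      + cst (1 / 2) * pderiv R iu (Φ.NN (cpv (a - 1) b f))
      + cst (1 / 2) * bar (pderiv R iu (Φ.NN (cpv (b - 1) a f)))) := by
  have h := congrArg (pderiv R iu) (Φ.add_mul_cp hf hg hT a b)
  have hz : ∀ (m : ℤ) (p : PS n R), pderiv R iu ((m : PS n R) * p) = m * pderiv R iu p :=
    fun m p => by rw [← map_intCast (C : R →+* PS n R), pderiv_C_mul]
  have e1 : (a + b : PS n R) = ((a + b : ℤ) : PS n R) := by push_cast; ring
  have e2 : (a + b - 2 : PS n R) = ((a + b - 2 : ℤ) : PS n R) := by push_cast; ring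
  rw [e2, e1, hz, hz] at h
  rw [e2, e1, h]
  simp only [map_add, map_sub, pderiv_Ic_mul, pderiv_cst_mul, bar_pderiv_u]

/-- This and the following five lemmas compute the components that occur in the normal form.
Skewness removes g outside bidegree (0,0), and the recursion along `DDb` f = 0 removes the
components of f of positive degree in z̄; only g_{00} and the f_{a0} remain. -/
theorem TT_one_one : cp 1 1 (Φ.TT f g) =
    Ic * (Φ.Q * pderiv R iu (cp 0 0 g) - Φ.CC (cpv 1 0 f) - bar (Φ.CC (cpv 1 0 f))) := by
  have hT1 := Φ.cp_TT hf g 1 1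
  have hg1 := Φ.add_mul_cp hf hg hT 1 1
  norm_num at hT1 hg1
  -- In bidegree (1,1) the factor a + b − 2 of `add_mul_cp` vanishes.
  have hg2 : cp 1 1 g = 0 := two_mul_cancel (by rw [hg1, mul_zero])
  rw [hT1, hg2]
  ring

/-- The factor 6 clears the denominator 3 = a + b coming from g_{21} and the factor ½ in front of 𝓝.
-/
theorem TT_two_one : 6 * cp 2 1 (Φ.TT f g) =
    -8 * Ic * Φ.CC (cpv 2 0 f) - 4 * Ic * Φ.Q * pderiv R iu (Φ.NN (cpv 0 0 f))
      - 16 * Φ.Q * bar (pderiv R iu (Φ.CC (cpv 0 0 f))) := by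
  have hT1 := Φ.cp_TT hf g 2 1
  have hg1 := Φ.add_mul_cp hf hg hT 2 1
  have hg2 := Φ.add_mul_pderiv_cp hf hg hT 1 0
  have hN := Φ.mul_NN_cpv hf 1 1
  have hC := congrArg bar (Φ.mul_CC_cpv hf 1 1)
  have hI : (Ic : PS n R) * Ic = -1 := Ic_mul_Ic
  have hb : bar (2 : PS n R) = 2 := map_ofNat _ 2
  have hh := two_mul_half (n := n) (R := R)
  norm_num [Φ.cpv_of_lt hf, cpv_of_neg_left, cpv_of_neg_right, bar_Ic, bar_Q, hb]
    at hT1 hg1 hg2 hN hC hh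
  rw [hT1]
  rw [hN, hC] at hg1 ⊢
  linear_combination 4 * hg1 + 6 * Ic * Φ.Q * hg2
    - 4 * Ic * Φ.Q * pderiv R iu (Φ.NN (cpv 0 0 f)) * hh
    + 16 * Φ.Q * bar (pderiv R iu (Φ.CC (cpv 0 0 f))) * hI

theorem TT_two_two : cp 2 2 (Φ.TT f g) =
    2 * Φ.Q * (pderiv R iu (Φ.CC (cpv 1 0 f)) - bar (pderiv R iu (Φ.CC (cpv 1 0 f)))) := by
  have hT1 := Φ.cp_TT hf g 2 2
  have hg1 := Φ.add_mul_cp hf hg hT 2 2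
  have hg2 := Φ.add_mul_pderiv_cp hf hg hT 1 1
  have hC := Φ.mul_CC_cpv hf 2 1
  have hC' := congrArg bar (Φ.mul_CC_cpv hf 2 1)
  have hI : (Ic : PS n R) * Ic = -1 := Ic_mul_Ic
  have hb : bar (2 : PS n R) = 2 := map_ofNat _ 2
  norm_num [Φ.cpv_of_lt hf, cpv_of_neg_left, cpv_of_neg_right, bar_Ic, bar_Q, hb]
    at hT1 hg1 hg2 hC hC'
  rw [hC', hC] at hg1 hT1
  refine two_mul_cancel ?_
  rw [hT1]
  linear_combination hg1 + Ic * Φ.Q * hg2 - 4 * Φ.Q * (pderiv R iu (Φ.CC (cpv 1 0 f)) -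
    bar (pderiv R iu (Φ.CC (cpv 1 0 f)))) * hI

/-- The factor 30 clears the denominators 5 and 3 coming from g_{32} and g_{21}, and the factor ½ in
front of 𝓝. -/
theorem TT_three_two : 30 * cp 3 2 (Φ.TT f g) =
    56 * Φ.Q * pderiv R iu (Φ.CC (cpv 2 0 f))
      + 32 * Ic * Φ.Q * Φ.Q * bar (pderiv R iu (pderiv R iu (Φ.CC (cpv 0 0 f))))
      + 4 * Φ.Q * Φ.Q * pderiv R iu (pderiv R iu (Φ.NN (cpv 0 0 f))) := by
  have hT1 := Φ.cp_TT hf g 3 2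
  have hg1 := Φ.add_mul_cp hf hg hT 3 2
  have hg2 := Φ.add_mul_pderiv_cp hf hg hT 2 1
  have hC := Φ.mul_CC_cpv hf 3 1
  have hC2 := congrArg bar (Φ.two_mul_CC_cpv hf 2)
  have hN2 := Φ.two_mul_NN_cpv hf 2
  have hC1 := congrArg bar (Φ.pderiv_CC_cpv hf 1)
  have hN1 := Φ.pderiv_NN_cpv hf 1
  have hI : (Ic : PS n R) * Ic = -1 := Ic_mul_Ic
  have hb : bar (2 : PS n R) = 2 := map_ofNat _ 2
  have hh := two_mul_half (n := n) (R := R)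
  norm_num [Φ.cpv_of_lt hf, cpv_of_neg_left, cpv_of_neg_right, bar_Ic, bar_Q, hb]
    at hT1 hg1 hg2 hC hC2 hN2 hC1 hN1 hh
  rw [hC] at hg1 hT1
  rw [hC1, hN1] at hg2
  rw [hT1]
  linear_combination 18 * hg1 + 10 * Ic * Φ.Q * hg2 - 42 * Ic * hC2 - 18 * cst (1 / 2) * hN2
    + (10 * Ic * Φ.Q * Φ.Q * bar (pderiv R iu (pderiv R iu (Φ.CC (cpv 0 0 f))))
      - 56 * Φ.Q * pderiv R iu (Φ.CC (cpv 2 0 f))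
      + 10 * Φ.Q * Φ.Q * cst (1 / 2) * pderiv R iu (pderiv R iu (Φ.NN (cpv 0 0 f)))) * hI
    + 4 * Φ.Q * Φ.Q * pderiv R iu (pderiv R iu (Φ.NN (cpv 0 0 f))) * hh

theorem TT_three_three : cp 3 3 (Φ.TT f g) =
    Ic * Φ.Q * Φ.Q * (pderiv R iu (pderiv R iu (Φ.CC (cpv 1 0 f)))
      + bar (pderiv R iu (pderiv R iu (Φ.CC (cpv 1 0 f))))) := by
  have hT1 := Φ.cp_TT hf g 3 3
  have hg1 := Φ.add_mul_cp hf hg hT 3 3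
  have hg2 := Φ.add_mul_pderiv_cp hf hg hT 2 2
  have hC2 := Φ.two_mul_CC_cpv hf 3
  have hC2' := congrArg bar (Φ.two_mul_CC_cpv hf 3)
  have hC1 := Φ.pderiv_CC_cpv hf 2
  have hC1' := congrArg bar (Φ.pderiv_CC_cpv hf 2)
  have hI : (Ic : PS n R) * Ic = -1 := Ic_mul_Ic
  have hb : bar (2 : PS n R) = 2 := map_ofNat _ 2
  norm_num [Φ.cpv_of_lt hf, cpv_of_neg_left, cpv_of_neg_right, bar_Ic, bar_Q, hb]
    at hT1 hg1 hg2 hC2 hC2' hC1 hC1'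
  rw [hC1', hC1] at hg2
  refine two_mul_cancel (two_mul_cancel ?_)
  rw [hT1]
  linear_combination 2 * hg1 + Ic * Φ.Q * hg2 - 6 * Ic * hC2 - 6 * Ic * hC2'
    + 2 * Ic * Φ.Q * Φ.Q * (pderiv R iu (pderiv R iu (Φ.CC (cpv 1 0 f)))
      + bar (pderiv R iu (pderiv R iu (Φ.CC (cpv 1 0 f))))) * hI

theorem TT_one {a : ℤ} (ha : 3 ≤ a) : ((a : PS n R) + 1) * ((a : PS n R) - 1) * cp a 1 (Φ.TT f g) =
    -2 * (a : PS n R) * ((a : PS n R) - 1) * Ic * Φ.CC (cpv a 0 f)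
      - 2 * Ic * Φ.Q * pderiv R iu (Φ.NN (cpv (a - 2) 0 f)) := by
  have hT1 := Φ.cp_TT hf g a 1
  have hg1 := Φ.add_mul_cp hf hg hT a 1
  have hg2 := Φ.add_mul_pderiv_cp hf hg hT (a - 1) 0
  have hN := Φ.mul_NN_cpv hf (a - 1) 1
  have hh := two_mul_half (n := n) (R := R)
  have e : a - 1 - 1 = a - 2 := by ring
  rw [sub_self, Φ.cpv_of_lt hf (show 1 < a - 1 by omega)] at hT1 hg1
  rw [Φ.cpv_of_lt hf (show 0 < a by omega)] at hg1
  rw [e, Φ.cpv_of_lt hf (show 0 < a - 2 by omega),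
    cpv_of_neg_right (a := a - 1) (b := 0 - 1) (by norm_num),
    cpv_of_neg_left (a := 0 - 1) (b := a - 1) (by norm_num)] at hg2
  rw [sub_self, e] at hN
  push_cast at hT1 hg1 hg2 hN
  simp only [map_zero, mul_zero, sub_zero, add_zero, zero_add, one_mul] at hT1 hg1 hg2 hN
  rw [hN] at hT1 hg1
  rw [hT1]
  linear_combination (a : PS n R) * ((a : PS n R) - 1) * hg1 + (a + 1) * Ic * Φ.Q * hg2
    - 2 * Ic * Φ.Q * pderiv R iu (Φ.NN (cpv (a - 2) 0 f)) * hh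

end Homogeneous

end Frame

end FormalCR

/-! ### Primitives in u, Euler equations, the trace, and the inversion of the Levi form -/

namespace FormalCR

open MvPowerSeries

section Integration

variable {n : ℕ} {R : Type*} [CommRing R] [Algebra ℂ R]

/-- The primitive in `u` without terms of degree `0` in `u`. -/
def Iu (p : PS n R) : PS n R := ofCoeff fun α =>
  if α iu = 0 then 0
  else algebraMap ℂ R ((α iu : ℂ)⁻¹) * coeff (α - Finsupp.single iu 1) p

theorem coeff_Iu_of_eq_zero {α : MIdx n} (h : α iu = 0) (p : PS n R) : coeff α (Iu p) = 0 := by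
  rw [Iu, coeff_ofCoeff, if_pos h]

theorem pderiv_Iu (p : PS n R) : pderiv R iu (Iu p) = p := by
  ext α
  rw [coeff_pderiv, Iu, coeff_ofCoeff, if_neg (by simp), add_tsub_cancel_right]
  have h : (algebraMap ℂ R) (((α iu + 1 : ℕ) : ℂ)⁻¹) * ((α iu + 1 : ℕ) : R) = 1 := by
    rw [← map_natCast (algebraMap ℂ R), ← map_mul, inv_mul_cancel₀ (Nat.cast_ne_zero.2 (Nat.succ_ne_zero _)), map_one]
  simp only [Finsupp.add_apply, Finsupp.single_eq_same]
  push_cast at h ⊢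
  linear_combination (coeff α p) * h

theorem coeff_Iu_Iu {α : MIdx n} (h : α iu ≤ 1) (p : PS n R) : coeff α (Iu (Iu p)) = 0 := by
  by_cases h0 : α iu = 0
  · exact coeff_Iu_of_eq_zero h0 _
  · rw [Iu, coeff_ofCoeff, if_neg h0, coeff_Iu_of_eq_zero, mul_zero]
    simp; omega

theorem coeff_Iu_Iu_Iu {α : MIdx n} (h : α iu ≤ 2) (p : PS n R) :
    coeff α (Iu (Iu (Iu p))) = 0 := by
  by_cases h0 : α iu = 0
  · exact coeff_Iu_of_eq_zero h0 _
  · rw [Iu, coeff_ofCoeff, if_neg h0, coeff_Iu_Iu, mul_zero]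
    simp; omega

theorem bar_Iu [StarRing R] [StarModule ℂ R] (p : PS n R) : bar (Iu p) = Iu (bar p) := by
  ext α
  have h : swapIdx α iu = α iu := swapIdx_apply _ _
  have h2 : swapIdx (α - Finsupp.single iu 1) = swapIdx α - Finsupp.single iu 1 := by
    ext i
    rw [swapIdx_apply, Finsupp.tsub_apply, Finsupp.tsub_apply, swapIdx_apply]
    congr 1
    rcases i with i | i | i <;> simp [swapVar]
  simp only [coeff_bar, Iu, coeff_ofCoeff, h, h2]
  split_ifs
  · simp
  · rw [star_mul', ← algebraMap_star_comm]
    simp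

theorem cp_Iu (a b : ℤ) (p : PS n R) : cp a b (Iu p) = Iu (cp a b p) := by
  ext α
  simp only [coeff_cp, Iu, coeff_ofCoeff]
  by_cases h : α iu = 0
  · simp [h]
  · have h1 : ∀ i : Fin n, (α - Finsupp.single iu 1 : MIdx n) (iz i) = α (iz i) := fun i => by
      simp
    have h2 : ∀ i : Fin n, (α - Finsupp.single iu 1 : MIdx n) (izb i) = α (izb i) := fun i => by
      simp
    simp only [h1, h2, if_neg h]
    split_ifs <;> simp

theorem eq_zero_of_pderiv_u {p : PS n R} (h : pderiv R iu p = 0)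
    (h0 : ∀ α, α iu = 0 → coeff α p = 0) : p = 0 := by
  ext α
  by_cases hα : α iu = 0
  · exact h0 α hα
  · have h1 := congrArg (coeff (α - Finsupp.single iu 1)) h
    have h2 : α - Finsupp.single iu 1 + Finsupp.single iu 1 = α :=
      tsub_add_cancel_of_le (Finsupp.single_le_iff.2 (Nat.one_le_iff_ne_zero.2 hα))
    rw [coeff_pderiv, h2, coeff_zero] at h1
    have h3 : ((α - Finsupp.single iu 1 : MIdx n) iu : R) + 1 = (α iu : R) := by
      have : (α - Finsupp.single iu 1 : MIdx n) iu + 1 = α iu := by simp; omega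
      rw [← this]; push_cast; rfl
    rw [h3] at h1
    have h4 : (algebraMap ℂ R) ((α iu : ℂ)⁻¹) * (α iu : R) = 1 := by
      rw [← map_natCast (algebraMap ℂ R), ← map_mul,
        inv_mul_cancel₀ (by exact_mod_cast hα), map_one]
    rw [coeff_zero]
    linear_combination (algebraMap ℂ R) ((α iu : ℂ)⁻¹) * h1 - coeff α p * h4

theorem eq_zero_of_pderiv_u_u {p : PS n R} (h : pderiv R iu (pderiv R iu p) = 0)
    (h0 : ∀ α, α iu ≤ 1 → coeff α p = 0) : p = 0 := by
  refine eq_zero_of_pderiv_u (eq_zero_of_pderiv_u h fun α hα => ?_) fun α hα => h0 α (by omega)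
  rw [coeff_pderiv, h0 _ (by simp [hα]), zero_mul]

theorem eq_zero_of_pderiv_u_u_u {p : PS n R} (h : pderiv R iu (pderiv R iu (pderiv R iu p)) = 0)
    (h0 : ∀ α, α iu ≤ 2 → coeff α p = 0) : p = 0 := by
  refine eq_zero_of_pderiv_u (eq_zero_of_pderiv_u_u h fun α hα => ?_) fun α hα => h0 α (by omega)
  rw [coeff_pderiv, h0 _ (by simp; omega), zero_mul]

end Integration

section Assemble

variable {n : ℕ} {R : Type*} [CommRing R]

theorem exists_assemble (G : ℕ → ℕ → PS n R) (hG : ∀ a b : ℕ, cp a b (G a b) = G a b) :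
    ∃ f : PS n R, ∀ a b : ℕ, cp a b f = G a b := by
  refine ⟨ofCoeff fun α => coeff α (G (∑ j, α (iz j)) (∑ j, α (izb j))), fun a b => ?_⟩
  ext α
  rw [← hG a b, coeff_cp, coeff_cp, coeff_ofCoeff]
  split_ifs with h
  · rw [Int.natCast_inj.1 h.1, Int.natCast_inj.1 h.2]
  · rfl

theorem eq_zero_of_ee_add_eb [Algebra ℂ R] {p : PS n R} (h : ee p + eb p = 0)
    (h0 : cp 0 0 p = 0) : p = 0 := by
  refine cp_ext fun a b => ?_
  rw [map_zero]
  by_cases hab : (a : ℤ) + b = 0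
  · obtain rfl : a = 0 := by omega
    obtain rfl : b = 0 := by omega
    exact h0
  · have h1 := congrArg (cp a b) h
    rw [map_add, cp_ee, cp_eb, map_zero] at h1
    refine intCast_mul_cancel hab ?_
    push_cast at h1 ⊢
    linear_combination h1

/-- The operator multiplies bidegree (a,b) by a + b, so one divides; bidegree (0,0) is its kernel,
where g is free. -/
theorem exists_ee_add_eb [Algebra ℂ R] {s g₀ : PS n R} (hs : cp 0 0 s = 0) :
    ∃ g : PS n R, ee g + eb g = s ∧ cp 0 0 g = cp 0 0 g₀ := by
  obtain ⟨g, hg⟩ := exists_assemble (n := n) (R := R)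
    (fun a b => if a + b = 0 then cp a b g₀ else cst ((a + b : ℂ)⁻¹) * cp a b s)
    (fun a b => by split_ifs <;> simp only [cp_cst_mul, cp_cp_self])
  refine ⟨g, cp_ext fun a b => ?_, by simpa using hg 0 0⟩
  rw [map_add, cp_ee, cp_eb, hg]
  split_ifs with h
  · obtain rfl : a = 0 := by omega
    obtain rfl : b = 0 := by omega
    simpa using hs.symm
  · have h1 : (cst ((a + b : ℂ)⁻¹) : PS n R) * (a + b) = 1 := by
      rw [← map_natCast (cst : ℂ →+* PS n R) a, ← map_natCast (cst : ℂ →+* PS n R) b, ← map_add,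
        ← map_mul, inv_mul_cancel₀ (by exact_mod_cast h), map_one]
    push_cast
    linear_combination cp a b s * h1

theorem pderiv_zb_cp_zero (a : ℤ) (j : Fin n) (p : PS n R) :
    pderiv R (izb j) (cp a 0 p) = 0 := by
  have h := cp_pderiv_zb a (-1) j p
  norm_num at h
  rw [← h, cp_of_neg_right (by norm_num)]

theorem pderiv_z_cp_zero (b : ℤ) (j : Fin n) (p : PS n R) :
    pderiv R (iz j) (cp 0 b p) = 0 := by
  have h := cp_pderiv_z (-1) b j p
  norm_num at h
  rw [← h, cp_of_neg_left (by norm_num)]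

end Assemble

namespace Frame

variable {n : ℕ} {R : Type*} [CommRing R] [StarRing R] [Algebra ℂ R] (Φ : Frame n R)

theorem cinv_mul_c : Φ.cinv * Φ.c = 1 := mul_eq_one_comm.1 Φ.c_mul_cinv

theorem star_cinv (j k : Fin n) : star (Φ.cinv j k) = Φ.cinv k j := by
  have hc : Φ.c.conjTranspose = Φ.c := by
    ext j k
    rw [Matrix.conjTranspose_apply, Φ.star_c]
  have h := congrArg Matrix.conjTranspose Φ.c_mul_cinv
  rw [Matrix.conjTranspose_mul, hc, Matrix.conjTranspose_one] at h
  have h2 : Φ.cinv.conjTranspose = Φ.cinv := by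
    calc Φ.cinv.conjTranspose = Φ.cinv.conjTranspose * (Φ.c * Φ.cinv) := by
          rw [Φ.c_mul_cinv, mul_one]
      _ = Φ.cinv := by rw [← mul_assoc, h, one_mul]
  have h3 := congrFun (congrFun h2 k) j
  rwa [Matrix.conjTranspose_apply] at h3

theorem sum_c_mul_cinv (i k : Fin n) :
    ∑ j, (C (Φ.c i j) : PS n R) * C (Φ.cinv j k) = if i = k then 1 else 0 := by
  have h := congrFun (congrFun Φ.c_mul_cinv i) k
  rw [Matrix.mul_apply, Matrix.one_apply] at h
  simp only [← map_mul, ← map_sum, h]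
  split_ifs <;> simp

theorem sum_cinv_mul_c (i k : Fin n) :
    ∑ j, (C (Φ.cinv i j) : PS n R) * C (Φ.c j k) = if i = k then 1 else 0 := by
  have h := congrFun (congrFun Φ.cinv_mul_c i) k
  rw [Matrix.mul_apply, Matrix.one_apply] at h
  simp only [← map_mul, ← map_sum, h]
  split_ifs <;> simp

/-- The trace operator of the Levi form. -/
def tr : PS n R →ₗ[R] PS n R := ∑ j, ∑ k,
  Φ.cinv k j • (pderiv R (izb j)).toLinearMap ∘ₗ (pderiv R (iz k)).toLinearMap

theorem tr_apply (p : PS n R) :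
    Φ.tr p = ∑ j, ∑ k, C (Φ.cinv k j) * pderiv R (izb j) (pderiv R (iz k) p) := by
  simp [tr, LinearMap.sum_apply, smul_eq_C_mul]

theorem bar_tr (p : PS n R) : bar (Φ.tr p) = Φ.tr (bar p) := by
  simp only [tr_apply, map_sum, map_mul, bar_C, star_cinv, bar_pderiv_z, bar_pderiv_zb]
  rw [Finset.sum_comm]
  exact Finset.sum_congr rfl fun j _ => Finset.sum_congr rfl fun k _ => by rw [pderiv_comm]

theorem cp_tr (a b : ℤ) (p : PS n R) : cp a b (Φ.tr p) = Φ.tr (cp (a + 1) (b + 1) p) := by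
  simp only [tr_apply, map_sum, cp_C_mul, cp_pderiv_z, cp_pderiv_zb]

theorem tr_intCast_mul (a : ℤ) (p : PS n R) : Φ.tr ((a : PS n R) * p) = a * Φ.tr p := by
  rw [← map_intCast (C : R →+* PS n R), ← smul_eq_C_mul, map_smul, smul_eq_C_mul]

theorem tr_natCast_mul (a : ℕ) (p : PS n R) : Φ.tr ((a : PS n R) * p) = a * Φ.tr p :=
  mod_cast Φ.tr_intCast_mul a p

theorem tr_cst_mul (x : ℂ) (p : PS n R) : Φ.tr (cst x * p) = cst x * Φ.tr p := by
  rw [cst_def, ← smul_eq_C_mul, map_smul, smul_eq_C_mul]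

theorem tr_Ic_mul (p : PS n R) : Φ.tr (Ic * p) = Ic * Φ.tr p := Φ.tr_cst_mul _ p

theorem pderiv_z_Q (k : Fin n) : pderiv R (iz k) Φ.Q = ∑ j, C (Φ.c j k) * X (izb j) := by
  classical
  simp only [Q, map_sum, Derivation.leibniz, pderiv_X, smul_eq_mul]
  refine Finset.sum_congr rfl fun j _ => ?_
  rw [Finset.sum_eq_single k]
  · simp
  · intro b _ hb; simp [hb]
  · simp

theorem pderiv_zb_Q (j : Fin n) : pderiv R (izb j) Φ.Q = ∑ k, C (Φ.c j k) * X (iz k) := by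
  classical
  simp only [Q, map_sum, Derivation.leibniz, pderiv_X, smul_eq_mul]
  rw [Finset.sum_eq_single j]
  · simp
  · intro b _ hb; simp [hb]
  · simp

/-- Product rule: when both derivatives hit Q, the contraction of c with its inverse gives n; when
one of them does, it gives an Euler operator. This commutation relation allows all the traces to be
inverted below. -/
theorem tr_Q_mul (p : PS n R) : Φ.tr (Φ.Q * p) = n * p + ee p + eb p + Φ.Q * Φ.tr p := by
  classical
  have h1 : ∀ j k, pderiv R (izb j) (pderiv R (iz k) (Φ.Q * p)) =
      C (Φ.c j k) * p + (∑ i, C (Φ.c i k) * X (izb i)) * pderiv R (izb j) p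
        + (∑ i, C (Φ.c j i) * X (iz i)) * pderiv R (iz k) p
        + Φ.Q * pderiv R (izb j) (pderiv R (iz k) p) := by
    intro j k
    have h2 : pderiv R (izb j) (∑ i, C (Φ.c i k) * X (izb i)) = C (Φ.c j k) := by
      rw [map_sum, Finset.sum_eq_single j]
      · simp
      · intro b _ hb; simp [hb]
      · simp
    rw [Derivation.leibniz, pderiv_z_Q, map_add, smul_eq_mul, smul_eq_mul, Derivation.leibniz,
      Derivation.leibniz, h2, pderiv_zb_Q]
    simp only [smul_eq_mul]
    ring
  have e1 : ∑ j, ∑ k, (C (Φ.cinv k j) : PS n R) * (C (Φ.c j k) * p) = n * p := by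
    rw [Finset.sum_comm]
    simp only [← mul_assoc, ← Finset.sum_mul, sum_cinv_mul_c]
    simp
  have e2 : ∑ j, ∑ k, (C (Φ.cinv k j) : PS n R) *
      ((∑ i, C (Φ.c i k) * X (izb i)) * pderiv R (izb j) p) = eb p := by
    rw [eb_apply]
    refine Finset.sum_congr rfl fun j _ => ?_
    have : ∑ k, (C (Φ.cinv k j) : PS n R) * (∑ i, C (Φ.c i k) * X (izb i)) = X (izb j) := by
      simp only [Finset.mul_sum]
      rw [Finset.sum_comm]
      have : ∀ i, ∑ k, (C (Φ.cinv k j) : PS n R) * (C (Φ.c i k) * X (izb i)) =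
          if i = j then X (izb j) else 0 := fun i => by
        have h := Φ.sum_c_mul_cinv i j
        calc _ = (∑ k, (C (Φ.c i k) : PS n R) * C (Φ.cinv k j)) * X (izb i) := by
              rw [Finset.sum_mul]; exact Finset.sum_congr rfl fun k _ => by ring
          _ = _ := by rw [h]; split_ifs with h0 <;> simp [h0]
      simp [this]
    rw [← this, Finset.sum_mul]
    exact Finset.sum_congr rfl fun k _ => by ring
  have e3 : ∑ j, ∑ k, (C (Φ.cinv k j) : PS n R) *
      ((∑ i, C (Φ.c j i) * X (iz i)) * pderiv R (iz k) p) = ee p := by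
    rw [ee_apply, Finset.sum_comm]
    refine Finset.sum_congr rfl fun k _ => ?_
    have : ∑ j, (C (Φ.cinv k j) : PS n R) * (∑ i, C (Φ.c j i) * X (iz i)) = X (iz k) := by
      simp only [Finset.mul_sum]
      rw [Finset.sum_comm]
      have : ∀ i, ∑ j, (C (Φ.cinv k j) : PS n R) * (C (Φ.c j i) * X (iz i)) =
          if k = i then X (iz k) else 0 := fun i => by
        have h := Φ.sum_cinv_mul_c k i
        calc _ = (∑ j, (C (Φ.cinv k j) : PS n R) * C (Φ.c j i)) * X (iz i) := by
              rw [Finset.sum_mul]; exact Finset.sum_congr rfl fun k _ => by ring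
          _ = _ := by rw [h]; split_ifs with h0 <;> simp [h0]
      simp [this]
    rw [← this, Finset.sum_mul]
    exact Finset.sum_congr rfl fun k _ => by ring
  have e4 : ∑ j, ∑ k, (C (Φ.cinv k j) : PS n R) *
      (Φ.Q * pderiv R (izb j) (pderiv R (iz k) p)) = Φ.Q * Φ.tr p := by
    rw [tr_apply, Finset.mul_sum]
    refine Finset.sum_congr rfl fun j _ => ?_
    rw [Finset.mul_sum]
    exact Finset.sum_congr rfl fun k _ => mul_left_comm _ _ _
  rw [tr_apply, ← e1, ← e2, ← e3, ← e4]
  simp only [← Finset.sum_add_distrib]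
  refine Finset.sum_congr rfl fun j _ => Finset.sum_congr rfl fun k _ => ?_
  rw [h1, mul_add, mul_add, mul_add]
  ring

theorem tr_Q_mul_cp {a b : ℤ} {p : PS n R} (hp : cp a b p = p) :
    Φ.tr (Φ.Q * p) = (n + a + b) * p + Φ.Q * Φ.tr p := by
  rw [tr_Q_mul, ← hp, ee_cp, eb_cp]; ring

theorem tr_of_right {a : ℤ} {p : PS n R} (hp : cp a 0 p = p) : Φ.tr p = 0 := by
  rw [← hp]
  have h := Φ.cp_tr (a - 1) (-1) p
  norm_num at h
  rw [← h, cp_of_neg_right (by norm_num)]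

theorem cp_Q_mul_self {a b : ℤ} {p : PS n R} (hp : cp a b p = p) :
    cp (a + 1) (b + 1) (Φ.Q * p) = Φ.Q * p := by
  rw [cp_Q_mul, add_sub_cancel_right, add_sub_cancel_right, hp]

/-- For p of bidegree (1,0): tr(Qp) = (n+1)p, and then tr(Q²p) = (n+3)Qp + (n+1)Qp = (2n+4)Qp. -/
theorem tr_tr_Q_Q_mul {p : PS n R} (hp : cp 1 0 p = p) :
    Φ.tr (Φ.tr (Φ.Q * (Φ.Q * p))) = ((2 * n + 4) * (n + 1) : ℕ) * p := by
  have h1 := Φ.tr_Q_mul_cp hp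
  rw [Φ.tr_of_right hp] at h1
  have h2 := Φ.tr_Q_mul_cp (Φ.cp_Q_mul_self hp)
  rw [h1] at h2
  have h3 : Φ.tr (Φ.Q * (Φ.Q * p)) = ((2 * n + 4 : ℕ) : PS n R) * (Φ.Q * p) := by
    rw [h2]; push_cast; ring
  rw [h3, tr_natCast_mul, h1]
  push_cast; ring

/-- For p of bidegree (0,0): tr(Qp) = np, tr(Q²p) = (2n+2)Qp and tr(Q³p) = (3n+6)Q²p. The factor n
is why n ≥ 1 matters later. -/
theorem tr_tr_tr_Q_Q_Q_mul {p : PS n R} (hp : cp 0 0 p = p) :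
    Φ.tr (Φ.tr (Φ.tr (Φ.Q * (Φ.Q * (Φ.Q * p))))) = ((3 * n + 6) * ((2 * n + 2) * n) : ℕ) * p := by
  have h1 := Φ.tr_Q_mul_cp hp
  rw [Φ.tr_of_right hp] at h1
  have h2 := Φ.tr_Q_mul_cp (Φ.cp_Q_mul_self hp)
  rw [h1] at h2
  have h3 := Φ.tr_Q_mul_cp (Φ.cp_Q_mul_self (Φ.cp_Q_mul_self hp))
  rw [h2] at h3
  have h3' : Φ.tr (Φ.Q * (Φ.Q * (Φ.Q * p))) = ((3 * n + 6 : ℕ) : PS n R) * (Φ.Q * (Φ.Q * p)) := by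
    rw [h3]; push_cast; ring
  have h2' : Φ.tr (Φ.Q * (Φ.Q * p)) = ((2 * n + 2 : ℕ) : PS n R) * (Φ.Q * p) := by
    rw [h2]; push_cast; ring
  rw [h3', tr_natCast_mul, h2', tr_natCast_mul, tr_natCast_mul, h1]
  push_cast; ring

/-- The hypothesis reads (n+2)ψ + Q tr ψ = 0; its trace is (2n+2) tr ψ = 0, and then ψ = 0. -/
theorem eq_zero_of_tr_Q_mul {ψ : PS n R} (hψ : cp 1 1 ψ = ψ) (h : Φ.tr (Φ.Q * ψ) = 0) :
    ψ = 0 := by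
  have h1 := Φ.tr_Q_mul_cp hψ
  have h2 : cp 0 0 (Φ.tr ψ) = Φ.tr ψ := by rw [cp_tr]; norm_num [hψ]
  have h3 := Φ.tr_Q_mul_cp h2
  rw [Φ.tr_of_right h2] at h3
  rw [h] at h1
  have e1 : (n + (1 : ℤ) + (1 : ℤ) : PS n R) = ((n + 2 : ℕ) : PS n R) := by push_cast; ring
  rw [e1] at h1
  have h4 := congrArg Φ.tr h1
  rw [map_zero, map_add, h3, tr_natCast_mul] at h4
  have h5 : Φ.tr ψ = 0 := by
    refine intCast_mul_cancel (a := 2 * n + 2) (by positivity) ?_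
    rw [mul_zero, h4]
    push_cast; ring
  rw [h5, mul_zero, add_zero] at h1
  refine intCast_mul_cancel (a := n + 2) (by positivity) ?_
  rw [mul_zero, h1]
  push_cast; ring

/-- Inverts ψ ↦ tr(Qψ) = (n+2)ψ + Q tr ψ, using tr(Q² tr K) = (2n+2)Q tr K. That the coefficients
are real guarantees that ψ inherits the symmetry of K under conjugation. -/
theorem exists_tr_Q_mul {K : PS n R} (hK : cp 1 1 K = K) :
    ∃ x y : ℂ, star x = x ∧ star y = y ∧
      Φ.tr (Φ.Q * (cst x * K + cst y * (Φ.Q * Φ.tr K))) = K := by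
  have h2 : cp 0 0 (Φ.tr K) = Φ.tr K := by rw [cp_tr]; norm_num [hK]
  have h1 := Φ.tr_Q_mul_cp hK
  have h3 := Φ.tr_Q_mul_cp h2
  rw [Φ.tr_of_right h2] at h3
  have h4 := Φ.tr_Q_mul_cp (Φ.cp_Q_mul_self h2)
  rw [h3] at h4
  have hn : ((n : ℂ) + 2) ≠ 0 := by exact_mod_cast (by omega : n + 2 ≠ 0)
  have hn' : (2 * (n : ℂ) + 2) ≠ 0 := by exact_mod_cast (by omega : 2 * n + 2 ≠ 0)
  have hcn : (cst ((n : ℂ) + 2) : PS n R) = n + 2 := by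
    rw [map_add, map_natCast, map_ofNat]
  have hcn' : (cst (2 * (n : ℂ) + 2) : PS n R) = 2 * n + 2 := by
    rw [map_add, map_mul, map_natCast, map_ofNat]
  refine ⟨((n : ℂ) + 2)⁻¹, -(((n : ℂ) + 2)⁻¹ * (2 * (n : ℂ) + 2)⁻¹), by simp, by simp, ?_⟩
  have hx : (cst ((n : ℂ) + 2)⁻¹ : PS n R) * (n + 2) = 1 := by
    rw [← hcn, ← map_mul, inv_mul_cancel₀ hn, map_one]
  have hy : (cst (2 * (n : ℂ) + 2)⁻¹ : PS n R) * (2 * n + 2) = 1 := by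
    rw [← hcn', ← map_mul, inv_mul_cancel₀ hn', map_one]
  rw [mul_add, map_add, mul_left_comm, tr_cst_mul, mul_left_comm, tr_cst_mul, h1, h4, map_neg,
    map_mul]
  push_cast at *
  linear_combination (K) * hx - cst ((n : ℂ) + 2)⁻¹ * Φ.Q * Φ.tr K * hy

/-- The solution `f` of `𝓛(z̄, f) = p` for `p` of degree one in `z̄`. -/
def solveC (p : PS n R) : Fin n → PS n R := fun k => ∑ j, C (Φ.cinv k j) * pderiv R (izb j) p

/-- Since p has degree one in z̄, Euler's identity p = ∑ z̄_i ∂p/∂z̄_i applies, and it remains to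
cancel c against its inverse. -/
theorem CC_solveC {a : ℤ} {p : PS n R} (hp : cp a 1 p = p) : Φ.CC (Φ.solveC p) = p := by
  have h : eb p = p := by rw [← hp, eb_cp]; simp
  conv_rhs => rw [← h, eb_apply]
  rw [CC_apply]
  refine Finset.sum_congr rfl fun i _ => ?_
  simp only [solveC, Finset.mul_sum]
  rw [Finset.sum_comm]
  have : ∀ j, ∑ k, (C (Φ.c i k) : PS n R) * (X (izb i) * (C (Φ.cinv k j) * pderiv R (izb j) p)) =
      if i = j then X (izb i) * pderiv R (izb j) p else 0 := fun j => by
    calc _ = (∑ k, (C (Φ.c i k) : PS n R) * C (Φ.cinv k j)) * (X (izb i) * pderiv R (izb j) p) := by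
          rw [Finset.sum_mul]; exact Finset.sum_congr rfl fun k _ => by ring
      _ = _ := by rw [sum_c_mul_cinv]; split_ifs <;> simp
  simp [this]

theorem cpv_solveC {a : ℤ} {p : PS n R} (hp : cp a 1 p = p) :
    cpv a 0 (Φ.solveC p) = Φ.solveC p := by
  funext k
  simp only [cpv, solveC, map_sum, cp_C_mul, cp_pderiv_zb]
  norm_num [hp]

/-- As f does not contain z̄, differentiating 𝓛(z̄, f) in z̄_i gives ∑ c_{ik} f_k, and c is
invertible. -/
theorem eq_zero_of_CC {a : ℤ} {f : Fin n → PS n R} (hf : cpv a 0 f = f) (h : Φ.CC f = 0) :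
    f = 0 := by
  classical
  have hd : ∀ i k, pderiv R (izb i) (f k) = 0 := fun i k => by
    rw [← hf]; exact pderiv_zb_cp_zero _ _ _
  have h1 : ∀ i, ∑ k, C (Φ.c i k) * f k = 0 := fun i => by
    have h2 := congrArg (pderiv R (izb i)) h
    simp only [CC_apply, map_sum, Derivation.leibniz, hd, pderiv_X, smul_eq_mul,
      mul_zero, zero_add, map_zero] at h2
    rw [Finset.sum_eq_single i] at h2
    · simpa using h2
    · intro b _ hb; simp [hb]
    · simp
  funext k
  calc f k = ∑ l, (if k = l then 1 else 0) * f l := by simp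
    _ = ∑ l, (∑ j, (C (Φ.cinv k j) : PS n R) * C (Φ.c j l)) * f l := by
        simp only [sum_cinv_mul_c]
    _ = ∑ j, C (Φ.cinv k j) * ∑ l, C (Φ.c j l) * f l := by
        simp only [Finset.sum_mul, Finset.mul_sum]
        rw [Finset.sum_comm]
        exact Finset.sum_congr rfl fun j _ => Finset.sum_congr rfl fun l _ => by ring
    _ = 0 := by simp [h1]

/-- The bidegree (a,b) part of the equation is b f_{ab} = q_{ab} + iQ ∂f_{a−1,b−1}/∂u. For b > 0 it
is a recursion in b starting from arbitrary f_{a0}; for b = 0 it is the compatibility condition on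
q. -/
theorem exists_DDb {q φ : PS n R} (hq : ∀ a : ℕ, cp a 0 q = 0) :
    ∃ f, Φ.DDb f = q ∧ ∀ a : ℕ, cp a 0 f = cp a 0 φ := by
  -- The recursion is on b, for all a at once; the branch a = 0 stands for the vanishing component
  -- of degree −1 in z.
  let G : ℕ → ℕ → PS n R := fun a b => Nat.rec (motive := fun _ => ℕ → PS n R)
    (fun a => cp a 0 φ) (fun b Gb a => cst (((b : ℂ) + 1)⁻¹) *
      (cp a (b + 1) q + Ic * Φ.Q * pderiv R iu (if a = 0 then 0 else Gb (a - 1)))) b a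
  have hG0 : ∀ a, G a 0 = cp a 0 φ := fun a => rfl
  have hGs : ∀ a b, G a (b + 1) = cst (((b : ℂ) + 1)⁻¹) *
      (cp a (b + 1) q + Ic * Φ.Q * pderiv R iu (if a = 0 then 0 else G (a - 1) b)) :=
    fun a b => rfl
  have hcp : ∀ b a : ℕ, cp a b (G a b) = G a b := by
    intro b
    induction b with
    | zero => intro a; rw [hG0, Nat.cast_zero, cp_cp_self]
    | succ b ih =>
      intro a
      rw [hGs, cp_cst_mul, map_add, mul_assoc, cp_Ic_mul, cp_Q_mul, cp_pderiv_u]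
      push_cast
      rw [cp_cp_self]
      cases a with
      | zero => simp
      | succ a => simp [ih a]
  obtain ⟨f, hf⟩ := exists_assemble G fun a b => hcp b a
  refine ⟨f, cp_ext fun a b => ?_, fun a => by rw [← hG0]; exact_mod_cast hf a 0⟩
  rw [DDb, map_sub, cp_eb, mul_assoc, cp_Ic_mul, cp_Q_mul, cp_pderiv_u]
  cases b with
  | zero =>
    rw [cp_of_neg_right (b := ((0 : ℕ) : ℤ) - 1) (by simp)]
    simpa using (hq a).symm
  | succ b =>
    rw [hf, hGs]
    have h1 : (cst ((b : ℂ) + 1)⁻¹ : PS n R) * (b + 1) = 1 := by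
      have : (cst ((b : ℂ) + 1) : PS n R) = b + 1 := by simp
      rw [← this, ← map_mul, inv_mul_cancel₀ (by exact_mod_cast Nat.succ_ne_zero b), map_one]
    cases a with
    | zero =>
      rw [cp_of_neg_left (a := ((0 : ℕ) : ℤ) - 1) (by simp)]
      simp only [if_true, map_zero, mul_zero, add_zero, sub_zero]
      push_cast
      linear_combination cp 0 (b + 1) q * h1
    | succ a =>
      have h2 : cp (((a + 1 : ℕ) : ℤ) - 1) (((b + 1 : ℕ) : ℤ) - 1) f = G a b := by
        rw [← hf]; simp
      rw [h2, if_neg (Nat.succ_ne_zero a), Nat.add_sub_cancel]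
      push_cast
      linear_combination (cp (a + 1) (b + 1) q + Ic * Φ.Q * pderiv R iu (G a b)) * h1

theorem eq_zero_of_DDb {f : Fin n → PS n R} (hf : ∀ k, Φ.DDb (f k) = 0)
    (h0 : ∀ a : ℕ, cpv a 0 f = 0) : f = 0 := by
  have hd : duv (0 : Fin n → PS n R) = 0 := by funext k; simp [duv]
  have key : ∀ b a : ℕ, cpv a b f = 0 := by
    intro b
    induction b with
    | zero => exact h0
    | succ b ih =>
      intro a
      have h := Φ.natCast_smul_cpv hf a (b + 1 : ℕ)
      have h2 : cpv (a - 1) (((b + 1 : ℕ) : ℤ) - 1) f = 0 := by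
        push_cast
        rw [add_sub_cancel_right]
        cases a with
        | zero => exact cpv_of_neg_left (by simp) f
        | succ a => simpa using ih a
      rw [h2, hd, smul_zero] at h
      funext k
      refine intCast_mul_cancel (a := (b + 1 : ℕ)) (by positivity) ?_
      simpa using congrFun h k
  funext k
  exact cp_ext fun a b => by simpa [cpv] using congrFun (key b a) k

end Frame

end FormalCR

/-! ### The second nondegeneracy condition over the coefficient ring -/

namespace FormalCR

open MvPowerSeries

namespace Frame

variable {n : ℕ} {R : Type*} [CommRing R] [StarRing R] [Algebra ℂ R] (Φ : Frame n R)

/-- The coefficients of the linear form `6i𝓛(ξ̄, ·) + 𝓝(ξ, ·)`. -/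
def strongForm (ξ : Fin n → PS n R) (k : Fin n) : PS n R :=
  ∑ j, (cst (6 * Complex.I) * C (Φ.c j k) * bar (ξ j) + C (Φ.nn j k) * ξ j)

/-- Hermitian symmetry of c turns the first sum into a conjugate of 𝓛(z̄, ξ); antisymmetry of N is
responsible for the minus sign. -/
theorem sum_X_mul_strongForm (ξ : Fin n → PS n R) :
    ∑ k, X (iz k) * Φ.strongForm ξ k = 6 * Ic * bar (Φ.CC ξ) - Φ.NN ξ := by
  have h1 : bar (Φ.CC ξ) = ∑ k, ∑ j, C (Φ.c j k) * (X (iz k) * bar (ξ j)) := by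
    simp only [CC_apply, map_sum, map_mul, bar_C, bar_X_zb, Φ.star_c]
  have h2 : Φ.NN ξ = -∑ k, ∑ j, C (Φ.nn j k) * (X (iz k) * ξ j) := by
    rw [NN_apply, ← Finset.sum_neg_distrib]
    refine Finset.sum_congr rfl fun k _ => ?_
    rw [← Finset.sum_neg_distrib]
    refine Finset.sum_congr rfl fun j _ => ?_
    rw [Φ.nn_anti, map_neg]; ring
  have h3 : (cst (6 * Complex.I) : PS n R) = 6 * Ic := by
    rw [map_mul, map_ofNat, Ic]
  rw [h1, h2, Finset.mul_sum, sub_neg_eq_add, ← Finset.sum_add_distrib]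
  refine Finset.sum_congr rfl fun k _ => ?_
  rw [strongForm, h3, Finset.mul_sum, Finset.mul_sum, ← Finset.sum_add_distrib]
  exact Finset.sum_congr rfl fun j _ => by ring

/-- The matrix of the real-linear map `ξ ↦ 6i𝓛(ξ̄, ·) + 𝓝(ξ, ·)` in the coordinates `(ξ, ξ̄)`. -/
def strongMat : Matrix (Fin n ⊕ Fin n) (Fin n ⊕ Fin n) R :=
  Matrix.fromBlocks Φ.nn (algebraMap ℂ R (-6 * Complex.I) • Φ.c.map (starRingEnd R))
    (algebraMap ℂ R (6 * Complex.I) • Φ.c) (Φ.nn.map (starRingEnd R))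

/-- The exchange of the two halves of a vector, composed with conjugation. -/
def swapBar (v : Fin n ⊕ Fin n → PS n R) : Fin n ⊕ Fin n → PS n R := fun i => bar (v i.swap)

theorem vecMul_inl (ξ : Fin n → PS n R) (k : Fin n) :
    Matrix.vecMul (Sum.elim ξ fun j => bar (ξ j)) (Φ.strongMat.map C) (Sum.inl k) =
      Φ.strongForm ξ k := by
  simp only [Matrix.vecMul, dotProduct, Fintype.sum_sum_type, strongForm, strongMat, cst_def,
    Finset.sum_add_distrib]
  rw [add_comm]
  simp [mul_comm]

theorem isUnit_det_strongMat_map : IsUnit (Φ.strongMat.map (C : R →+* PS n R)).det := by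
  have h := Φ.strong.map (C : R →+* PS n R)
  rwa [RingHom.map_det] at h

variable [StarModule ℂ R]

/-- The matrix comes from a real-linear map, hence commutes with the real structure (x, y) ↦ (ȳ,
x̄), whose fixed vectors are the pairs (ξ, ξ̄). -/
theorem swapBar_vecMul (v : Fin n ⊕ Fin n → PS n R) :
    Matrix.vecMul (swapBar v) (Φ.strongMat.map C) =
      swapBar (Matrix.vecMul v (Φ.strongMat.map C)) := by
  have hst : ∀ r : R, starRingEnd R r = star r := fun _ => rfl
  funext i
  rcases i with k | k
  · simp [Matrix.vecMul, dotProduct, swapBar, strongMat, Fintype.sum_sum_type, bar_C,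
      hst, ← algebraMap_star_comm, add_comm]
  · simp [Matrix.vecMul, dotProduct, swapBar, strongMat, Fintype.sum_sum_type, bar_C,
      hst, ← algebraMap_star_comm, add_comm]

/-- The system for (ξ, ξ̄) is solved by inverting the matrix on (l, l̄). The right-hand side is
fixed by the real structure, so by injectivity the solution is too, and it really has the form (ξ,
ξ̄). -/
theorem exists_strongForm (l : Fin n → PS n R) : ∃ ξ, ∀ k, Φ.strongForm ξ k = l k := by
  classical
  let M := Φ.strongMat.map (C : R →+* PS n R)
  have hM : IsUnit M.det := Φ.isUnit_det_strongMat_map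
  let b : Fin n ⊕ Fin n → PS n R := Sum.elim l fun j => bar (l j)
  let v := Matrix.vecMul b M⁻¹
  have hv : Matrix.vecMul v M = b := by
    rw [Matrix.vecMul_vecMul, Matrix.nonsing_inv_mul _ hM, Matrix.vecMul_one]
  have hb : swapBar b = b := by
    funext i
    rcases i with i | i <;> simp [b, swapBar]
  have hs : swapBar v = v := by
    have h1 : Matrix.vecMul (swapBar v) M = Matrix.vecMul v M := by
      rw [Φ.swapBar_vecMul, hv, hb]
    have h2 := congrArg (fun w => Matrix.vecMul w M⁻¹) h1
    simpa [Matrix.vecMul_vecMul, Matrix.mul_nonsing_inv _ hM] using h2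
  refine ⟨fun j => v (Sum.inl j), fun k => ?_⟩
  have h3 : (Sum.elim (fun j => v (Sum.inl j)) fun j => bar (v (Sum.inl j))) = v := by
    funext i
    rcases i with i | i
    · rfl
    · exact congrFun hs (Sum.inr i)
  rw [← Φ.vecMul_inl, h3]
  exact congrFun hv (Sum.inl k)

theorem eq_zero_of_strongForm {ξ : Fin n → PS n R} (h : ∀ k, Φ.strongForm ξ k = 0) : ξ = 0 := by
  classical
  let M := Φ.strongMat.map (C : R →+* PS n R)
  have hM : IsUnit M.det := Φ.isUnit_det_strongMat_map
  let v : Fin n ⊕ Fin n → PS n R := Sum.elim ξ fun j => bar (ξ j)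
  have hs : swapBar v = v := by
    funext i
    rcases i with i | i <;> simp [v, swapBar]
  have hv : Matrix.vecMul v M = 0 := by
    have h1 := Φ.swapBar_vecMul v
    rw [hs] at h1
    funext i
    rcases i with i | i
    · exact (Φ.vecMul_inl ξ i).trans (h i)
    · rw [congrFun h1 (Sum.inr i), swapBar, Sum.swap_inr]
      rw [(Φ.vecMul_inl ξ i).trans (h i), map_zero]
      rfl
  have h2 := congrArg (fun w => Matrix.vecMul w M⁻¹) hv
  have h3 : v = 0 := by
    simpa [Matrix.vecMul_vecMul, Matrix.mul_nonsing_inv _ hM] using h2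
  funext j
  exact congrFun h3 (Sum.inl j)

/-- A linear form l in z is ∑ z_k ∂l/∂z_k, so its coefficients can be prescribed one by one.
Projection to bidegree (0,0) removes z and z̄ from ξ. -/
theorem exists_strong {l : PS n R} (hl : cp 1 0 l = l) :
    ∃ ξ : Fin n → PS n R, cpv 0 0 ξ = ξ ∧ 6 * Ic * bar (Φ.CC ξ) - Φ.NN ξ = l := by
  obtain ⟨ξ, hξ⟩ := Φ.exists_strongForm fun k => pderiv R (iz k) l
  refine ⟨cpv 0 0 ξ, funext fun k => cp_cp_self _ _ _, ?_⟩
  have h1 : ∀ k, Φ.strongForm (cpv 0 0 ξ) k = pderiv R (iz k) l := fun k => by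
    have h := congrArg (cp 0 0) (hξ k)
    rw [cp_pderiv_z, zero_add, hl] at h
    rw [← h]
    simp only [strongForm, cpv, map_sum, map_add, mul_assoc, cp_cst_mul, cp_C_mul, cp_bar]
  rw [← sum_X_mul_strongForm]
  simp only [h1]
  rw [← ee_apply]
  calc ee l = ee (cp 1 0 l) := by rw [hl]
    _ = l := by rw [ee_cp, hl]; simp

theorem eq_zero_of_strong {ξ : Fin n → PS n R} (hξ : cpv 0 0 ξ = ξ)
    (h : 6 * Ic * bar (Φ.CC ξ) - Φ.NN ξ = 0) : ξ = 0 := by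
  classical
  refine Φ.eq_zero_of_strongForm fun k => ?_
  have hcp : ∀ k, cp 0 0 (Φ.strongForm ξ k) = Φ.strongForm ξ k := fun k => by
    have hj : ∀ j, cp 0 0 (ξ j) = ξ j := fun j => congrFun hξ j
    simp only [strongForm, map_sum, map_add, mul_assoc, cp_cst_mul, cp_C_mul, cp_bar, hj]
  have hd : ∀ i k, pderiv R (iz i) (Φ.strongForm ξ k) = 0 := fun i k => by
    rw [← hcp]; exact pderiv_z_cp_zero _ _ _
  have h2 := congrArg (pderiv R (iz k)) (Φ.sum_X_mul_strongForm ξ)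
  rw [h, map_zero] at h2
  simp only [map_sum, Derivation.leibniz, hd, pderiv_X, smul_eq_mul, mul_zero, zero_add] at h2
  rw [Finset.sum_eq_single k] at h2
  · simpa using h2
  · intro b _ hb; simp [hb]
  · simp

end Frame

end FormalCR

/-! ### Injectivity of the radial linearized problem -/

namespace FormalCR

open MvPowerSeries

section NCL

variable {n : ℕ} {R : Type*} [CommRing R]

/-- `p` has no constant and no linear terms. -/
def NCL (p : PS n R) : Prop := ∀ α : MIdx n, α.degree ≤ 1 → coeff α p = 0

theorem degree_eq (α : MIdx n) :
    α.degree = ∑ j, α (iz j) + (∑ j, α (izb j) + α iu) := by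
  rw [Finsupp.degree_eq_sum, Fintype.sum_sum_type, Fintype.sum_sum_type]
  simp

theorem coeff_cp_zero_zero {p : PS n R} {m : ℕ}
    (h : ∀ α : MIdx n, α.degree ≤ m → coeff α p = 0) {α : MIdx n} (hα : α iu ≤ m) :
    coeff α (cp 0 0 p) = 0 := by
  rw [coeff_cp]
  split_ifs with h1
  · refine h α ?_
    rw [degree_eq]; omega
  · rfl

theorem NCL.coeff_cp_one_zero {p : PS n R} (h : NCL p) {α : MIdx n} (hα : α iu = 0) :
    coeff α (cp 1 0 p) = 0 := by
  rw [coeff_cp]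
  split_ifs with h1
  · refine h α ?_
    rw [degree_eq]; omega
  · rfl

/-- Monomials of degree at most one lie in bidegrees (0,0), (1,0) and (0,1); in these only the
lowest powers of u are concerned. -/
theorem ncl_of_cp {p : PS n R} (h0 : ∀ α : MIdx n, α iu ≤ 1 → coeff α (cp 0 0 p) = 0)
    (h1 : ∀ α : MIdx n, α iu = 0 → coeff α (cp 1 0 p) = 0)
    (h2 : ∀ α : MIdx n, α iu = 0 → coeff α (cp 0 1 p) = 0) : NCL p := by
  intro α hα
  rw [degree_eq] at hα
  by_cases hz : ∑ j, α (iz j) = 0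
  · by_cases hb : ∑ j, α (izb j) = 0
    · have := h0 α (by omega)
      rwa [coeff_cp, if_pos (by omega)] at this
    · have := h2 α (by omega)
      rwa [coeff_cp, if_pos (by omega)] at this
  · have := h1 α (by omega)
    rwa [coeff_cp, if_pos (by omega)] at this

theorem coeff_cp_one_zero_of_mem_wfil {p : PS n R} (hp : p ∈ wfil R wwt 2) {α : MIdx n}
    (hα : α iu = 0) : coeff α (cp 1 0 p) = 0 := by
  rw [coeff_cp]
  split_ifs with h
  · exact hp α (by rw [weight_wwt]; omega)
  · rfl

theorem coeff_cp_zero_one_of_mem_wfil {p : PS n R} (hp : p ∈ wfil R wwt 2) {α : MIdx n}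
    (hα : α iu = 0) : coeff α (cp 0 1 p) = 0 := by
  rw [coeff_cp]
  split_ifs with h
  · exact hp α (by rw [weight_wwt]; omega)
  · rfl

end NCL

namespace Frame

variable {n : ℕ} {R : Type*} [CommRing R] [StarRing R] [Algebra ℂ R] (Φ : Frame n R)

/-- The normalization conditions on the radial part of the `w`-component. -/
structure RadNormal (T : PS n R) : Prop where
  skew : T + bar T = 0
  one_one : pderiv R iu (cp 1 1 T) = 0
  one : ∀ a : ℕ, cp (a + 2) 1 T = 0
  trace_one : Φ.tr (cp 2 2 T) = 0
  trace_two : Φ.tr (Φ.tr (cp 3 2 T)) = 0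
  trace_three : Φ.tr (Φ.tr (Φ.tr (cp 3 3 T))) = 0

variable [StarModule ℂ R]

/-- The triangular elimination: f_{00} from (2,1) and (3,2); then g_{00} and f_{10} from (1,1),
(2,2) and (3,3); then the f_{a0} with a ≥ 2 from (a,1) by induction. These components determine f,
and skewness then kills g. The conditions only control f_{00}'', f_{10}' and g_{00}'''; the
assumptions on low-order terms remove the integration constants. -/
theorem eq_zero_of_radNormal (hn : 1 ≤ n) {f : Fin n → PS n R} {g : PS n R}
    (hf : ∀ k, NCL (f k)) (hg : NCL g) (hr : bar g = g)
    (hg2 : coeff (Finsupp.single iu 2) g = 0) (hD : ∀ k, Φ.DDb (f k) = 0)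
    (hN : Φ.RadNormal (Φ.TT f g)) : f = 0 ∧ g = 0 := by
  have hI : (Ic : PS n R) * Ic = -1 := Ic_mul_Ic
  have hT := hN.skew
  -- the components `f_{00}`
  have hF00 : cpv 0 0 f = 0 := by
    have h21 := Φ.TT_two_one hD hr hT
    have h32 := Φ.TT_three_two hD hr hT
    have hT21 : cp 2 1 (Φ.TT f g) = 0 := by simpa using hN.one 0
    rw [hT21, mul_zero] at h21
    have h21' := congrArg (pderiv R iu) h21
    have e1 : pderiv R iu (-8 * Ic * Φ.CC (cpv 2 0 f)
        - 4 * Ic * Φ.Q * pderiv R iu (Φ.NN (cpv 0 0 f))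
        - 16 * Φ.Q * bar (pderiv R iu (Φ.CC (cpv 0 0 f)))) =
        -8 * (Ic * pderiv R iu (Φ.CC (cpv 2 0 f)))
        - 4 * (Ic * (Φ.Q * pderiv R iu (pderiv R iu (Φ.NN (cpv 0 0 f)))))
        - 16 * (Φ.Q * bar (pderiv R iu (pderiv R iu (Φ.CC (cpv 0 0 f))))) := by
      have c8 : (-8 : PS n R) = cst (-8) := by rw [map_neg, map_ofNat]
      have c4 : (4 : PS n R) = cst 4 := by rw [map_ofNat]
      have c16 : (16 : PS n R) = cst 16 := by rw [map_ofNat]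
      simp only [c8, c4, c16, map_sub, mul_assoc, pderiv_cst_mul, pderiv_Ic_mul, pderiv_u_Q_mul,
        bar_pderiv_u]
    rw [e1, map_zero] at h21'
    let L := 6 * Ic * bar (Φ.CC (duv (duv (cpv 0 0 f)))) - Φ.NN (duv (duv (cpv 0 0 f)))
    -- The u-derivative of the (2,1) equation eliminates f_{20}' from the (3,2) component, leaving a
    -- multiple of Q².
    have hL : 30 * cp 3 2 (Φ.TT f g) = ((24 : ℕ) : PS n R) * (Φ.Q * (Φ.Q * L)) := by
      rw [h32]
      simp only [L, CC_duv, NN_duv]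
      push_cast
      linear_combination (-7 * Ic * Φ.Q) * h21' + (56 * Φ.Q * pderiv R iu (Φ.CC (cpv 2 0 f)) +
        28 * Φ.Q ^ 2 * pderiv R iu (pderiv R iu (Φ.NN (cpv 0 0 f)))) * hI
    have hLcp : cp 1 0 L = L := by
      have h0 : cpv 0 0 (duv (duv (cpv 0 0 f))) = duv (duv (cpv 0 0 f)) := by
        rw [cpv_duv, cpv_duv]
        congr 2
        exact funext fun k => cp_cp_self _ _ _
      have c6 : (6 : PS n R) = cst 6 := by rw [map_ofNat]
      simp only [L, map_sub, c6, mul_assoc, cp_cst_mul, cp_Ic_mul, cp_bar, cp_CC, cp_NN]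
      norm_num [h0]
    have h3 := congrArg (fun p => Φ.tr (Φ.tr p)) hL
    have c30 : (30 : PS n R) = ((30 : ℕ) : PS n R) := by norm_num
    simp only [c30, tr_natCast_mul, hN.trace_two, mul_zero] at h3
    rw [Φ.tr_tr_Q_Q_mul hLcp, ← mul_assoc, ← Nat.cast_mul] at h3
    have hL0 : L = 0 := by
      refine intCast_mul_cancel (a := (24 * ((2 * n + 4) * (n + 1)) : ℕ)) (by positivity) ?_
      rw [mul_zero, h3, Int.cast_natCast]
    have h4 := Φ.eq_zero_of_strong (by
      rw [cpv_duv, cpv_duv]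
      congr 2
      exact funext fun k => cp_cp_self _ _ _) hL0
    funext k
    refine eq_zero_of_pderiv_u_u (congrFun h4 k) fun α hα => ?_
    exact coeff_cp_zero_zero (hf k) hα
  -- the components `g_{00}` and `f_{10}`
  have h11 : Φ.Q * pderiv R iu (pderiv R iu (cp 0 0 g)) =
      Φ.CC (duv (cpv 1 0 f)) + bar (Φ.CC (duv (cpv 1 0 f))) := by
    have h := hN.one_one
    rw [Φ.TT_one_one hD hr hT, pderiv_Ic_mul, map_sub, map_sub, pderiv_u_Q_mul] at h
    have h' := Ic_mul_cancel (h.trans (mul_zero _).symm)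
    rw [CC_duv, bar_pderiv_u]
    linear_combination h'
  have hcp1 : cp 1 1 (Φ.CC (duv (cpv 1 0 f))) = Φ.CC (duv (cpv 1 0 f)) := by
    rw [cp_CC, cpv_duv]
    norm_num
    congr 2
    exact funext fun k => cp_cp_self _ _ _
  -- The (2,2) component is 2Q times the difference of the two sides, and ψ ↦ tr(Qψ) is injective in
  -- bidegree (1,1).
  have h22 : Φ.CC (duv (cpv 1 0 f)) = bar (Φ.CC (duv (cpv 1 0 f))) := by
    rw [← sub_eq_zero]
    refine Φ.eq_zero_of_tr_Q_mul (by rw [map_sub, cp_bar, hcp1]) ?_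
    have h := hN.trace_one
    rw [Φ.TT_two_two hD hr hT, mul_assoc, show (2 : PS n R) = ((2 : ℕ) : PS n R) by norm_num,
      tr_natCast_mul] at h
    rw [CC_duv]
    exact two_mul_cancel (by rw [mul_zero]; exact_mod_cast h)
  have hg00 : cp 0 0 g = 0 := by
    have h33 := hN.trace_three
    have h11' := congrArg (pderiv R iu) h11
    rw [pderiv_u_Q_mul, CC_duv, map_add, ← bar_pderiv_u] at h11'
    rw [Φ.TT_three_three hD hr hT, ← h11', mul_assoc, mul_assoc, tr_Ic_mul, tr_Ic_mul, tr_Ic_mul,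
      Φ.tr_tr_tr_Q_Q_Q_mul (by simp only [cp_pderiv_u, cp_cp_self])] at h33
    have h3 := Ic_mul_cancel (h33.trans (mul_zero _).symm)
    -- The numerical factor is nonzero because n ≥ 1. The three integration constants are the
    -- constant, linear and u² coefficients of g.
    refine eq_zero_of_pderiv_u_u_u (intCast_mul_cancel
      (a := ((3 * n + 6) * ((2 * n + 2) * n) : ℕ)) (by positivity) (by
        rw [mul_zero, Int.cast_natCast, h3])) fun α hα => ?_
    rw [coeff_cp]
    split_ifs with h
    · by_cases h2 : α iu = 2
      · have : α = Finsupp.single iu 2 := by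
          have h3 := h.1
          have h4 := h.2
          norm_cast at h3 h4
          rw [Finset.sum_eq_zero_iff] at h3 h4
          ext i
          rcases i with i | i | i
          · simpa using h3 i (Finset.mem_univ _)
          · simpa using h4 i (Finset.mem_univ _)
          · simpa using h2
        rw [this, hg2]
      · refine hg α ?_
        rw [degree_eq]; omega
    · rfl
  have hF10 : cpv 1 0 f = 0 := by
    have h1 : Φ.CC (duv (cpv 1 0 f)) = 0 := by
      rw [hg00, map_zero, map_zero, mul_zero, ← h22] at h11
      exact two_mul_cancel (by rw [mul_zero, h11]; ring)
    have h2 := Φ.eq_zero_of_CC (a := 1) (by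
      rw [cpv_duv]
      congr 1
      exact funext fun k => cp_cp_self _ _ _) h1
    funext k
    exact eq_zero_of_pderiv_u (congrFun h2 k) fun α hα => (hf k).coeff_cp_one_zero hα
  have hFa0 : ∀ a : ℕ, cpv a 0 f = 0 := by
    intro a
    induction a using Nat.strong_induction_on with
    | _ a ih =>
      match a with
      | 0 => exact_mod_cast hF00
      | 1 => exact_mod_cast hF10
      | 2 =>
        have h := Φ.TT_two_one hD hr hT
        have hT21 : cp 2 1 (Φ.TT f g) = 0 := by simpa using hN.one 0
        rw [hT21, hF00] at h
        simp only [map_zero, mul_zero, sub_zero] at h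
        refine Φ.eq_zero_of_CC (a := 2) (funext fun k => cp_cp_self _ _ _)
          (intCast_mul_cancel (a := -8) (by norm_num) (Ic_mul_cancel ?_))
        push_cast
        linear_combination -h
      | a + 3 =>
        have h := Φ.TT_one hD hr hT (a := a + 3) (by omega)
        have h0 := hN.one (a + 1)
        push_cast at h0
        rw [show (a : ℤ) + 1 + 2 = a + 3 by ring] at h0
        have h1 := ih (a + 1) (by omega)
        push_cast at h1
        rw [h0, show (a : ℤ) + 3 - 2 = a + 1 by ring, h1] at h
        simp only [map_zero, mul_zero, sub_zero] at h
        refine Φ.eq_zero_of_CC (a := (a + 3 : ℕ)) (funext fun k => cp_cp_self _ _ _)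
          (intCast_mul_cancel (a := -2 * (a + 3) * (a + 2)) (by
            have : (0 : ℤ) < 2 * (a + 3) * (a + 2) := by positivity
            nlinarith) (Ic_mul_cancel ?_))
        push_cast at h ⊢
        linear_combination -h
  have hf0 := Φ.eq_zero_of_DDb hD hFa0
  refine ⟨hf0, cp_ext fun a b => ?_⟩
  rw [map_zero]
  have h := Φ.add_mul_cp hD hr hT a b
  have hz : ∀ a b : ℤ, cpv a b (0 : Fin n → PS n R) = 0 := fun a b => funext fun k => by
    simp [cpv]
  rw [hf0] at h
  simp only [hz, map_zero, mul_zero, sub_zero, add_zero] at h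
  by_cases hab : (a : ℤ) + b = 0
  · obtain rfl : a = 0 := by omega
    obtain rfl : b = 0 := by omega
    exact_mod_cast hg00
  · refine intCast_mul_cancel hab ?_
    push_cast at h ⊢
    rw [h, mul_zero]

end Frame

end FormalCR

/-! ### Weighted order of the model operators and elimination of g -/

namespace FormalCR

open MvPowerSeries

section Filtration

variable {n : ℕ} {R : Type*} [CommRing R]

theorem wfil_C_mul {d : ℤ} (r : R) {p : PS n R} (hp : p ∈ wfil R wwt d) :
    C r * p ∈ wfil R wwt d := by
  rw [← smul_eq_C_mul]; exact Submodule.smul_mem _ _ hp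

theorem wfil_X_mul {d k : ℤ} (i : Var n) {p : PS n R} (hp : p ∈ wfil R wwt d)
    (h : k ≤ wwt i + d) : X i * p ∈ wfil R wwt k := wfil_mul' (wfil_X i) hp h

theorem wfil_ee {d : ℤ} {p : PS n R} (hp : p ∈ wfil R wwt d) : ee p ∈ wfil R wwt d :=
  fun α hα => by rw [coeff_ee, hp α hα, mul_zero]

theorem NCL.mem_wfil {p : PS n R} (h : NCL p) : p ∈ wfil R wwt 2 := fun α hα => by
  refine h α ?_
  have := degree_le_weight (w := wwt) one_le_wwt α
  omega

end Filtration

namespace Frame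

variable {n : ℕ} {R : Type*} [CommRing R] [StarRing R] [Algebra ℂ R] (Φ : Frame n R)

theorem Q_mem_wfil : Φ.Q ∈ wfil R wwt 2 :=
  sum_mem fun _ _ => sum_mem fun _ _ => wfil_C_mul _
    (wfil_mul' (wfil_X _) (wfil_X _) (by rw [wwt_z, wwt_zb]; norm_num))

theorem DD_mem_wfil {d : ℤ} {p : PS n R} (hp : p ∈ wfil R wwt d) : Φ.DD p ∈ wfil R wwt d := by
  refine add_mem (wfil_ee hp) ?_
  rw [mul_assoc]
  exact wfil_C_mul _ (wfil_mul' Φ.Q_mem_wfil (wfil_pderiv hp iu) (by rw [wwt_u]; omega))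

theorem CC_mem_wfil {d k : ℤ} {f : Fin n → PS n R} (hf : ∀ k, f k ∈ wfil R wwt d)
    (h : k ≤ 1 + d) : Φ.CC f ∈ wfil R wwt k := by
  rw [CC_apply]
  exact sum_mem fun j _ => sum_mem fun k _ => wfil_C_mul _ (wfil_X_mul _ (hf k) h)

theorem NN_mem_wfil {d k : ℤ} {f : Fin n → PS n R} (hf : ∀ k, f k ∈ wfil R wwt d)
    (h : k ≤ 1 + d) : Φ.NN f ∈ wfil R wwt k := by
  rw [NN_apply]
  exact sum_mem fun j _ => sum_mem fun k _ => wfil_C_mul _ (wfil_X_mul _ (hf k) h)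

theorem TT_mem_wfil {d : ℤ} {f : Fin n → PS n R} {g : PS n R} (hf : ∀ k, f k ∈ wfil R wwt d)
    (hg : g ∈ wfil R wwt d) : Φ.TT f g ∈ wfil R wwt d := by
  refine sub_mem (sub_mem (sub_mem (Φ.DD_mem_wfil hg) (wfil_C_mul _ ?_)) (wfil_C_mul _ ?_))
    (wfil_C_mul _ ?_)
  · exact Φ.CC_mem_wfil (fun k => Φ.DD_mem_wfil (hf k)) (by omega)
  · exact bar_mem_wfil (Φ.CC_mem_wfil hf (by omega))
  · exact Φ.NN_mem_wfil (fun k => sub_mem (Φ.DD_mem_wfil (hf k)) (hf k)) (by omega)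

theorem TT_eq (f : Fin n → PS n R) (g : PS n R) : Φ.TT f g = Φ.DD g + Φ.TT f 0 := by
  have h : Φ.DD (0 : PS n R) = 0 := by simp [DD]
  simp only [TT, h]; ring

theorem cp_TT_zero (f : Fin n → PS n R) : cp 0 0 (Φ.TT f 0) = 0 := by
  simp only [TT, DD, map_sub, map_add, map_zero, mul_zero, mul_assoc, cp_Ic_mul, cp_cst_mul,
    cp_bar, cp_CC, cp_NN]
  simp [cpv_of_neg_left, cpv_of_neg_right]

theorem exists_homogeneous (P : ℕ → Fin n → PS n R) (hP : ∀ a : ℕ, cpv a 0 (P a) = P a) :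
    ∃ f : Fin n → PS n R, (∀ k, Φ.DDb (f k) = 0) ∧ ∀ a : ℕ, cpv a 0 f = P a := by
  have key : ∀ k, ∃ f : PS n R, Φ.DDb f = 0 ∧ ∀ a : ℕ, cp a 0 f = P a k := fun k => by
    obtain ⟨φ, hφ⟩ := exists_assemble (fun a b => if b = 0 then P a k else 0) fun a b => by
      split_ifs with h
      · subst h; exact congrFun (hP a) k
      · exact map_zero _
    obtain ⟨f, h1, h2⟩ := Φ.exists_DDb (q := 0) (φ := φ) (fun a => map_zero _)
    refine ⟨f, h1, fun a => ?_⟩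
    rw [h2]
    simpa using hφ a 0
  choose f h1 h2 using key
  exact ⟨f, h1, fun a => funext fun k => h2 k a⟩

variable [StarModule ℂ R]

/-- For real g the term iQ ∂g/∂u cancels against its conjugate, leaving only Euler operators acting
on g. -/
theorem TT_add_bar_TT (f : Fin n → PS n R) {g : PS n R} (hg : bar g = g) :
    Φ.TT f g + bar (Φ.TT f g) = ee g + eb g + (Φ.TT f 0 + bar (Φ.TT f 0)) := by
  rw [TT_eq, map_add, bar_DD, hg, DD, DDb]; ring

/-- Skewness is an Euler equation for g, solvable with free component g_{00}. Its right-hand side is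
real, so ḡ solves the same equation with the same (0,0) component, and g = ḡ by uniqueness. -/
theorem exists_real_skew (f : Fin n → PS n R) {q g₀ : PS n R} (hq : cp 0 0 q = 0)
    (hg₀ : bar g₀ = g₀) : ∃ g, bar g = g ∧ cp 0 0 g = cp 0 0 g₀ ∧
      (q + Φ.TT f g) + bar (q + Φ.TT f g) = 0 := by
  obtain ⟨g, h1, h2⟩ := exists_ee_add_eb (s := -(Φ.TT f 0 + bar (Φ.TT f 0) + q + bar q))
    (g₀ := g₀) (by simp only [map_neg, map_add, cp_bar, cp_TT_zero, hq]; simp)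
  have hr : bar g = g := by
    rw [← sub_eq_zero]
    refine eq_zero_of_ee_add_eb ?_ ?_
    · have h3 := congrArg bar h1
      rw [map_add, bar_ee, bar_eb] at h3
      simp only [map_neg, map_add, bar_bar] at h3
      rw [map_sub, map_sub]
      linear_combination h3 - h1
    · rw [map_sub, cp_bar, h2, ← cp_bar, hg₀, sub_self]
  refine ⟨g, hr, h2, ?_⟩
  have h4 := Φ.TT_add_bar_TT f hr
  rw [map_add]
  linear_combination h4 + h1

/-- The right-hand side of the Euler equation for g has weight at least two, so g has no terms
linear in z or z̄; the constant and the u-term belong to g_{00}. -/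
theorem ncl_of_skew {f : Fin n → PS n R} (hf : ∀ k, NCL (f k)) {q g : PS n R}
    (hq : q ∈ wfil R wwt 2) (hr : bar g = g) (hs : (q + Φ.TT f g) + bar (q + Φ.TT f g) = 0)
    (h0 : ∀ α : MIdx n, α iu ≤ 1 → coeff α (cp 0 0 g) = 0) : NCL g := by
  have h1 := Φ.TT_add_bar_TT f hr
  have hW : Φ.TT f 0 ∈ wfil R wwt 2 := Φ.TT_mem_wfil (fun k => (hf k).mem_wfil) (zero_mem _)
  have h2 : ee g + eb g ∈ wfil R wwt 2 := by
    have : ee g + eb g = -(Φ.TT f 0 + bar (Φ.TT f 0) + q + bar q) := by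
      rw [map_add] at hs
      linear_combination hs - h1
    rw [this]
    exact neg_mem (add_mem (add_mem (add_mem hW (bar_mem_wfil hW)) hq) (bar_mem_wfil hq))
  refine ncl_of_cp h0 (fun α hα => ?_) fun α hα => ?_
  · have h3 := coeff_cp_one_zero_of_mem_wfil h2 hα
    rw [map_add, cp_ee, cp_eb] at h3
    simpa using h3
  · have h3 := coeff_cp_zero_one_of_mem_wfil h2 hα
    rw [map_add, cp_ee, cp_eb] at h3
    simpa using h3

end Frame

/-- A sequence determined by three initial values and a recursion of step two. -/
def recThree {X : Type*} (a b c : X) (F : ℕ → X → X) : ℕ → X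
  | 0 => a
  | 1 => b
  | 2 => c
  | k + 3 => F k (recThree a b c F (k + 1))

end FormalCR

/-! ### Choice of the free parameters f_{a0} and g_{00} -/

namespace FormalCR

open MvPowerSeries

section

variable {n : ℕ} {R : Type*} [CommRing R]

theorem cp_X_u_mul (a b : ℤ) (p : PS n R) : cp a b (X iu * p) = X iu * cp a b p := by
  rw [cp, comp_X_mul, wbi_u, sub_zero]

theorem cp_one : cp 0 0 (1 : PS n R) = 1 := by
  classical
  ext α
  rw [coeff_cp, coeff_one]
  by_cases h : α = 0
  · subst h; simp
  · simp [h]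

variable [StarRing R] [Algebra ℂ R] [StarModule ℂ R]

/-- The series `ρ u² + ∭ γ`. -/
theorem exists_primitive (ρ : R) (hρ : star ρ = ρ) {γ : PS n R} (hγ : bar γ = γ)
    (hγ0 : cp 0 0 γ = γ) : ∃ g : PS n R, bar g = g ∧ cp 0 0 g = g ∧
      pderiv R iu (pderiv R iu (pderiv R iu g)) = γ ∧
      (∀ α : MIdx n, α iu ≤ 1 → coeff α g = 0) ∧ coeff (Finsupp.single iu 2) g = ρ := by
  classical
  have hX : ∀ α : MIdx n, coeff α (X iu * (X iu * 1) : PS n R) =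
      if α = Finsupp.single iu 2 then 1 else 0 := fun α => by
    rw [mul_one, ← pow_two, X_pow_eq, coeff_monomial]
  refine ⟨C ρ * (X iu * (X iu * 1)) + Iu (Iu (Iu γ)), ?_, ?_, ?_, fun α hα => ?_, ?_⟩
  · simp only [map_add, map_mul, bar_C, bar_X_u, hρ, map_one, bar_Iu, hγ]
  · simp only [map_add, cp_C_mul, cp_X_u_mul, cp_one, cp_Iu, hγ0]
  · simp [pderiv_Iu]
  · rw [map_add, coeff_C_mul, hX, if_neg (by rintro rfl; simp at hα), mul_zero, zero_add]
    exact coeff_Iu_Iu_Iu (by omega) _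
  · rw [map_add, coeff_C_mul, hX, if_pos rfl, mul_one, coeff_Iu_Iu_Iu (by simp), add_zero]

end

namespace Frame

variable {n : ℕ} {R : Type*} [CommRing R] [StarRing R] [Algebra ℂ R] [StarModule ℂ R]
  (Φ : Frame n R)

/-- The choice of the free parameters `φ` and `g₀` for a given skew radial part `T`. -/
theorem exists_parameters (hn : 1 ≤ n) {T : PS n R} (hT : T + bar T = 0) (ρ : R)
    (hρ : star ρ = ρ) : ∃ (P : ℕ → Fin n → PS n R) (g : PS n R),
      (∀ a : ℕ, cpv a 0 (P a) = P a) ∧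
      (∀ k, ∀ α : MIdx n, α iu ≤ 1 → coeff α (P 0 k) = 0) ∧
      (∀ k, ∀ α : MIdx n, α iu = 0 → coeff α (P 1 k) = 0) ∧
      bar g = g ∧ cp 0 0 g = g ∧ (∀ α : MIdx n, α iu ≤ 1 → coeff α g = 0) ∧
      coeff (Finsupp.single iu 2) g = ρ ∧
      ∀ S : PS n R,
        cp 1 1 S = Ic * (Φ.Q * pderiv R iu g - Φ.CC (P 1) - bar (Φ.CC (P 1))) →
        6 * cp 2 1 S = -8 * Ic * Φ.CC (P 2) - 4 * Ic * Φ.Q * pderiv R iu (Φ.NN (P 0))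
          - 16 * Φ.Q * bar (pderiv R iu (Φ.CC (P 0))) →
        cp 2 2 S = 2 * Φ.Q * (pderiv R iu (Φ.CC (P 1)) - bar (pderiv R iu (Φ.CC (P 1)))) →
        30 * cp 3 2 S = 56 * Φ.Q * pderiv R iu (Φ.CC (P 2))
          + 32 * Ic * Φ.Q * Φ.Q * bar (pderiv R iu (pderiv R iu (Φ.CC (P 0))))
          + 4 * Φ.Q * Φ.Q * pderiv R iu (pderiv R iu (Φ.NN (P 0))) →
        cp 3 3 S = Ic * Φ.Q * Φ.Q * (pderiv R iu (pderiv R iu (Φ.CC (P 1)))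
          + bar (pderiv R iu (pderiv R iu (Φ.CC (P 1))))) →
        (∀ a : ℕ, (((a + 3 : ℕ) : PS n R) + 1) * (((a + 3 : ℕ) : PS n R) - 1)
            * cp (a + 3) 1 S = -2 * ((a + 3 : ℕ) : PS n R) * (((a + 3 : ℕ) : PS n R) - 1)
            * Ic * Φ.CC (P (a + 3)) - 2 * Ic * Φ.Q * pderiv R iu (Φ.NN (P (a + 1)))) →
        S + bar S = 0 → Φ.RadNormal (T + S) := by
  have hI : (Ic : PS n R) * Ic = -1 := Ic_mul_Ic
  have hbT : ∀ a : ℤ, bar (cp a a T) = -cp a a T := fun a => by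
    rw [← cp_bar, ← map_neg]; congr 1; linear_combination hT
  -- the parameter of bidegree `(0, 0)` of `f`
  let κ : ℕ := (2 * n + 4) * (n + 1)
  have hκ : 24 * κ ≠ 0 := by positivity
  -- After elimination of f_{20} by (2,1), 30 times the (3,2) component of T + S is 30 T_{32} − 42
  -- iQ ∂T_{21}/∂u + 24 Q²l. This l makes its double trace vanish.
  let l : PS n R := cst (-(((24 * κ : ℕ) : ℂ)⁻¹)) * Φ.tr (Φ.tr (30 * cp 3 2 T
    - 42 * (Ic * (Φ.Q * pderiv R iu (cp 2 1 T)))))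
  have c30 : (30 : PS n R) = cst 30 := by rw [map_ofNat]
  have c42 : (42 : PS n R) = cst 42 := by rw [map_ofNat]
  have hl : cp 1 0 l = l := by
    simp only [l, cp_cst_mul, cp_tr, map_sub, c30, c42, cp_Ic_mul, cp_Q_mul, cp_pderiv_u]
    norm_num [cp_cp_self]
  have hl2 : ((24 * κ : ℕ) : PS n R) * l = -Φ.tr (Φ.tr (30 * cp 3 2 T
    - 42 * (Ic * (Φ.Q * pderiv R iu (cp 2 1 T))))) := by
    rw [← mul_assoc, ← map_natCast (cst : ℂ →+* PS n R), ← map_mul, mul_neg,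
      mul_inv_cancel₀ (Nat.cast_ne_zero.2 hκ), map_neg, map_one]
    ring
  obtain ⟨ξ, hξ0, hξ⟩ := Φ.exists_strong hl
  let P0 : Fin n → PS n R := fun k => Iu (Iu (ξ k))
  have hP0 : cpv 0 0 P0 = P0 := funext fun k => by
    have : cp 0 0 (ξ k) = ξ k := congrFun hξ0 k
    simp only [P0, cpv, cp_Iu, this]
  have hP0d : duv (duv P0) = ξ := funext fun k => by
    simp only [P0, duv, pderiv_Iu]
  -- the parameter `g`
  let κ' : ℕ := (3 * n + 6) * ((2 * n + 2) * n)
  have hκ' : κ' ≠ 0 := by positivity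
  -- The required value of g_{00}'''. Once (1,1) holds, the (3,3) component of T + S is T_{33} + Q²
  -- ∂²T_{11}/∂u² + iQ³γ, and its triple trace must vanish.
  let γ : PS n R := cst (((κ' : ℕ) : ℂ)⁻¹) * (Ic * Φ.tr (Φ.tr (Φ.tr (cp 3 3 T
    + Φ.Q * (Φ.Q * pderiv R iu (pderiv R iu (cp 1 1 T)))))))
  have hγ2 : (κ' : PS n R) * γ = Ic * Φ.tr (Φ.tr (Φ.tr (cp 3 3 T
    + Φ.Q * (Φ.Q * pderiv R iu (pderiv R iu (cp 1 1 T)))))) := by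
    rw [← mul_assoc, ← map_natCast (cst : ℂ →+* PS n R), ← map_mul,
      mul_inv_cancel₀ (Nat.cast_ne_zero.2 hκ'), map_one, one_mul]
  have hγb : bar γ = γ := by
    simp only [γ, map_mul, bar_cst, bar_tr, bar_Ic, map_add, bar_Q, bar_pderiv_u, hbT]
    simp
    ring
  have hγ0 : cp 0 0 γ = γ := by
    simp only [γ, cp_cst_mul, cp_tr, map_add, cp_Ic_mul, cp_Q_mul, cp_pderiv_u]
    norm_num [cp_cp_self]
  obtain ⟨g, hgb, hg0, hg3, hg1, hg2⟩ := exists_primitive ρ hρ hγb hγ0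
  -- the parameter of bidegree `(1, 0)` of `f`
  let K : PS n R := -(cst (1 / 2) * Φ.tr (cp 2 2 T))
  have hK : cp 1 1 K = K := by
    simp only [K, map_neg, cp_cst_mul, cp_tr]
    norm_num [cp_cp_self]
  have hKb : bar K = -K := by
    have hc : (starRingEnd ℂ) (1 / 2) = 1 / 2 := by rw [map_div₀, map_one, map_ofNat]
    simp only [K, map_neg, map_mul, bar_cst, bar_tr, hbT, RCLike.star_def, hc]
    ring
  obtain ⟨x, y, hx, hy, hψ⟩ := Φ.exists_tr_Q_mul hK
  -- The skew part of the sought 2𝓛(z̄, f_{10}'). The trace condition in bidegree (2,2) says exactly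
  -- that tr(Qψ) = K.
  let ψ : PS n R := cst x * K + cst y * (Φ.Q * Φ.tr K)
  have hψb : bar ψ = -ψ := by
    simp only [ψ, map_add, map_mul, bar_cst, bar_Q, bar_tr, hKb, hx, hy, map_neg]
    ring
  have hψ1 : cp 1 1 ψ = ψ := by
    simp only [ψ, map_add, cp_cst_mul, hK, cp_Q_mul, cp_tr]
    norm_num [hK]
  -- The real part, doubled: the (1,1) condition requires 𝓛(z̄, f_{10}') plus its conjugate to equal
  -- H.
  let H : PS n R := Φ.Q * pderiv R iu (pderiv R iu g) - Ic * pderiv R iu (cp 1 1 T)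
  have hHb : bar H = H := by
    simp only [H, map_sub, map_mul, bar_Ic, bar_Q, bar_pderiv_u, hgb, hbT, map_neg]
    ring
  have hH1 : cp 1 1 H = H := by
    simp only [H, map_sub, cp_Ic_mul, cp_Q_mul, cp_pderiv_u]
    norm_num [cp_cp_self, hg0]
  -- The only series with A1 + conj A1 = H and A1 − conj A1 = ψ, given that H is real and ψ is skew;
  -- it is the value of 𝓛(z̄, f_{10}').
  let A1 : PS n R := cst (1 / 2) * (H + ψ)
  have hA1 : cp 1 1 A1 = A1 := by simp only [A1, cp_cst_mul, map_add, hH1, hψ1]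
  have hA1b : bar A1 = cst (1 / 2) * (H - ψ) := by
    have hc : (starRingEnd ℂ) (1 / 2) = 1 / 2 := by rw [map_div₀, map_one, map_ofNat]
    simp only [A1, map_mul, bar_cst, map_add, hHb, hψb, RCLike.star_def, hc]
    ring
  let P1 : Fin n → PS n R := fun k => Iu (Φ.solveC A1 k)
  have hP1 : cpv 1 0 P1 = P1 := funext fun k => by
    have := congrFun (Φ.cpv_solveC hA1) k
    simp only [cpv] at this
    simp only [P1, cpv, cp_Iu, this]
  have hP1d : Φ.CC (duv P1) = A1 := by
    have : duv P1 = Φ.solveC A1 := funext fun k => by simp only [P1, duv, pderiv_Iu]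
    rw [this, Φ.CC_solveC hA1]
  -- the parameters of bidegree `(a, 0)`, `a ≥ 2`, of `f`
  let A2 : PS n R := cst (1 / 8) * (-Ic * (6 * cp 2 1 T - 4 * (Ic * (Φ.Q * pderiv R iu (Φ.NN P0)))
    - 16 * (Φ.Q * bar (pderiv R iu (Φ.CC P0)))))
  have hA2 : cp 2 1 A2 = A2 := by
    have c6 : (6 : PS n R) = cst 6 := by rw [map_ofNat]
    have c4 : (4 : PS n R) = cst 4 := by rw [map_ofNat]
    have c16 : (16 : PS n R) = cst 16 := by rw [map_ofNat]
    simp only [A2, c6, c4, c16, neg_mul, map_neg, map_sub, cp_cst_mul, cp_Ic_mul, cp_Q_mul,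
      cp_pderiv_u, cp_bar, cp_CC, cp_NN]
    norm_num [cp_cp_self, hP0]
  -- Solves the (a+3, 1) equation of `TT_one` for 𝓛(z̄, f_{a+3,0}), with p in the role of f_{a+1,0}:
  -- at a' = a + 3 the factors (a'+1)(a'−1) and 2a'(a'−1) become (a+4)(a+2) and 2(a+3)(a+2).
  let F : ℕ → (Fin n → PS n R) → PS n R := fun a p =>
    cst (((2 * (a + 3) * (a + 2) : ℕ) : ℂ)⁻¹) * (-Ic * ((((a + 4) * (a + 2) : ℕ) : PS n R) * cp (a + 3) 1 T
      - 2 * (Ic * (Φ.Q * pderiv R iu (Φ.NN p)))))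
  have hF : ∀ (a : ℕ) (p : Fin n → PS n R), cpv (a + 1) 0 p = p →
      cp (a + 3) 1 (F a p) = F a p := by
    intro a p hp
    have c2 : (2 : PS n R) = cst 2 := by rw [map_ofNat]
    simp only [F, c2, ← map_natCast (cst : ℂ →+* PS n R) ((a + 4) * (a + 2)), neg_mul, map_neg,
      map_sub, cp_cst_mul, cp_Ic_mul, cp_Q_mul, cp_pderiv_u, cp_NN, cp_cp_self]
    rw [show (a : ℤ) + 3 - 1 - 1 = a + 1 by ring, sub_self, hp]
  let P : ℕ → Fin n → PS n R := recThree P0 P1 (Φ.solveC A2) fun a p => Φ.solveC (F a p)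
  have hP3 : ∀ a, P (a + 3) = Φ.solveC (F a (P (a + 1))) := fun a => rfl
  have hP : ∀ a : ℕ, cpv a 0 (P a) = P a := by
    intro a
    induction a using Nat.strong_induction_on with
    | _ a ih =>
      match a with
      | 0 => exact_mod_cast hP0
      | 1 => exact_mod_cast hP1
      | 2 => exact Φ.cpv_solveC hA2
      | a + 3 =>
        have h := ih (a + 1) (by omega)
        push_cast at h ⊢
        exact Φ.cpv_solveC (hF a _ h)
  have hC2 : Φ.CC (P 2) = A2 := Φ.CC_solveC hA2
  have hC3 : ∀ a, Φ.CC (P (a + 3)) = F a (P (a + 1)) := fun a => by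
    have h := hP (a + 1)
    push_cast at h
    exact Φ.CC_solveC (hF a _ h)
  -- From here S plays the part of `TT` applied to the homogeneous solution with these parameters;
  -- only its listed components are used.
  refine ⟨P, g, hP, fun k α hα => coeff_Iu_Iu hα _, fun k α hα => coeff_Iu_of_eq_zero hα _,
    hgb, hg0, hg1, hg2, fun S s11 s21 s22 s32 s33 sa hS => ?_⟩
  have e0 : P 0 = P0 := rfl
  have e1 : P 1 = P1 := rfl
  rw [e0, hC2] at s21 s32
  rw [e1] at s11 s22 s33
  have hh := two_mul_half (n := n) (R := R)
  have h8 : (cst (1 / 8) : PS n R) * 8 = 1 := by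
    rw [← map_ofNat (cst : ℂ →+* PS n R) 8, ← map_mul]; norm_num
  have t21 : cp 2 1 (T + S) = 0 := by
    refine intCast_mul_cancel (a := 6) (by norm_num) ?_
    rw [map_add]
    push_cast
    simp only [A2] at s21
    linear_combination s21 + (Ic * Ic * (6 * cp 2 1 T
      - 4 * (Ic * (Φ.Q * pderiv R iu (Φ.NN P0)))
      - 16 * (Φ.Q * bar (pderiv R iu (Φ.CC P0))))) * h8 + (6 * cp 2 1 T
      - 4 * (Ic * (Φ.Q * pderiv R iu (Φ.NN P0)))
      - 16 * (Φ.Q * bar (pderiv R iu (Φ.CC P0)))) * hI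
  have d11 : pderiv R iu (cp 1 1 S) =
      Ic * (Φ.Q * pderiv R iu (pderiv R iu g) - A1 - bar A1) := by
    rw [s11, pderiv_Ic_mul, map_sub, map_sub, pderiv_u_Q_mul, ← bar_pderiv_u, ← CC_duv, hP1d]
  have hA1s : A1 + bar A1 = H := by
    rw [hA1b]; simp only [A1]; linear_combination H * hh
  refine ⟨?_, ?_, fun a => ?_, ?_, ?_, ?_⟩
  · rw [map_add]; linear_combination hT + hS
  · rw [map_add, map_add, d11]
    simp only [H] at hA1s
    linear_combination -Ic * hA1s + pderiv R iu (cp 1 1 T) * hI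
  · match a with
    | 0 => simpa using t21
    | a + 1 =>
      have h := sa a
      rw [hC3] at h
      have e : (((a + 1 : ℕ) : ℤ) + 2) = a + 3 := by push_cast; ring
      rw [e]
      refine intCast_mul_cancel (a := (a + 4) * (a + 2)) (by positivity) ?_
      have hF2 : ((2 * (a + 3) * (a + 2) : ℕ) : PS n R) * F a (P (a + 1)) =
          -Ic * ((((a + 4) * (a + 2) : ℕ) : PS n R) * cp (a + 3) 1 T
            - 2 * (Ic * (Φ.Q * pderiv R iu (Φ.NN (P (a + 1)))))) := by
        simp only [F]
        rw [← mul_assoc, ← map_natCast (cst : ℂ →+* PS n R) (2 * (a + 3) * (a + 2)), ← map_mul,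
          mul_inv_cancel₀ (Nat.cast_ne_zero.2 (by positivity)), map_one, one_mul]
      rw [map_add]
      push_cast at h hF2 ⊢
      linear_combination h - Ic * hF2 + ((a + 4) * (a + 2) * cp (a + 3) 1 T
            - 2 * (Ic * (Φ.Q * pderiv R iu (Φ.NN (P (a + 1)))))) * hI
  · have hs : cp 2 2 S = ((2 : ℕ) : PS n R) * (Φ.Q * ψ) := by
      rw [s22, ← CC_duv, hP1d, hA1b]
      simp only [A1]
      push_cast
      linear_combination 2 * Φ.Q * ψ * hh
    rw [map_add, map_add, hs, tr_natCast_mul, hψ]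
    simp only [K]
    push_cast
    linear_combination -Φ.tr (cp 2 2 T) * hh
  · have d21 : pderiv R iu A2 = cst (1 / 8) * (-Ic * (6 * pderiv R iu (cp 2 1 T)
        - 4 * (Ic * (Φ.Q * pderiv R iu (pderiv R iu (Φ.NN P0))))
        - 16 * (Φ.Q * bar (pderiv R iu (pderiv R iu (Φ.CC P0)))))) := by
      have c6 : (6 : PS n R) = cst 6 := by rw [map_ofNat]
      have c4 : (4 : PS n R) = cst 4 := by rw [map_ofNat]
      have c16 : (16 : PS n R) = cst 16 := by rw [map_ofNat]
      simp only [A2, c6, c4, c16, neg_mul, map_neg, map_sub, pderiv_cst_mul, pderiv_Ic_mul,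
        pderiv_u_Q_mul, bar_pderiv_u]
    rw [d21, ← CC_duv, ← CC_duv, ← NN_duv, ← NN_duv, hP0d] at s32
    have hs : 30 * cp 3 2 (T + S) = (30 * cp 3 2 T - 42 * (Ic * (Φ.Q * pderiv R iu (cp 2 1 T))))
        + ((24 : ℕ) : PS n R) * (Φ.Q * (Φ.Q * l)) := by
      rw [map_add, ← hξ]
      push_cast
      linear_combination s32 + 7 * Φ.Q * (-Ic * (6 * pderiv R iu (cp 2 1 T)
        - 4 * (Ic * (Φ.Q * Φ.NN ξ)) - 16 * (Φ.Q * bar (Φ.CC ξ)))) * h8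
        + 28 * Φ.Q * Φ.Q * Φ.NN ξ * hI
    have h30 : ((30 : ℕ) : PS n R) * Φ.tr (Φ.tr (cp 3 2 (T + S))) = 0 := by
      rw [← tr_natCast_mul, ← tr_natCast_mul]
      push_cast
      rw [hs, map_add, map_add, tr_natCast_mul, tr_natCast_mul, Φ.tr_tr_Q_Q_mul hl]
      push_cast [κ] at hl2 ⊢
      linear_combination hl2
    refine intCast_mul_cancel (a := 30) (by norm_num) ?_
    rw [mul_zero]
    exact_mod_cast h30
  · have d11' := congrArg (pderiv R iu) hA1s
    have hs : cp 3 3 (T + S) = cp 3 3 T + Φ.Q * (Φ.Q * pderiv R iu (pderiv R iu (cp 1 1 T)))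
        + Ic * (Φ.Q * (Φ.Q * (Φ.Q * γ))) := by
      simp only [H, map_add, map_sub, pderiv_Ic_mul, pderiv_u_Q_mul, hg3] at d11'
      rw [map_add, s33, ← CC_duv, hP1d, bar_pderiv_u]
      linear_combination Ic * Φ.Q * Φ.Q * d11' -
        Φ.Q * Φ.Q * pderiv R iu (pderiv R iu (cp 1 1 T)) * hI
    rw [hs, map_add, map_add, map_add, tr_Ic_mul, tr_Ic_mul, tr_Ic_mul,
      Φ.tr_tr_tr_Q_Q_Q_mul hγ0]
    change _ + Ic * ((κ' : PS n R) * γ) = 0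
    rw [hγ2]
    linear_combination Φ.tr (Φ.tr (Φ.tr (cp 3 3 T
      + Φ.Q * (Φ.Q * pderiv R iu (pderiv R iu (cp 1 1 T)))))) * hI

end Frame

end FormalCR

/-! ### Solvability of the radial linearized problem -/

namespace FormalCR

open MvPowerSeries

namespace Frame

variable {n : ℕ} {R : Type*} [CommRing R] [StarRing R] [Algebra ℂ R] (Φ : Frame n R)

theorem ncl_of_DDb {f q : PS n R} (hf : Φ.DDb f = q) (hq : q ∈ wfil R wwt 2)
    (h0 : ∀ α : MIdx n, α iu ≤ 1 → coeff α (cp 0 0 f) = 0)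
    (h1 : ∀ α : MIdx n, α iu = 0 → coeff α (cp 1 0 f) = 0) : NCL f := by
  refine ncl_of_cp h0 h1 fun α hα => ?_
  have h := congrArg (cp 0 1) hf
  simp only [DDb, map_sub, mul_assoc, cp_Ic_mul, cp_Q_mul, cp_pderiv_u, cp_eb] at h
  rw [cp_of_neg_left (a := 0 - 1) (by norm_num)] at h
  simp only [map_zero, mul_zero, sub_zero, Int.cast_one, one_mul] at h
  rw [h]
  exact coeff_cp_zero_one_of_mem_wfil hq hα

variable [StarModule ℂ R]

/-- Solvability of the radial part of the linearized normalization problem. -/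
theorem exists_radNormal (hn : 1 ≤ n) {q' : Fin n → PS n R} {q : PS n R}
    (hq' : ∀ (j : Fin n) (b : ℕ), cp 0 b (q' j) = 0) (hq : ∀ b : ℕ, cp 0 b q = 0)
    (hw' : ∀ j, q' j ∈ wfil R wwt 2) (hw : q ∈ wfil R wwt 2) {ρ : R} (hρ : star ρ = ρ) :
    ∃ (f : Fin n → PS n R) (g : PS n R), (∀ j, NCL (f j)) ∧ NCL g ∧ bar g = g ∧
      coeff (Finsupp.single iu 2) g = ρ ∧ (∀ j, Φ.DDb (f j) = bar (q' j)) ∧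
      Φ.RadNormal (q + Φ.TT f g) := by
  have hq0 : cp 0 0 q = 0 := by exact_mod_cast hq 0
  -- A particular solution with all f_{a0} equal to zero. Compatibility holds because q' has no
  -- component of degree zero in z, so its conjugate has none of degree zero in z̄.
  have key : ∀ j, ∃ f, Φ.DDb f = bar (q' j) ∧ ∀ a : ℕ, cp a 0 f = 0 := fun j => by
    obtain ⟨f, h1, h2⟩ := Φ.exists_DDb (q := bar (q' j)) (φ := 0) fun a => by
      rw [cp_bar, hq' j a, map_zero]
    exact ⟨f, h1, fun a => by rw [h2, map_zero]⟩
  choose fp hfp hfp0 using key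
  have hfpN : ∀ j, NCL (fp j) := fun j => Φ.ncl_of_DDb (hfp j) (bar_mem_wfil (hw' j))
    (fun α _ => by rw [show cp 0 0 (fp j) = 0 by exact_mod_cast hfp0 j 0, map_zero])
    (fun α _ => by rw [show cp 1 0 (fp j) = 0 by exact_mod_cast hfp0 j 1, map_zero])
  obtain ⟨gp, hgp, hgp0, hgps⟩ := Φ.exists_real_skew fp hq0 (g₀ := 0) (map_zero _)
  rw [map_zero] at hgp0
  have hgpN : NCL gp := Φ.ncl_of_skew hfpN hw hgp hgps fun α _ => by rw [hgp0, map_zero]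
  -- The particular solution leaves a skew radial part. A solution of the homogeneous equation with
  -- suitable parameters corrects it and supplies the u² coefficient.
  obtain ⟨P, g₀, hP, hP0, hP1, hg₀, hg₀0, hg₀1, hg₀2, hP2⟩ :=
    Φ.exists_parameters hn hgps ρ hρ
  obtain ⟨fh, hfh, hfhP⟩ := Φ.exists_homogeneous P hP
  have hfhN : ∀ j, NCL (fh j) := fun j => Φ.ncl_of_DDb (hfh j) (zero_mem _)
    (fun α hα => by
      have := congrFun (hfhP 0) j
      simp only [cpv, Nat.cast_zero] at this
      rw [this]; exact hP0 j α hα)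
    (fun α hα => by
      have := congrFun (hfhP 1) j
      simp only [cpv, Nat.cast_one] at this
      rw [this]; exact hP1 j α hα)
  obtain ⟨gh, hgh, hgh0, hghs⟩ := Φ.exists_real_skew fh (q := 0) (map_zero _) hg₀
  rw [hg₀0] at hgh0
  have hghN : NCL gh := Φ.ncl_of_skew hfhN (zero_mem _) hgh hghs fun α hα => by
    rw [hgh0]; exact hg₀1 α hα
  rw [zero_add] at hghs
  have f0 : cpv 0 0 fh = P 0 := by exact_mod_cast hfhP 0
  have f1 : cpv 1 0 fh = P 1 := by exact_mod_cast hfhP 1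
  have f2 : cpv 2 0 fh = P 2 := by exact_mod_cast hfhP 2
  have hc : ∀ p : PS n R, coeff (Finsupp.single iu 2) p =
      coeff (Finsupp.single iu 2) (cp 0 0 p) := fun p => by
    rw [coeff_cp, if_pos (by simp)]
  refine ⟨fp + fh, gp + gh, fun j α hα => ?_, fun α hα => ?_, ?_, ?_, fun j => ?_, ?_⟩
  · rw [Pi.add_apply, map_add, hfpN j α hα, hfhN j α hα, add_zero]
  · rw [map_add, hgpN α hα, hghN α hα, add_zero]
  · rw [map_add, hgp, hgh]
  · rw [hc, map_add, hgp0, hgh0, zero_add, hg₀2]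
  · rw [Pi.add_apply, DDb_add, hfp, hfh, add_zero]
  · rw [TT_add, ← add_assoc]
    refine hP2 (Φ.TT fh gh) ?_ ?_ ?_ ?_ ?_ (fun a => ?_) hghs
    · rw [Φ.TT_one_one hfh hgh hghs, hgh0, f1]
    · rw [Φ.TT_two_one hfh hgh hghs, f0, f2]
    · rw [Φ.TT_two_two hfh hgh hghs, f1]
    · rw [Φ.TT_three_two hfh hgh hghs, f0, f2]
    · rw [Φ.TT_three_three hfh hgh hghs, f1]
    · have h := Φ.TT_one hfh hgh hghs (a := a + 3) (by omega)
      have h1 := hfhP (a + 3)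
      have h2 := hfhP (a + 1)
      push_cast at h1 h2
      rw [h1, show (a : ℤ) + 3 - 2 = a + 1 by ring, h2] at h
      push_cast at h ⊢
      exact h

end Frame

end FormalCR

/-! ### The full linearized problem -/

namespace FormalCR

open MvPowerSeries

/-- The unknowns of the linearized problem: the map `id + (f, g)` and the components `zb`, `w` of
the perturbation of the model. -/
@[ext]
structure Unknown (n : ℕ) (R : Type*) where
  f : Fin n → PS n R
  g : PS n R
  zb : Fin n → Fin n → PS n R
  w : Fin n → PS n R

namespace Unknown

variable {n : ℕ} {R : Type*} [CommRing R]

instance : Sub (Unknown n R) :=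
  ⟨fun v v' => ⟨v.f - v'.f, v.g - v'.g, v.zb - v'.zb, v.w - v'.w⟩⟩

theorem sub_f (v v' : Unknown n R) : (v - v').f = v.f - v'.f := rfl
theorem sub_g (v v' : Unknown n R) : (v - v').g = v.g - v'.g := rfl
theorem sub_zb (v v' : Unknown n R) : (v - v').zb = v.zb - v'.zb := rfl
theorem sub_w (v v' : Unknown n R) : (v - v').w = v.w - v'.w := rfl

/-- The weighted filtration on the unknowns. -/
structure Fil (d : ℤ) (v : Unknown n R) : Prop where
  f : ∀ j, v.f j ∈ wfil R wwt (d + 1)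
  g : v.g ∈ wfil R wwt (d + 2)
  zb : ∀ j k, v.zb j k ∈ wfil R wwt d
  w : ∀ k, v.w k ∈ wfil R wwt (d + 1)

theorem Fil.sub {d : ℤ} {v v' : Unknown n R} (h : Fil d v) (h' : Fil d v') : Fil d (v - v') :=
  ⟨fun j => sub_mem (h.f j) (h'.f j), sub_mem h.g h'.g, fun j k => sub_mem (h.zb j k) (h'.zb j k),
    fun k => sub_mem (h.w k) (h'.w k)⟩

end Unknown

section Comp

variable {n : ℕ} {R : Type*} [CommRing R]

theorem NCL.sub {p q : PS n R} (hp : NCL p) (hq : NCL q) : NCL (p - q) := fun α hα => by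
  rw [map_sub, hp α hα, hq α hα, sub_zero]

theorem NCL.comp {p : PS n R} (hp : NCL p) (m : ℤ) : NCL (comp wwt m p) := fun α hα => by
  rw [coeff_comp, hp α hα, ite_self]

theorem comp_cp (m a b : ℤ) (p : PS n R) : comp wwt m (cp a b p) = cp a b (comp wwt m p) :=
  comp_comm _ _ _ _ _

theorem comp_pderiv_u (m : ℤ) (p : PS n R) :
    comp wwt m (pderiv R iu p) = pderiv R iu (comp wwt (m + 2) p) := comp_pderiv _ _ _ _

theorem comp_ee (m : ℤ) (p : PS n R) : comp wwt m (ee p) = ee (comp wwt m p) := by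
  ext α
  simp only [coeff_comp, coeff_ee]
  split_ifs <;> simp

theorem comp_eb (m : ℤ) (p : PS n R) : comp wwt m (eb p) = eb (comp wwt m p) := by
  ext α
  simp only [coeff_comp, coeff_eb]
  split_ifs <;> simp

theorem mem_wfil_of_comp {p : PS n R} {d e : ℤ} (h : ∀ m < d, comp wwt (m + e) p = 0) :
    p ∈ wfil R wwt (d + e) :=
  mem_wfil_iff_comp.2 fun m hm => by
    have := h (m - e) (by omega)
    rwa [sub_add_cancel] at this

end Comp

namespace Frame

variable {n : ℕ} {R : Type*} [CommRing R] [StarRing R] [Algebra ℂ R] (Φ : Frame n R)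

theorem RadNormal.sub {T T' : PS n R} (h : Φ.RadNormal T) (h' : Φ.RadNormal T') :
    Φ.RadNormal (T - T') where
  skew := by rw [map_sub]; linear_combination h.skew - h'.skew
  one_one := by rw [map_sub, map_sub, h.one_one, h'.one_one, sub_zero]
  one a := by rw [map_sub, h.one, h'.one, sub_zero]
  trace_one := by rw [map_sub, map_sub, h.trace_one, h'.trace_one, sub_zero]
  trace_two := by simp only [map_sub, h.trace_two, h'.trace_two, sub_zero]
  trace_three := by simp only [map_sub, h.trace_three, h'.trace_three, sub_zero]

theorem comp_Q_mul (m : ℤ) (p : PS n R) : comp wwt m (Φ.Q * p) = Φ.Q * comp wwt (m - 2) p := by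
  simp only [Q, Finset.sum_mul, map_sum, mul_assoc, comp_C_mul, comp_X_mul, wwt_z, wwt_zb]
  rw [show m - 1 - 1 = m - 2 by ring]

theorem comp_tr (m : ℤ) (p : PS n R) : comp wwt m (Φ.tr p) = Φ.tr (comp wwt (m + 2) p) := by
  simp only [tr_apply, map_sum, comp_C_mul, comp_pderiv, wwt_z, wwt_zb]
  rw [show m + 1 + 1 = m + 2 by ring]

theorem comp_DD (m : ℤ) (p : PS n R) : comp wwt m (Φ.DD p) = Φ.DD (comp wwt m p) := by
  simp only [DD, map_add, comp_ee, mul_assoc, Ic, cst_def, comp_C_mul, comp_Q_mul, comp_pderiv_u,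
    sub_add_cancel]

theorem comp_DDb (m : ℤ) (p : PS n R) : comp wwt m (Φ.DDb p) = Φ.DDb (comp wwt m p) := by
  simp only [DDb, map_sub, comp_eb, mul_assoc, Ic, cst_def, comp_C_mul, comp_Q_mul, comp_pderiv_u,
    sub_add_cancel]

theorem comp_TT (m : ℤ) (f : Fin n → PS n R) (g : PS n R) : comp wwt (m + 1) (Φ.TT f g) =
    Φ.TT (fun k => comp wwt m (f k)) (comp wwt (m + 1) g) := by
  simp only [TT, map_sub, Ic, cst_def, comp_C_mul, comp_wwt_bar, comp_DD, CC_apply,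
    NN_apply, map_sum, comp_X_mul, wwt_z, wwt_zb, add_sub_cancel_right]

theorem RadNormal.comp {T : PS n R} (h : Φ.RadNormal T) (m : ℤ) :
    Φ.RadNormal (comp wwt m T) where
  skew := by rw [← comp_wwt_bar, ← map_add, h.skew, map_zero]
  one_one := by
    rw [← comp_cp, show m = m - 2 + 2 by ring, ← comp_pderiv_u, h.one_one, map_zero]
  one a := by rw [← comp_cp, h.one, map_zero]
  trace_one := by
    rw [← comp_cp, show m = m - 2 + 2 by ring, ← comp_tr, h.trace_one, map_zero]
  trace_two := by
    rw [← comp_cp, show m = m - 4 + 2 + 2 by ring, ← comp_tr, ← comp_tr, h.trace_two, map_zero]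
  trace_three := by
    rw [← comp_cp, show m = m - 6 + 2 + 2 + 2 by ring, ← comp_tr, ← comp_tr, ← comp_tr,
      h.trace_three, map_zero]

/-- The linear form `i ∑ c_{jk} y_j + ½ ∑ N_{jk} x_j`. -/
def ell (k : Fin n) (x y : Fin n → PS n R) : PS n R :=
  Ic * ∑ j, C (Φ.c j k) * y j + cst (1 / 2) * ∑ j, C (Φ.nn j k) * x j

theorem ell_add (k : Fin n) (x x' y y' : Fin n → PS n R) :
    Φ.ell k (fun j => x j + x' j) (fun j => y j + y' j) = Φ.ell k x y + Φ.ell k x' y' := by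
  simp only [ell, mul_add, Finset.sum_add_distrib]; ring

theorem ell_sub (k : Fin n) (x x' y y' : Fin n → PS n R) :
    Φ.ell k (fun j => x j - x' j) (fun j => y j - y' j) = Φ.ell k x y - Φ.ell k x' y' := by
  simp only [ell, mul_sub, Finset.sum_sub_distrib]; ring

theorem ell_mem_wfil (w : Var n → ℤ) (k : Fin n) {d : ℤ} {x y : Fin n → PS n R}
    (hx : ∀ j, x j ∈ wfil R w d) (hy : ∀ j, y j ∈ wfil R w d) : Φ.ell k x y ∈ wfil R w d := by
  have hC : ∀ (r : R) {p : PS n R}, p ∈ wfil R w d → C r * p ∈ wfil R w d := fun r p hp => by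
    rw [← smul_eq_C_mul]; exact Submodule.smul_mem _ _ hp
  exact add_mem (hC _ (sum_mem fun j _ => hC _ (hy j))) (hC _ (sum_mem fun j _ => hC _ (hx j)))

/-- The `w`-components of the model, `ℓ_k(z, z̄)`. -/
def ellz (k : Fin n) : PS n R := Φ.ell k (fun j => X (iz j)) fun j => X (izb j)

theorem ellz_mem_wfil (k : Fin n) : Φ.ellz k ∈ wfil R wwt 1 :=
  Φ.ell_mem_wfil wwt k (fun j => wfil_X (iz j)) fun j => wfil_X (izb j)

/-- The vector fields of the model. -/
def vz (k : Fin n) (p : PS n R) : PS n R := pderiv R (iz k) p + Φ.ellz k * pderiv R iu p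

theorem vz_sub (k : Fin n) (p q : PS n R) : Φ.vz k (p - q) = Φ.vz k p - Φ.vz k q := by
  simp only [vz, map_sub]; ring

theorem vz_mem_wfil (k : Fin n) {d e : ℤ} {p : PS n R} (hp : p ∈ wfil R wwt d) (he : e + 1 ≤ d) :
    Φ.vz k p ∈ wfil R wwt e :=
  add_mem (wfil_pderiv' hp _ (by rw [wwt_z]; omega))
    (wfil_mul' (Φ.ellz_mem_wfil k) (wfil_pderiv hp iu) (by rw [wwt_u]; omega))

theorem sum_mul_ell (x y : Fin n → PS n R) : ∑ k, X (iz k) * Φ.ell k x y =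
    Ic * ∑ j, ∑ k, C (Φ.c j k) * (y j * X (iz k))
      + cst (1 / 2) * ∑ j, ∑ k, C (Φ.nn j k) * (x j * X (iz k)) := by
  simp only [ell, mul_add, Finset.sum_add_distrib, Finset.mul_sum]
  congr 1 <;>
  · rw [Finset.sum_comm]
    exact Finset.sum_congr rfl fun j _ => Finset.sum_congr rfl fun k _ => by ring

theorem sum_nn_eq_neg (x y : Fin n → PS n R) : ∑ j, ∑ k, C (Φ.nn j k) * (x j * y k) =
    -∑ j, ∑ k, C (Φ.nn j k) * (y j * x k) := by
  rw [Finset.sum_comm, ← Finset.sum_neg_distrib]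
  refine Finset.sum_congr rfl fun j _ => ?_
  rw [← Finset.sum_neg_distrib]
  refine Finset.sum_congr rfl fun k _ => ?_
  rw [Φ.nn_anti k j, map_neg]
  ring

theorem sum_mul_ell_eq (x y : Fin n → PS n R) : ∑ k, X (iz k) * Φ.ell k x y =
    Ic * ∑ j, ∑ k, C (Φ.c j k) * (y j * X (iz k)) - cst (1 / 2) * Φ.NN x := by
  rw [sum_mul_ell, sum_nn_eq_neg, NN_apply]; ring

/-- Antisymmetry makes 𝓝(z, z) vanish: only the Levi form is visible in the radial part of the
model. -/
theorem sum_mul_ellz : ∑ k, X (iz k) * Φ.ellz k = Ic * Φ.Q := by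
  have h : Φ.NN (fun k => X (iz k)) = 0 := by
    refine two_mul_cancel ?_
    have := Φ.sum_nn_eq_neg (fun k => X (iz k)) (fun k => X (iz k))
    rw [← NN_apply] at this
    linear_combination this
  simp only [ellz]
  rw [sum_mul_ell_eq, h, Q]; ring

theorem sum_mul_vz (p : PS n R) : ∑ k, X (iz k) * Φ.vz k p = Φ.DD p := by
  simp only [vz, mul_add, Finset.sum_add_distrib, ← mul_assoc]
  rw [← Finset.sum_mul, sum_mul_ellz, DD, ee_apply]

theorem sum_ellz_mul (x : Fin n → PS n R) : ∑ m, Φ.ellz m * x m =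
    Ic * Φ.CC x + cst (1 / 2) * Φ.NN x := by
  simp only [ellz, ell, add_mul, Finset.sum_add_distrib, CC_apply, NN_apply, Finset.mul_sum,
    Finset.sum_mul]
  congr 1 <;>
  · rw [Finset.sum_comm]
    exact Finset.sum_congr rfl fun j _ => Finset.sum_congr rfl fun k _ => by ring

theorem bar_CC (f : Fin n → PS n R) :
    bar (Φ.CC f) = ∑ j, ∑ k, C (Φ.c j k) * (bar (f j) * X (iz k)) := by
  simp only [CC_apply, map_sum, map_mul, bar_C, bar_X_zb, Φ.star_c]
  rw [Finset.sum_comm]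
  exact Finset.sum_congr rfl fun j _ => Finset.sum_congr rfl fun k _ => by ring

/-- The `w`-component of the linearized transformation. -/
def linW (v : Unknown n R) (k : Fin n) : PS n R :=
  v.w k - Φ.vz k v.g + ∑ m, Φ.ellz m * Φ.vz k (v.f m) + Φ.ell k v.f fun j => bar (v.f j)

/-- The `z̄`-component of the linearized transformation. -/
def linZb (v : Unknown n R) (j k : Fin n) : PS n R := v.zb j k - Φ.vz k (bar (v.f j))

theorem linW_sub (v v' : Unknown n R) (k : Fin n) :
    Φ.linW (v - v') k = Φ.linW v k - Φ.linW v' k := by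
  have h : Φ.ell k (v - v').f (fun j => bar ((v - v').f j)) =
      Φ.ell k v.f (fun j => bar (v.f j)) - Φ.ell k v'.f fun j => bar (v'.f j) := by
    rw [← ell_sub]
    simp only [Unknown.sub_f, Pi.sub_apply, map_sub]
    rfl
  simp only [linW, h]
  simp only [Unknown.sub_f, Unknown.sub_g, Unknown.sub_w, Pi.sub_apply, vz_sub, mul_sub,
    Finset.sum_sub_distrib]
  ring

theorem linZb_sub (v v' : Unknown n R) (j k : Fin n) :
    Φ.linZb (v - v') j k = Φ.linZb v j k - Φ.linZb v' j k := by
  simp only [linZb, Unknown.sub_f, Unknown.sub_zb, Pi.sub_apply, map_sub, vz_sub]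
  ring

/-- Contraction with z identifies the radial part of the linearized w-equation: this is the origin
of the operator `TT`. -/
theorem sum_mul_linW (v : Unknown n R) :
    ∑ k, X (iz k) * Φ.linW v k = ∑ k, v.w k * X (iz k) - Φ.TT v.f v.g := by
  have h1 : ∑ k, X (iz k) * ∑ m, Φ.ellz m * Φ.vz k (v.f m) =
      ∑ m, Φ.ellz m * Φ.DD (v.f m) := by
    simp only [Finset.mul_sum]
    rw [Finset.sum_comm]
    refine Finset.sum_congr rfl fun m _ => ?_
    rw [← sum_mul_vz, Finset.mul_sum]
    exact Finset.sum_congr rfl fun k _ => by ring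
  have h2 : ∑ k, X (iz k) * v.w k = ∑ k, v.w k * X (iz k) :=
    Finset.sum_congr rfl fun k _ => mul_comm _ _
  have h3 : Φ.NN (fun k => Φ.DD (v.f k) - v.f k) =
      Φ.NN (fun k => Φ.DD (v.f k)) - Φ.NN v.f := by
    rw [← map_sub]; rfl
  simp only [linW, mul_add, mul_sub, Finset.sum_add_distrib, Finset.sum_sub_distrib]
  rw [h1, h2, sum_mul_vz, sum_ellz_mul, sum_mul_ell_eq, ← bar_CC, TT, h3]
  ring

theorem sum_mul_linZb (v : Unknown n R) (j : Fin n) :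
    ∑ k, X (iz k) * Φ.linZb v j k = ∑ k, v.zb j k * X (iz k) - Φ.DD (bar (v.f j)) := by
  simp only [linZb, mul_sub, Finset.sum_sub_distrib, sum_mul_vz, mul_comm]

/-- The normalization conditions. -/
structure LinNormal (v : Unknown n R) : Prop where
  ncl_f : ∀ j, NCL (v.f j)
  ncl_g : NCL v.g
  real : bar v.g = v.g
  tangential : ∀ j, ∑ k, v.zb j k * X (iz k) = 0
  radial : Φ.RadNormal (∑ k, v.w k * X (iz k))

theorem LinNormal.sub {v v' : Unknown n R} (h : Φ.LinNormal v) (h' : Φ.LinNormal v') :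
    Φ.LinNormal (v - v') where
  ncl_f j := (h.ncl_f j).sub (h'.ncl_f j)
  ncl_g := h.ncl_g.sub h'.ncl_g
  real := by rw [Unknown.sub_g, map_sub, h.real, h'.real]
  tangential j := by
    simp only [Unknown.sub_zb, Pi.sub_apply, sub_mul, Finset.sum_sub_distrib, h.tangential,
      h'.tangential, sub_zero]
  radial := by
    simp only [Unknown.sub_w, Pi.sub_apply, sub_mul, Finset.sum_sub_distrib]
    exact RadNormal.sub Φ h.radial h'.radial

variable [StarModule ℂ R]

/-- Solvability of the linearized problem. -/
theorem exists_linNormal (hn : 1 ≤ n) {Ez : Fin n → Fin n → PS n R} {Ew : Fin n → PS n R}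
    (hEz : ∀ j k, Ez j k ∈ wfil R wwt 1) (hEw : ∀ k, Ew k ∈ wfil R wwt 1) {ρ : R}
    (hρ : star ρ = ρ) : ∃ v : Unknown n R, Φ.LinNormal v ∧
      coeff (Finsupp.single iu 2) v.g = ρ ∧ (∀ j k, Φ.linZb v j k = Ez j k) ∧
      ∀ k, Φ.linW v k = Ew k := by
  obtain ⟨f, g, hf, hg, hgr, hgρ, hD, hT⟩ := Φ.exists_radNormal hn
    (q' := fun j => -∑ k, X (iz k) * Ez j k) (q := ∑ k, X (iz k) * Ew k)
    (fun j b => by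
      rw [map_neg, map_sum]
      simp [cp_z_mul, cp_of_neg_left])
    (fun b => by
      rw [map_sum]
      simp [cp_z_mul, cp_of_neg_left])
    (fun j => neg_mem (sum_mem fun k _ => wfil_X_mul _ (hEz j k) (by rw [wwt_z]; norm_num)))
    (sum_mem fun k _ => wfil_X_mul _ (hEw k) (by rw [wwt_z]; norm_num)) hρ
  -- Once (f, g) solves the radial problem, zb and w are read off from the full equations; their
  -- radial parts are then normalized automatically.
  let v : Unknown n R := ⟨f, g, fun j k => Ez j k + Φ.vz k (bar (f j)),
    fun k => Ew k + Φ.vz k g - ∑ m, Φ.ellz m * Φ.vz k (f m) - Φ.ell k f fun j => bar (f j)⟩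
  have hz : ∀ j k, Φ.linZb v j k = Ez j k := fun j k => by simp only [linZb, v]; ring
  have hw : ∀ k, Φ.linW v k = Ew k := fun k => by simp only [linW, v]; ring
  refine ⟨v, ⟨hf, hg, hgr, fun j => ?_, ?_⟩, hgρ, hz, hw⟩
  · have h1 := Φ.sum_mul_linZb v j
    have h2 := congrArg bar (hD j)
    simp only [hz] at h1
    rw [bar_DDb, bar_bar] at h2
    change _ = _ - Φ.DD (bar (f j)) at h1
    linear_combination -h1 + h2
  · have h1 := Φ.sum_mul_linW v
    simp only [hw] at h1
    have h2 : ∑ k, v.w k * X (iz k) = ∑ k, X (iz k) * Ew k + Φ.TT f g := by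
      change _ = _ - Φ.TT f g at h1
      linear_combination -h1
    rw [h2]; exact hT

/-- The linearized problem is graded injective. -/
theorem LinNormal.fil (hn : 1 ≤ n) {v : Unknown n R} (hv : Φ.LinNormal v) {d : ℤ}
    (hd : 2 < d → coeff (Finsupp.single iu 2) v.g = 0)
    (hz : ∀ j k, Φ.linZb v j k ∈ wfil R wwt d) (hw : ∀ k, Φ.linW v k ∈ wfil R wwt (d + 1)) :
    v.Fil d := by
  have hDf : ∀ j, Φ.DDb (v.f j) ∈ wfil R wwt (d + 1) := fun j => by
    have h1 := Φ.sum_mul_linZb v j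
    rw [hv.tangential, zero_sub] at h1
    rw [← bar_bar (v.f j), ← bar_DD]
    refine bar_mem_wfil ?_
    rw [← neg_mem_iff, ← h1]
    exact sum_mem fun k _ => wfil_X_mul _ (hz j k) (by rw [wwt_z]; omega)
  have hTd : ∑ k, v.w k * X (iz k) - Φ.TT v.f v.g ∈ wfil R wwt (d + 2) := by
    rw [← sum_mul_linW]
    exact sum_mem fun k _ => wfil_X_mul _ (hw k) (by rw [wwt_z]; omega)
  -- Below the order of the right-hand sides, each pair of components of weights m+1 of f and m+2 of
  -- g solves the homogeneous radial problem, hence vanishes.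
  have key : ∀ m < d, (fun k => comp wwt (m + 1) (v.f k)) = 0 ∧ comp wwt (m + 2) v.g = 0 := by
    intro m hm
    refine Φ.eq_zero_of_radNormal hn (fun k => (hv.ncl_f k).comp _) (hv.ncl_g.comp _)
      (by rw [← comp_wwt_bar, hv.real]) ?_ (fun k => ?_) ?_
    · rw [coeff_comp]
      -- The monomial u² has weight 4, so the prescribed coefficient intervenes only for m = 2,
      -- which is below d only if d > 2.
      split_ifs with h
      · refine hd ?_
        rw [Finsupp.weight_single, wwt_u] at h
        norm_num at h
        omega
      · rfl
    · rw [← comp_DDb]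
      exact mem_wfil_iff_comp.1 (hDf k) _ (by omega)
    · have h := mem_wfil_iff_comp.1 hTd (m + 2) (by omega)
      rw [map_sub, sub_eq_zero] at h
      have h2 := RadNormal.comp Φ hv.radial (m + 2)
      rw [h, show m + 2 = m + 1 + 1 by ring, comp_TT] at h2
      rwa [show m + 2 = m + 1 + 1 by ring]
  have hf : ∀ j, v.f j ∈ wfil R wwt (d + 1) := fun j =>
    mem_wfil_of_comp fun m hm => congrFun (key m hm).1 j
  have hg : v.g ∈ wfil R wwt (d + 2) := mem_wfil_of_comp fun m hm => (key m hm).2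
  -- The orders of zb and w follow from those of f and g through the linear equations.
  refine ⟨hf, hg, fun j k => ?_, fun k => ?_⟩
  · have h : v.zb j k = Φ.linZb v j k + Φ.vz k (bar (v.f j)) := by simp only [linZb]; ring
    rw [h]
    exact add_mem (hz j k) (Φ.vz_mem_wfil k (bar_mem_wfil (hf j)) le_rfl)
  · have h : v.w k = Φ.linW v k + Φ.vz k v.g - ∑ m, Φ.ellz m * Φ.vz k (v.f m)
        - Φ.ell k v.f fun j => bar (v.f j) := by simp only [linW]; ring
    rw [h]
    refine sub_mem (sub_mem (add_mem (hw k) (Φ.vz_mem_wfil k hg (by omega)))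
      (sum_mem fun m _ => ?_)) (Φ.ell_mem_wfil _ k hf fun j => bar_mem_wfil (hf j))
    exact wfil_mul' (Φ.ellz_mem_wfil m) (Φ.vz_mem_wfil k (hf m) le_rfl) (by omega)

end Frame

end FormalCR

/-! ### The nonlinear equation and the weight gained by its nonlinear terms -/

namespace FormalCR

open MvPowerSeries

/-- A formal power series map `ℂⁿ_z → ℂⁿ_z̄ × ℂ_w` with coefficients in `R`. -/
@[ext]
structure CRMap (n : ℕ) (R : Type*) where
  zb : Fin n → Fin n → PS n R
  w : Fin n → PS n R

section

variable {n : ℕ} {R : Type*} [CommRing R]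

/-- The vector fields spanning the graph of `L`. -/
def CRMap.vf (L : CRMap n R) (k : Fin n) (p : PS n R) : PS n R :=
  pderiv R (iz k) p + (∑ j, L.zb j k * pderiv R (izb j) p) + L.w k * pderiv R iu p

namespace CRMap

variable (L : CRMap n R)

theorem vf_add (k : Fin n) (p q : PS n R) : L.vf k (p + q) = L.vf k p + L.vf k q := by
  simp only [vf, map_add, mul_add, Finset.sum_add_distrib]; ring

theorem vf_sub (k : Fin n) (p q : PS n R) : L.vf k (p - q) = L.vf k p - L.vf k q := by
  simp only [vf, map_sub, mul_sub, Finset.sum_sub_distrib]; ring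

theorem vf_X_z (k m : Fin n) : L.vf k (X (iz m)) = if m = k then 1 else 0 := by
  classical
  simp [vf, pderiv_X, Pi.single_apply, eq_comm]

theorem vf_X_zb (k j : Fin n) : L.vf k (X (izb j)) = L.zb j k := by
  classical
  simp [vf, pderiv_X, Pi.single_apply]

theorem vf_X_u (k : Fin n) : L.vf k (X iu) = L.w k := by
  simp [vf]

end CRMap

theorem hasSubst_of_mem_wfil {w v : Var n → ℤ} {h : Var n → PS n R}
    (hh : ∀ i, h i ∈ wfil R v (w i)) (hw : ∀ i, 1 ≤ w i) : HasSubst h :=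
  hasSubst_of_constantCoeff_zero fun i => by
    rw [← coeff_zero_eq_constantCoeff_apply]
    exact hh i 0 (by rw [map_zero]; linarith [hw i])

theorem hasSubst_X : HasSubst (X : Var n → PS n R) :=
  hasSubst_of_mem_wfil (v := wwt) (fun i => wfil_X i) one_le_wwt

theorem subst_X_self (p : PS n R) : subst (X : Var n → PS n R) p = p :=
  congrFun subst_self p

theorem subst_sub_of {h : Var n → PS n R} (hs : HasSubst h) (p q : PS n R) :
    subst h (p - q) = subst h p - subst h q := by
  rw [← coe_substAlgHom hs, map_sub]

theorem sum_mul_ite_add (F G : Fin n → PS n R) (k : Fin n) :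
    ∑ m, F m * ((if m = k then 1 else 0) + G m) = F k + ∑ m, F m * G m := by
  simp [mul_add, Finset.sum_add_distrib]

variable [StarRing R]

/-- The images of the coordinates under `id + (f, g)`. -/
def chg (f : Fin n → PS n R) (g : PS n R) : Var n → PS n R
  | Sum.inl j => X (iz j) + f j
  | Sum.inr (Sum.inl j) => X (izb j) + bar (f j)
  | Sum.inr (Sum.inr _) => X iu + g

theorem chg_z (f : Fin n → PS n R) (g : PS n R) (j : Fin n) :
    chg f g (iz j) = X (iz j) + f j := rfl
theorem chg_zb (f : Fin n → PS n R) (g : PS n R) (j : Fin n) :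
    chg f g (izb j) = X (izb j) + bar (f j) := rfl
theorem chg_u (f : Fin n → PS n R) (g : PS n R) : chg f g iu = X iu + g := rfl

/-- The map `id + (f, g)` transforms `L` into `L'`. -/
def CRMap.Transf (L : CRMap n R) (f : Fin n → PS n R) (g : PS n R) (L' : CRMap n R) : Prop :=
  (∀ k, L.vf k (chg f g iu) = ∑ m, subst (chg f g) (L'.w m) * L.vf k (chg f g (iz m))) ∧
  ∀ j k, L.vf k (chg f g (izb j)) =
    ∑ m, subst (chg f g) (L'.zb j m) * L.vf k (chg f g (iz m))

namespace Unknown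

variable {v v' : Unknown n R}

theorem Fil.chg_sub_X {d : ℤ} (h : v.Fil d) (i : Var n) :
    chg v.f v.g i - X i ∈ wfil R wwt (wwt i + d) := by
  rcases i with j | j | j
  · rw [chg_z, add_sub_cancel_left, wwt_z, add_comm]; exact h.f j
  · rw [chg_zb, add_sub_cancel_left, wwt_zb, add_comm]; exact bar_mem_wfil (h.f j)
  · change X iu + v.g - X iu ∈ _
    rw [add_sub_cancel_left, wwt_u, add_comm]; exact h.g

theorem Fil.chg_sub_chg {d : ℤ} (h : (v - v').Fil d) (i : Var n) :
    chg v.f v.g i - chg v'.f v'.g i ∈ wfil R wwt (wwt i + d) := by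
  rcases i with j | j | j
  · rw [chg_z, chg_z, add_sub_add_left_eq_sub, wwt_z, add_comm]; exact h.f j
  · rw [chg_zb, chg_zb, add_sub_add_left_eq_sub, wwt_zb, add_comm, ← map_sub]
    exact bar_mem_wfil (h.f j)
  · change X iu + v.g - (X iu + v'.g) ∈ _
    rw [add_sub_add_left_eq_sub, wwt_u, add_comm]; exact h.g

theorem Fil.chg_mem (h : v.Fil 1) (i : Var n) : chg v.f v.g i ∈ wfil R wwt (wwt i) := by
  have := add_mem (wfil_anti (by omega) (h.chg_sub_X i)) (wfil_X (R := R) (w := wwt) i)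
  rwa [sub_add_cancel] at this

theorem Fil.hasSubst (h : v.Fil 1) : HasSubst (chg v.f v.g) :=
  hasSubst_of_mem_wfil h.chg_mem one_le_wwt

theorem Fil.subst_mem (h : v.Fil 1) {a : ℤ} {p : PS n R} (hp : p ∈ wfil R wwt a) :
    subst (chg v.f v.g) p ∈ wfil R wwt a :=
  subst_mem_wfil h.hasSubst h.chg_mem wwt_nonneg hp

theorem Fil.subst_sub_self (h : v.Fil 1) {a : ℤ} {p : PS n R} (hp : p ∈ wfil R wwt a) :
    subst (chg v.f v.g) p - p ∈ wfil R wwt (a + 1) := by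
  have := subst_sub_mem_wfil h.hasSubst hasSubst_X h.chg_mem (fun i => wfil_X i)
    (fun i => h.chg_sub_X i) wwt_nonneg hp
  rwa [subst_X_self] at this

theorem Fil.subst_sub_subst (h : v.Fil 1) (h' : v'.Fil 1) {d : ℤ} (hd : (v - v').Fil d)
    {a : ℤ} {p : PS n R} (hp : p ∈ wfil R wwt a) :
    subst (chg v.f v.g) p - subst (chg v'.f v'.g) p ∈ wfil R wwt (a + d) :=
  subst_sub_mem_wfil h.hasSubst h'.hasSubst h.chg_mem h'.chg_mem
    (fun i => hd.chg_sub_chg i) wwt_nonneg hp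

/-- Difference of two substitutions into different series. -/
theorem Fil.subst_sub_subst' (h : v.Fil 1) (h' : v'.Fil 1) {d : ℤ} (hd : (v - v').Fil d)
    {a b : ℤ} {p q : PS n R} (hq : q ∈ wfil R wwt a) (hpq : p - q ∈ wfil R wwt b)
    (hb : b ≤ a + d) :
    subst (chg v.f v.g) p - subst (chg v'.f v'.g) q ∈ wfil R wwt b := by
  have h1 := add_mem (h.subst_mem hpq) (wfil_anti hb (h.subst_sub_subst h' hd hq))
  rwa [subst_sub_of h.hasSubst, sub_add_sub_cancel] at h1

/-- The map p ↦ p∘h − p gains one weight in p, and it depends on h with the gain d of the difference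
of the two maps; the two contributions are estimated separately. -/
theorem Fil.subst_sub_self_sub (h : v.Fil 1) (h' : v'.Fil 1) {d : ℤ} (hd : (v - v').Fil d)
    {a b : ℤ} {p q : PS n R} (hq : q ∈ wfil R wwt a) (hpq : p - q ∈ wfil R wwt b)
    (hb : b + 1 ≤ a + d) :
    (subst (chg v.f v.g) p - p) - (subst (chg v'.f v'.g) q - q) ∈ wfil R wwt (b + 1) := by
  have h1 := add_mem (h.subst_sub_self hpq) (wfil_anti hb (h.subst_sub_subst h' hd hq))
  rw [subst_sub_of h.hasSubst] at h1
  convert h1 using 1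
  ring

end Unknown

end

namespace Frame

variable {n : ℕ} {R : Type*} [CommRing R] [StarRing R] [Algebra ℂ R] (Φ : Frame n R)
  (L : CRMap n R)

theorem subst_ellz {f : Fin n → PS n R} {g : PS n R} (hs : HasSubst (chg f g)) (k : Fin n) :
    subst (chg f g) (Φ.ellz k) = Φ.ellz k + Φ.ell k f fun j => bar (f j) := by
  rw [ellz, ← ell_add, ell, ell, Ic, cst_def, cst_def]
  simp only [← coe_substAlgHom hs, map_add, map_mul, map_sum]
  simp only [coe_substAlgHom hs, subst_C_eq hs, subst_X hs]
  rfl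

/-- The perturbation of the model by the components `zb`, `w` of an unknown. -/
def perturb (v : Unknown n R) : CRMap n R := ⟨v.zb, fun k => Φ.ellz k + v.w k⟩

/-- The nonlinear terms of the `w`-component of the equation. -/
def nonlinW (v : Unknown n R) (k : Fin n) : PS n R :=
  (L.w k - Φ.ellz k) + (L.vf k v.g - Φ.vz k v.g) - (subst (chg v.f v.g) (v.w k) - v.w k)
    - ∑ m, Φ.ellz m * (L.vf k (v.f m) - Φ.vz k (v.f m))
    - ∑ m, (Φ.ell m v.f (fun j => bar (v.f j)) + subst (chg v.f v.g) (v.w m)) * L.vf k (v.f m)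

/-- The nonlinear terms of the `z̄`-component of the equation. -/
def nonlinZb (v : Unknown n R) (j k : Fin n) : PS n R :=
  L.zb j k + (L.vf k (bar (v.f j)) - Φ.vz k (bar (v.f j)))
    - (subst (chg v.f v.g) (v.zb j k) - v.zb j k)
    - ∑ m, subst (chg v.f v.g) (v.zb j m) * L.vf k (v.f m)

/-- Pure rearrangement: the model is linear in z, z̄, so substituting in it is explicit and splits
into its own value plus a term linear in f and its conjugate. All other deviations from the
linearization go to the nonlinear side. -/
theorem transf_perturb_iff {v : Unknown n R} (hs : HasSubst (chg v.f v.g)) :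
    L.Transf v.f v.g (Φ.perturb v) ↔ (∀ j k, Φ.linZb v j k = Φ.nonlinZb L v j k) ∧
      ∀ k, Φ.linW v k = Φ.nonlinW L v k := by
  rw [CRMap.Transf, and_comm]
  refine and_congr (forall_congr' fun j => forall_congr' fun k => ?_) (forall_congr' fun k => ?_)
  · simp only [chg_z, chg_zb, CRMap.vf_add, CRMap.vf_X_z, CRMap.vf_X_zb, perturb, linZb, nonlinZb]
    rw [sum_mul_ite_add]
    constructor <;> intro h <;> linear_combination -h
  · simp only [chg_z, chg_u, CRMap.vf_add, CRMap.vf_X_z, CRMap.vf_X_u, perturb, linW, nonlinW]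
    rw [sum_mul_ite_add, subst_add hs, subst_ellz Φ hs]
    simp only [subst_add hs, subst_ellz Φ hs]
    simp only [add_mul, mul_sub, Finset.sum_add_distrib, Finset.sum_sub_distrib]
    constructor <;> intro h <;> linear_combination -h

variable {L}

section Estimates

variable (hz : ∀ j k, L.zb j k ∈ wfil R wwt 1) (hw : ∀ k, L.w k - Φ.ellz k ∈ wfil R wwt 2)

include hz hw

/-- The fields of the model lower the weight by one. The coefficients of the difference have one
more weight, so the difference does not lower it. -/
theorem vf_sub_vz_mem (k : Fin n) {d : ℤ} {p : PS n R} (hp : p ∈ wfil R wwt d) :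
    L.vf k p - Φ.vz k p ∈ wfil R wwt d := by
  have h : L.vf k p - Φ.vz k p =
      (∑ j, L.zb j k * pderiv R (izb j) p) + (L.w k - Φ.ellz k) * pderiv R iu p := by
    simp only [CRMap.vf, vz]; ring
  rw [h]
  exact add_mem (sum_mem fun j _ => wfil_mul' (hz j k) (wfil_pderiv hp _) (by rw [wwt_zb]; omega))
    (wfil_mul' (hw k) (wfil_pderiv hp _) (by rw [wwt_u]; omega))

theorem vf_mem (k : Fin n) {d e : ℤ} {p : PS n R} (hp : p ∈ wfil R wwt d) (he : e + 1 ≤ d) :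
    L.vf k p ∈ wfil R wwt e := by
  have := add_mem (wfil_anti (by omega) (Φ.vf_sub_vz_mem hz hw k hp)) (Φ.vz_mem_wfil k hp he)
  rwa [sub_add_cancel] at this

variable {v v' : Unknown n R} {d : ℤ} (h : v.Fil 1) (h' : v'.Fil 1) (hd : (v - v').Fil d)

theorem vf_sub_vz_sub_mem (k : Fin n) {p q : PS n R} (hp : p - q ∈ wfil R wwt d) :
    (L.vf k p - Φ.vz k p) - (L.vf k q - Φ.vz k q) ∈ wfil R wwt d := by
  have := Φ.vf_sub_vz_mem hz hw k hp
  rw [CRMap.vf_sub, vz_sub] at this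
  convert this using 1
  ring

include h h' hd

/-- Every varying term carries a small factor: the difference between L and the model, the
difference between h and the identity, or a second factor in a product of unknowns. Each of these
gains one weight. -/
theorem nonlinZb_sub_mem (j k : Fin n) :
    Φ.nonlinZb L v j k - Φ.nonlinZb L v' j k ∈ wfil R wwt (d + 1) := by
  have e : Φ.nonlinZb L v j k - Φ.nonlinZb L v' j k =
      ((L.vf k (bar (v.f j)) - Φ.vz k (bar (v.f j)))
        - (L.vf k (bar (v'.f j)) - Φ.vz k (bar (v'.f j))))
      - ((subst (chg v.f v.g) (v.zb j k) - v.zb j k)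
        - (subst (chg v'.f v'.g) (v'.zb j k) - v'.zb j k))
      - ∑ m, ((subst (chg v.f v.g) (v.zb j m) - subst (chg v'.f v'.g) (v'.zb j m))
          * L.vf k (v.f m)
        + subst (chg v'.f v'.g) (v'.zb j m) * L.vf k (v.f m - v'.f m)) := by
    simp only [nonlinZb, CRMap.vf_sub, sub_mul, mul_sub, Finset.sum_add_distrib,
      Finset.sum_sub_distrib]
    ring
  rw [e]
  refine sub_mem (sub_mem ?_ ?_) (sum_mem fun m _ => add_mem ?_ ?_)
  · refine Φ.vf_sub_vz_sub_mem hz hw k ?_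
    rw [← map_sub]
    exact bar_mem_wfil (hd.f j)
  · exact h.subst_sub_self_sub h' hd (h'.zb j k) (hd.zb j k) (by omega)
  · exact wfil_mul' (h.subst_sub_subst' h' hd (h'.zb j m) (hd.zb j m) (by omega))
      (Φ.vf_mem hz hw k (h.f m) (le_refl (1 + 1))) (by omega)
  · exact wfil_mul' (h'.subst_mem (h'.zb j m)) (Φ.vf_mem hz hw k (hd.f m) le_rfl) (by omega)

/-- As for the z̄-component; the bound is one higher because w carries one more weight than zb. -/
theorem nonlinW_sub_mem (k : Fin n) :
    Φ.nonlinW L v k - Φ.nonlinW L v' k ∈ wfil R wwt (d + 1 + 1) := by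
  have e : Φ.nonlinW L v k - Φ.nonlinW L v' k =
      ((L.vf k v.g - Φ.vz k v.g) - (L.vf k v'.g - Φ.vz k v'.g))
      - ((subst (chg v.f v.g) (v.w k) - v.w k) - (subst (chg v'.f v'.g) (v'.w k) - v'.w k))
      - ∑ m, Φ.ellz m * ((L.vf k (v.f m) - Φ.vz k (v.f m)) -
          (L.vf k (v'.f m) - Φ.vz k (v'.f m)))
      - ∑ m, (((Φ.ell m v.f (fun j => bar (v.f j)) - Φ.ell m v'.f fun j => bar (v'.f j))
            + (subst (chg v.f v.g) (v.w m) - subst (chg v'.f v'.g) (v'.w m))) * L.vf k (v.f m)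
        + (Φ.ell m v'.f (fun j => bar (v'.f j)) + subst (chg v'.f v'.g) (v'.w m))
          * L.vf k (v.f m - v'.f m)) := by
    simp only [nonlinW, CRMap.vf_sub, sub_mul, mul_sub, add_mul, Finset.sum_add_distrib,
      Finset.sum_sub_distrib]
    ring
  rw [e]
  refine sub_mem (sub_mem (sub_mem ?_ ?_) (sum_mem fun m _ => ?_))
    (sum_mem fun m _ => add_mem ?_ ?_)
  · exact wfil_anti (by omega) (Φ.vf_sub_vz_sub_mem hz hw k hd.g)
  · exact h.subst_sub_self_sub h' hd (h'.w k) (hd.w k) (by omega)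
  · exact wfil_mul' (Φ.ellz_mem_wfil m) (Φ.vf_sub_vz_sub_mem hz hw k (hd.f m)) (by omega)
  · refine wfil_mul' (add_mem ?_ ?_) (Φ.vf_mem hz hw k (h.f m) (le_refl (1 + 1))) le_rfl
    · rw [← ell_sub]
      refine Φ.ell_mem_wfil _ m (fun j => hd.f j) fun j => ?_
      rw [← map_sub]
      exact bar_mem_wfil (hd.f j)
    · exact h.subst_sub_subst' h' hd (h'.w m) (hd.w m) (by omega)
  · exact wfil_mul' (add_mem (Φ.ell_mem_wfil _ m h'.f fun j => bar_mem_wfil (h'.f j))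
      (h'.subst_mem (h'.w m))) (Φ.vf_mem hz hw k (hd.f m) le_rfl) (by omega)

end Estimates

end Frame

end FormalCR

/-! ### The fixed point: existence and uniqueness for perturbations of the model -/

namespace FormalCR

open MvPowerSeries

namespace Unknown

variable {n : ℕ} {R : Type*} [CommRing R]

instance : Zero (Unknown n R) := ⟨⟨0, 0, 0, 0⟩⟩

theorem fil_zero (d : ℤ) : (0 : Unknown n R).Fil d :=
  ⟨fun _ => zero_mem _, zero_mem _, fun _ _ => zero_mem _, fun _ => zero_mem _⟩

theorem Fil.sub_zero {d : ℤ} {v : Unknown n R} (h : v.Fil d) : (v - 0).Fil d :=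
  h.sub (fil_zero d)

theorem Fil.anti {d e : ℤ} (hde : d ≤ e) {v : Unknown n R} (h : v.Fil e) : v.Fil d :=
  ⟨fun j => wfil_anti (by omega) (h.f j), wfil_anti (by omega) h.g,
    fun j k => wfil_anti hde (h.zb j k), fun k => wfil_anti (by omega) (h.w k)⟩

theorem Fil.add_sub {d : ℤ} {v v' : Unknown n R} (h : (v - v').Fil d) (h' : v'.Fil d) :
    v.Fil d :=
  ⟨fun j => by simpa [sub_f] using add_mem (h.f j) (h'.f j),
    by simpa [sub_g] using add_mem h.g h'.g,
    fun j k => by simpa [sub_zb] using add_mem (h.zb j k) (h'.zb j k),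
    fun k => by simpa [sub_w] using add_mem (h.w k) (h'.w k)⟩

theorem Fil.sub_sub {d : ℤ} {v v' v'' : Unknown n R} (h : (v - v'').Fil d)
    (h' : (v' - v'').Fil d) : (v - v').Fil d :=
  ⟨fun j => by simpa [sub_f] using sub_mem (h.f j) (h'.f j),
    by simpa [sub_g] using sub_mem h.g h'.g,
    fun j k => by simpa [sub_zb] using sub_mem (h.zb j k) (h'.zb j k),
    fun k => by simpa [sub_w] using sub_mem (h.w k) (h'.w k)⟩

theorem eq_of_fil {v v' : Unknown n R} (h : ∀ k : ℕ, (v - v').Fil k) : v = v' := by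
  have key : ∀ {p q : PS n R} (s : ℤ), 0 ≤ s →
      (∀ k : ℕ, p - q ∈ wfil R wwt (k + s)) → p = q := fun s hs hpq =>
    sub_eq_zero.1 (eq_zero_of_mem_wfil (w := wwt) fun k => wfil_anti (by omega) (hpq k))
  exact Unknown.ext (funext fun j => key 1 (by norm_num) fun k => (h k).f j)
    (key 2 (by norm_num) fun k => (h k).g)
    (funext fun j => funext fun m => key 0 le_rfl fun k => wfil_anti (by omega) ((h k).zb j m))
    (funext fun m => key 1 (by norm_num) fun k => (h k).w m)

theorem exists_limit {V : ℕ → Unknown n R} (h : ∀ k : ℕ, (V (k + 1) - V k).Fil (k + 1)) :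
    ∃ v, ∀ k : ℕ, (v - V k).Fil (k + 1) := by
  have hf : ∀ j, ∃ p, ∀ k : ℕ, p - (V k).f j ∈ wfil R wwt (k + 2) := fun j =>
    FormalCR.exists_limit _ 2 fun k => wfil_anti (by omega) ((h k).f j)
  obtain ⟨g, hg⟩ := FormalCR.exists_limit (R := R) (w := wwt) (fun k => (V k).g) 3 fun k => by
    have := (h k).g
    rwa [add_assoc, show (1 : ℤ) + 2 = 3 by norm_num] at this
  have hz : ∀ j m, ∃ p, ∀ k : ℕ, p - (V k).zb j m ∈ wfil R wwt (k + 1) := fun j m =>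
    FormalCR.exists_limit _ 1 fun k => (h k).zb j m
  have hw : ∀ m, ∃ p, ∀ k : ℕ, p - (V k).w m ∈ wfil R wwt (k + 2) := fun m =>
    FormalCR.exists_limit _ 2 fun k => wfil_anti (by omega) ((h k).w m)
  choose f hf using hf
  choose z hz using hz
  choose w hw using hw
  refine ⟨⟨f, g, z, w⟩, fun k => ⟨fun j => ?_, ?_, fun j m => hz j m k, fun m => ?_⟩⟩
  · have := hf j k
    rwa [show (k : ℤ) + 2 = k + 1 + 1 by ring] at this
  · have := hg k
    rwa [show (k : ℤ) + 3 = k + 1 + 2 by ring] at this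
  · have := hw m k
    rwa [show (k : ℤ) + 2 = k + 1 + 1 by ring] at this

end Unknown

namespace Frame

variable {n : ℕ} {R : Type*} [CommRing R] [StarRing R] [Algebra ℂ R]
  (Φ : Frame n R) {L : CRMap n R} (hz : ∀ j k, L.zb j k ∈ wfil R wwt 1)
  (hw : ∀ k, L.w k - Φ.ellz k ∈ wfil R wwt 2)

include hz hw

/-- Comparison with the zero unknown, where the nonlinear terms reduce to the deviation of L from
the model. -/
theorem nonlin_mem {v : Unknown n R} (h : v.Fil 1) :
    (∀ j k, Φ.nonlinZb L v j k ∈ wfil R wwt 1) ∧ ∀ k, Φ.nonlinW L v k ∈ wfil R wwt 2 := by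
  have h0 := Unknown.fil_zero (n := n) (R := R) 1
  have hs : HasSubst (chg (0 : Unknown n R).f (0 : Unknown n R).g) := h0.hasSubst
  have hv0 : ∀ k, L.vf k (0 : PS n R) = 0 := fun k => by simp [CRMap.vf]
  have hv1 : ∀ k, Φ.vz k (0 : PS n R) = 0 := fun k => by simp [vz]
  have e1 : ∀ j k, Φ.nonlinZb L 0 j k = L.zb j k := fun j k => by
    simp only [nonlinZb]
    change L.zb j k + (L.vf k (bar (0 : PS n R)) - Φ.vz k (bar (0 : PS n R)))
      - (subst _ (0 : PS n R) - 0) - ∑ m, subst _ (0 : PS n R) * L.vf k (0 : PS n R) = _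
    simp [hv0, hv1, subst_zero hs]
  have e2 : ∀ k, Φ.nonlinW L 0 k = L.w k - Φ.ellz k := fun k => by
    simp only [nonlinW]
    change L.w k - Φ.ellz k + (L.vf k (0 : PS n R) - Φ.vz k (0 : PS n R))
      - (subst _ (0 : PS n R) - 0) - ∑ m, Φ.ellz m * (L.vf k (0 : PS n R) - Φ.vz k (0 : PS n R))
      - ∑ m, _ * L.vf k (0 : PS n R) = _
    simp [hv0, hv1, subst_zero hs]
  constructor
  · intro j k
    have := add_mem (wfil_anti (by norm_num) (Φ.nonlinZb_sub_mem hz hw h h0 h.sub_zero j k))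
      (hz j k)
    rwa [e1, sub_add_cancel] at this
  · intro k
    have := add_mem (wfil_anti (by norm_num) (Φ.nonlinW_sub_mem hz hw h h0 h.sub_zero k)) (hw k)
    rwa [e2, sub_add_cancel] at this

variable [StarModule ℂ R] (hn : 1 ≤ n)

include hn

theorem exists_step {ρ : R} (hρ : star ρ = ρ) {v : Unknown n R} (h : v.Fil 1) :
    ∃ v' : Unknown n R, Φ.LinNormal v' ∧ coeff (Finsupp.single iu 2) v'.g = ρ ∧
      (∀ j k, Φ.linZb v' j k = Φ.nonlinZb L v j k) ∧
      (∀ k, Φ.linW v' k = Φ.nonlinW L v k) ∧ v'.Fil 1 := by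
  obtain ⟨h1, h2⟩ := Φ.nonlin_mem hz hw h
  obtain ⟨v', hv, hg, e1, e2⟩ :=
    Φ.exists_linNormal hn h1 (fun k => wfil_anti (by norm_num) (h2 k)) hρ
  exact ⟨v', hv, hg, e1, e2, LinNormal.fil Φ hn hv (fun h => by norm_num at h)
    (fun j k => by rw [e1]; exact h1 j k) fun k => by rw [e2]; exact h2 k⟩

/-- The contraction property: nonlinear terms gain one weight, and `LinNormal.fil` loses none when
inverting the linear side. The equal u² coefficients eliminate the only free constant of the linear
problem. -/
theorem fil_succ {v v' w w' : Unknown n R} (h : v.Fil 1) (h' : v'.Fil 1)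
    (hw1 : Φ.LinNormal w) (hw2 : Φ.LinNormal w')
    (hg : coeff (Finsupp.single iu 2) w.g = coeff (Finsupp.single iu 2) w'.g)
    (e1 : ∀ j k, Φ.linZb w j k = Φ.nonlinZb L v j k) (e2 : ∀ k, Φ.linW w k = Φ.nonlinW L v k)
    (e1' : ∀ j k, Φ.linZb w' j k = Φ.nonlinZb L v' j k)
    (e2' : ∀ k, Φ.linW w' k = Φ.nonlinW L v' k) {d : ℤ} (hd : (v - v').Fil d) :
    (w - w').Fil (d + 1) := by
  refine LinNormal.fil Φ hn (hw1.sub Φ hw2) (fun _ => ?_) (fun j k => ?_) fun k => ?_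
  · rw [Unknown.sub_g, map_sub, hg, sub_self]
  · rw [linZb_sub, e1, e1']
    exact Φ.nonlinZb_sub_mem hz hw h h' hd j k
  · rw [linW_sub, e2, e2']
    exact Φ.nonlinW_sub_mem hz hw h h' hd k

/-- Existence of the normalization of a perturbation of the model. -/
theorem exists_perturb {ρ : R} (hρ : star ρ = ρ) : ∃ v : Unknown n R, Φ.LinNormal v ∧
    coeff (Finsupp.single iu 2) v.g = ρ ∧ v.Fil 1 ∧ L.Transf v.f v.g (Φ.perturb v) := by
  have key : ∀ v : {v : Unknown n R // v.Fil 1}, ∃ v' : {v : Unknown n R // v.Fil 1},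
      Φ.LinNormal v'.1 ∧ coeff (Finsupp.single iu 2) v'.1.g = ρ ∧
      (∀ j k, Φ.linZb v'.1 j k = Φ.nonlinZb L v.1 j k) ∧
      (∀ k, Φ.linW v'.1 k = Φ.nonlinW L v.1 k) := fun v => by
    obtain ⟨v', a, b, c, d, e⟩ := Φ.exists_step hz hw hn hρ v.2
    exact ⟨⟨v', e⟩, a, b, c, d⟩
  choose S hS1 hS2 hS3 hS4 using key
  -- The iteration starts with the image of 0. Consecutive terms then differ in `Fil` (k+1), the
  -- base case holding because all iterates lie in `Fil` 1.
  let V : ℕ → {v : Unknown n R // v.Fil 1} := fun k =>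
    Nat.rec (S ⟨0, Unknown.fil_zero 1⟩) (fun _ v => S v) k
  have hstep : ∀ (v v' : {v : Unknown n R // v.Fil 1}) (d : ℤ), (v.1 - v'.1).Fil d →
      ((S v).1 - (S v').1).Fil (d + 1) := fun v v' d h =>
    Φ.fil_succ hz hw hn v.2 v'.2 (hS1 v) (hS1 v') (by rw [hS2, hS2]) (hS3 v) (hS4 v) (hS3 v')
      (hS4 v') h
  have hV : ∀ k : ℕ, ((V (k + 1)).1 - (V k).1).Fil (k + 1) := by
    intro k
    induction k with
    | zero => simpa using (V 1).2.sub (V 0).2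
    | succ k ih => exact_mod_cast hstep (V (k + 1)) (V k) _ ih
  obtain ⟨v, hv⟩ := Unknown.exists_limit (V := fun k => (V k).1) hV
  have hv1 : v.Fil 1 := by
    have := hv 0
    rw [Nat.cast_zero, zero_add] at this
    exact this.add_sub (V 0).2
  -- The image of the limit and the limit itself are both close to V (k+1), for every k.
  have hfix : (S ⟨v, hv1⟩).1 = v := by
    refine Unknown.eq_of_fil fun k => ?_
    have h1 := hstep ⟨v, hv1⟩ (V k) _ (hv k)
    have h2 := hv (k + 1)
    refine ((h1.anti ?_).sub_sub (v'' := (V (k + 1)).1) (h2.anti ?_)) <;> push_cast <;> omega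
  have a := hS1 ⟨v, hv1⟩
  have b := hS2 ⟨v, hv1⟩
  have c := hS3 ⟨v, hv1⟩
  have d := hS4 ⟨v, hv1⟩
  rw [hfix] at a b
  simp only [hfix] at c d
  exact ⟨v, a, b, hv1, (Φ.transf_perturb_iff L hv1.hasSubst).2 ⟨c, d⟩⟩

/-- Uniqueness of the normalization of a perturbation of the model. -/
theorem perturb_unique {v v' : Unknown n R} (h : v.Fil 1) (h' : v'.Fil 1)
    (hv : Φ.LinNormal v) (hv' : Φ.LinNormal v')
    (hg : coeff (Finsupp.single iu 2) v.g = coeff (Finsupp.single iu 2) v'.g)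
    (ht : L.Transf v.f v.g (Φ.perturb v)) (ht' : L.Transf v'.f v'.g (Φ.perturb v')) : v = v' := by
  obtain ⟨a, b⟩ := (Φ.transf_perturb_iff L h.hasSubst).1 ht
  obtain ⟨a', b'⟩ := (Φ.transf_perturb_iff L h'.hasSubst).1 ht'
  have key : ∀ k : ℕ, (v - v').Fil (k + 1) := by
    intro k
    induction k with
    | zero => simpa using h.sub h'
    | succ k ih => exact_mod_cast Φ.fil_succ hz hw hn h h' hv hv' hg a b a' b' ih
  exact Unknown.eq_of_fil fun k => (key k).anti (by omega)

end Frame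

end FormalCR

/-! ### Ordinary degree, and transformations to first order -/

namespace FormalCR

open MvPowerSeries

section Degree

variable {n : ℕ} {R : Type*} [CommRing R]

/-- The weights `1, 1, 1` of `z`, `z̄`, `u`. -/
def wone {n : ℕ} : Var n → ℤ := fun _ => 1

theorem one_le_wone {n : ℕ} (i : Var n) : 1 ≤ wone i := le_rfl

theorem wone_nonneg {n : ℕ} (i : Var n) : 0 ≤ wone i := zero_le_one

theorem weight_wone (α : MIdx n) : Finsupp.weight (R := ℕ) wone α = (α.degree : ℤ) := by
  rw [Finsupp.weight_apply, Finsupp.degree_apply, Finsupp.sum, Nat.cast_sum]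
  simp [wone]

theorem ncl_iff {p : PS n R} : NCL p ↔ p ∈ wfil R wone 2 := by
  refine forall_congr' fun α => ?_
  rw [weight_wone]
  refine imp_congr_left ?_
  omega

theorem wfil_wone_le (d : ℤ) : wfil R (wone : Var n → ℤ) d ≤ wfil R wwt d := fun p hp α hα => by
  refine hp α (lt_of_le_of_lt ?_ hα)
  rw [weight_wone]
  exact degree_le_weight one_le_wwt α

theorem mem_wfil_one_iff {w : Var n → ℤ} (hw : ∀ i, 1 ≤ w i) {p : PS n R} :
    p ∈ wfil R w 1 ↔ constantCoeff p = 0 := by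
  rw [← coeff_zero_eq_constantCoeff_apply]
  refine ⟨fun h => h 0 (by rw [map_zero]; norm_num), fun h α hα => ?_⟩
  have h1 := degree_le_weight hw α
  have h2 : α.degree = 0 := by omega
  rw [(Finsupp.degree_eq_zero_iff α).1 h2, h]

theorem mem_wfil_zero {w : Var n → ℤ} (hw : ∀ i, 0 ≤ w i) (p : PS n R) : p ∈ wfil R w 0 :=
  mem_wfil_of_nonpos hw le_rfl p

/-- The condition `L(0) = 0`. -/
structure CRMap.NoCst (L : CRMap n R) : Prop where
  zb : ∀ j k, L.zb j k ∈ wfil R wone 1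
  w : ∀ k, L.w k ∈ wfil R wone 1

namespace CRMap

variable {L : CRMap n R}

theorem vf_subst (L : CRMap n R) {h : Var n → PS n R} (hs : HasSubst h)
    (hh : ∀ i, h i ∈ wfil R wone (wone i)) (k : Fin n) (p : PS n R) :
    L.vf k (subst h p) = ∑ i, subst h (pderiv R i p) * L.vf k (h i) := by
  simp only [vf, pderiv_subst one_le_wone hs hh, mul_add, Finset.mul_sum, Finset.sum_add_distrib]
  rw [Finset.sum_comm]
  congr 1
  · congr 1
    exact Finset.sum_congr rfl fun i _ => Finset.sum_congr rfl fun j _ => by ring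
  · exact Finset.sum_congr rfl fun i _ => by ring

theorem vf_mem_wone (L : CRMap n R) (k : Fin n) {p : PS n R} {d : ℤ} (hp : p ∈ wfil R wone (d + 1)) :
    L.vf k p ∈ wfil R wone d := by
  have h : ∀ i, pderiv R i p ∈ wfil R wone d := fun i => wfil_pderiv' hp i (by simp [wone])
  exact add_mem (add_mem (h _) (sum_mem fun j _ =>
    wfil_mul' (mem_wfil_zero wone_nonneg _) (h _) (by omega)))
    (wfil_mul' (mem_wfil_zero wone_nonneg _) (h _) (by omega))

theorem NoCst.vf_sub_pderiv_mem (hL : L.NoCst) (k : Fin n) {p : PS n R} {d : ℤ}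
    (hp : p ∈ wfil R wone d) : L.vf k p - pderiv R (iz k) p ∈ wfil R wone d := by
  have h : ∀ i, pderiv R i p ∈ wfil R wone (d - 1) := fun i => wfil_pderiv' hp i (by simp [wone])
  have e : L.vf k p - pderiv R (iz k) p =
      (∑ j, L.zb j k * pderiv R (izb j) p) + L.w k * pderiv R iu p := by
    simp only [vf]; ring
  rw [e]
  exact add_mem (sum_mem fun j _ => wfil_mul' (hL.zb j k) (h _) (by omega))
    (wfil_mul' (hL.w k) (h _) (by omega))

end CRMap

variable [StarRing R]

theorem bar_mem_wone {d : ℤ} {p : PS n R} (hp : p ∈ wfil R wone d) : bar p ∈ wfil R wone d := by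
  intro α hα
  rw [coeff_bar, hp, star_zero]
  rw [weight_wone, degree_eq] at hα ⊢
  simp only [swapIdx_apply]
  change ((∑ j, α (izb j) + (∑ j, α (iz j) + α iu) : ℕ) : ℤ) < d
  omega

theorem NCL.bar {p : PS n R} (hp : NCL p) : NCL (bar p) := ncl_iff.2 (bar_mem_wone (ncl_iff.1 hp))

namespace CRMap

variable {f : Fin n → PS n R} {g : PS n R} {L L' : CRMap n R} (ht : L.Transf f g L')

include ht

theorem Transf.w_eq (k : Fin n) : L.w k + L.vf k g =
    subst (chg f g) (L'.w k) + ∑ m, subst (chg f g) (L'.w m) * L.vf k (f m) := by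
  have := ht.1 k
  simp only [chg_u, chg_z, vf_add, vf_X_u, vf_X_z] at this
  rwa [sum_mul_ite_add] at this

theorem Transf.zb_eq (j k : Fin n) : L.zb j k + L.vf k (bar (f j)) =
    subst (chg f g) (L'.zb j k) + ∑ m, subst (chg f g) (L'.zb j m) * L.vf k (f m) := by
  have := ht.2 j k
  simp only [chg_zb, chg_z, vf_add, vf_X_zb, vf_X_z] at this
  rwa [sum_mul_ite_add] at this

end CRMap

section Chg

variable {f : Fin n → PS n R} {g : PS n R} (hf : ∀ j, NCL (f j)) (hg : NCL g)

include hf hg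

theorem chg_sub_X_mem (i : Var n) : chg f g i - X i ∈ wfil R wone (wone i + 1) := by
  rw [show (wone i + 1 : ℤ) = 2 from rfl, ← ncl_iff]
  rcases i with j | j | j
  · rw [chg_z, add_sub_cancel_left]; exact hf j
  · rw [chg_zb, add_sub_cancel_left]; exact (hf j).bar
  · change NCL (X iu + g - X iu)
    rwa [add_sub_cancel_left]

theorem chg_mem_wone (i : Var n) : chg f g i ∈ wfil R wone (wone i) := by
  have := add_mem (wfil_anti (by omega) (chg_sub_X_mem hf hg i)) (wfil_X (R := R) (w := wone) i)
  rwa [sub_add_cancel] at this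

theorem hasSubst_chg : HasSubst (chg f g) := hasSubst_of_mem_wfil (chg_mem_wone hf hg) one_le_wone

theorem subst_chg_mem {d : ℤ} {p : PS n R} (hp : p ∈ wfil R wone d) :
    subst (chg f g) p ∈ wfil R wone d :=
  subst_mem_wfil (hasSubst_chg hf hg) (chg_mem_wone hf hg) wone_nonneg hp

theorem subst_chg_sub_mem {d : ℤ} {p : PS n R} (hp : p ∈ wfil R wone d) :
    subst (chg f g) p - p ∈ wfil R wone (d + 1) := by
  have := subst_sub_mem_wfil (hasSubst_chg hf hg) hasSubst_X (chg_mem_wone hf hg)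
    (fun i => wfil_X i) (chg_sub_X_mem hf hg) wone_nonneg hp
  rwa [subst_X_self] at this

namespace CRMap

variable {L L' : CRMap n R} (hL : L.NoCst) (ht : L.Transf f g L')

include ht hL

/-- The map is tangent to the identity, so all terms of the equation except the values of L and L'
themselves vanish at 0. -/
theorem Transf.noCst : L'.NoCst := by
  have h0 := fun p : PS n R => mem_wfil_zero wone_nonneg p
  refine ⟨fun j k => ?_, fun k => ?_⟩
  · have e : L'.zb j k = L.zb j k + L.vf k (bar (f j))
        - (∑ m, subst (chg f g) (L'.zb j m) * L.vf k (f m))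
        - (subst (chg f g) (L'.zb j k) - L'.zb j k) := by linear_combination -ht.zb_eq j k
    rw [e]
    refine sub_mem (sub_mem (add_mem (hL.zb j k) (L.vf_mem_wone k (ncl_iff.1 (hf j).bar)))
      (sum_mem fun m _ => wfil_mul' (h0 _) (L.vf_mem_wone k (d := 1) (ncl_iff.1 (hf m))) (by norm_num))) ?_
    simpa using subst_chg_sub_mem hf hg (h0 (L'.zb j k))
  · have e : L'.w k = L.w k + L.vf k g
        - (∑ m, subst (chg f g) (L'.w m) * L.vf k (f m))
        - (subst (chg f g) (L'.w k) - L'.w k) := by linear_combination -ht.w_eq k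
    rw [e]
    refine sub_mem (sub_mem (add_mem (hL.w k) (L.vf_mem_wone k (ncl_iff.1 hg)))
      (sum_mem fun m _ => wfil_mul' (h0 _) (L.vf_mem_wone k (d := 1) (ncl_iff.1 (hf m))) (by norm_num))) ?_
    simpa using subst_chg_sub_mem hf hg (h0 (L'.w k))

/-- To first order L^w changes only by the z-derivative of g. Both the invariance of the two forms
at 0 and the lower bound for the weight of normalizations rest on this. -/
theorem Transf.w_sub_mem (k : Fin n) :
    L'.w k - L.w k - pderiv R (iz k) g ∈ wfil R wone 2 := by
  have hL' := ht.noCst hf hg hL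
  have e : L'.w k - L.w k - pderiv R (iz k) g = L.vf k g - pderiv R (iz k) g
      - (∑ m, subst (chg f g) (L'.w m) * L.vf k (f m))
      - (subst (chg f g) (L'.w k) - L'.w k) := by linear_combination -ht.w_eq k
  rw [e]
  exact sub_mem (sub_mem (hL.vf_sub_pderiv_mem k (ncl_iff.1 hg)) (sum_mem fun m _ =>
    wfil_mul' (subst_chg_mem hf hg (hL'.w m)) (L.vf_mem_wone k (d := 1) (ncl_iff.1 (hf m)))
      (by norm_num))) (subst_chg_sub_mem hf hg (hL'.w k))

end CRMap

end Chg

/-- Conjugation of a substitution. -/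
theorem bar_subst {h : Var n → PS n R} (hs : HasSubst h)
    (hh : ∀ i, h i ∈ wfil R wone (wone i)) (p : PS n R) :
    bar (subst h p) = subst (fun i => bar (h (swapVar n i))) (bar p) := by
  let h' : Var n → PS n R := fun i => bar (h (swapVar n i))
  have hh' : ∀ i, h' i ∈ wfil R wone (wone i) := fun i => bar_mem_wone (hh (swapVar n i))
  have hs' : HasSubst h' := hasSubst_of_mem_wfil hh' one_le_wone
  let Δ : PS n R →+ PS n R :=
    AddMonoidHom.mk' (fun p => bar (subst h p) - subst h' (bar p)) fun p q => by
      simp only [map_add, subst_add hs, subst_add hs']; ring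
  have : Δ = 0 := by
    refine eq_zero_of_polynomial one_le_wone Δ 0 (fun d p hp => ?_) fun p => ?_
    · rw [sub_zero]
      exact sub_mem (bar_mem_wone (subst_mem_wfil hs hh wone_nonneg hp))
        (subst_mem_wfil hs' hh' wone_nonneg (bar_mem_wone hp))
    · induction p using MvPolynomial.induction_on with
      | C r =>
        change bar (subst h _) - subst h' (bar _) = 0
        rw [MvPolynomial.coe_C, subst_C_eq hs, bar_C, subst_C_eq hs', sub_self]
      | add p q hp hq => rw [MvPolynomial.coe_add, map_add, hp, hq, add_zero]
      | mul_X p k hp =>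
        replace hp : bar (subst h (p : PS n R)) - subst h' (bar (p : PS n R)) = 0 := hp
        change bar (subst h _) - subst h' (bar _) = 0
        rw [MvPolynomial.coe_mul, MvPolynomial.coe_X, subst_mul hs, subst_X hs, map_mul, map_mul,
          bar_X, subst_mul hs', subst_X hs', sub_eq_zero.1 hp]
        simp only [h', swapVar_swapVar, sub_self]
  have h2 := DFunLike.congr_fun this p
  exact sub_eq_zero.1 h2

theorem bar_chg {f : Fin n → PS n R} {g : PS n R} (hg : bar g = g) (i : Var n) :
    bar (chg f g (swapVar n i)) = chg f g i := by
  rcases i with j | j | j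
  · change bar (X (izb j) + bar (f j)) = X (iz j) + f j
    rw [map_add, bar_X_zb, bar_bar]
  · change bar (X (iz j) + f j) = X (izb j) + bar (f j)
    rw [map_add, bar_X_z]
  · change bar (X iu + g) = X iu + g
    rw [map_add, bar_X_u, hg]

theorem bar_subst_chg {f : Fin n → PS n R} {g : PS n R} (hf : ∀ j, NCL (f j)) (hg : NCL g)
    (hr : bar g = g) (p : PS n R) : bar (subst (chg f g) p) = subst (chg f g) (bar p) := by
  rw [bar_subst (hasSubst_chg hf hg) (chg_mem_wone hf hg)]
  congr 1
  exact funext fun i => bar_chg hr i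

end Degree

end FormalCR

/-! ### Quadratic shears in u -/

namespace FormalCR

open MvPowerSeries

section Linear

variable {n : ℕ} {R : Type*} [CommRing R]

theorem exists_eq_single {α : MIdx n} (h : α.degree = 1) : ∃ i, α = Finsupp.single i 1 := by
  have h0 : α ≠ 0 := by rintro rfl; simp at h
  obtain ⟨i, hi⟩ := Finsupp.ne_iff.1 h0
  have hle : Finsupp.single i 1 ≤ α := Finsupp.single_le_iff.2 (Nat.one_le_iff_ne_zero.2 hi)
  obtain ⟨β, rfl⟩ := exists_add_of_le hle
  rw [map_add, Finsupp.degree_single] at h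
  exact ⟨i, by rw [(Finsupp.degree_eq_zero_iff β).1 (by omega), add_zero]⟩

theorem eq_of_weight_lt_two {α : MIdx n} (h : Finsupp.weight (R := ℕ) wwt α < 2) :
    α = 0 ∨ (∃ j, α = Finsupp.single (iz j) 1) ∨ ∃ j, α = Finsupp.single (izb j) 1 := by
  have h1 := degree_le_weight one_le_wwt α
  rcases Nat.eq_zero_or_pos α.degree with h2 | h2
  · exact Or.inl ((Finsupp.degree_eq_zero_iff α).1 h2)
  · obtain ⟨i, rfl⟩ := exists_eq_single (α := α) (by omega)
    rcases i with j | j | j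
    · exact Or.inr (Or.inl ⟨j, rfl⟩)
    · exact Or.inr (Or.inr ⟨j, rfl⟩)
    · rw [Finsupp.weight_single] at h
      simp [wwt] at h

theorem sub_linear_mem {p : PS n R} (h : constantCoeff p = 0) :
    p - (∑ j, C (coeff (Finsupp.single (iz j) 1) p) * X (iz j)
      + ∑ j, C (coeff (Finsupp.single (izb j) 1) p) * X (izb j)) ∈ wfil R wwt 2 := by
  classical
  intro α hα
  have e : ∀ i i' : Var n, (Finsupp.single i 1 : MIdx n) = Finsupp.single i' 1 ↔ i = i' :=
    fun i i' => Finsupp.single_left_inj one_ne_zero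
  have e0 : ∀ i : Var n, (0 : MIdx n) ≠ Finsupp.single i 1 := fun i h => by
    simpa using (DFunLike.congr_fun h i).symm
  rw [← coeff_zero_eq_constantCoeff_apply] at h
  simp only [map_sub, map_add, map_sum, coeff_C_mul, coeff_X]
  rcases eq_of_weight_lt_two hα with rfl | ⟨k, rfl⟩ | ⟨k, rfl⟩ <;> simp [h, e, e0]

/-- A quadratic polynomial in `z`, `z̄`. -/
def quad (p r s : Fin n → Fin n → R) : PS n R :=
  ∑ k, ∑ j, (C (p k j) * (X (iz k) * X (iz j)) + C (r k j) * (X (iz k) * X (izb j))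
    + C (s k j) * (X (izb k) * X (izb j)))

variable (p r s : Fin n → Fin n → R)

theorem quad_mem {w : Var n → ℤ} {d e : ℤ} (hz : ∀ j, w (iz j) = e) (hb : ∀ j, w (izb j) = e)
    (hd : d = e + e) : quad p r s ∈ wfil R w d := by
  subst hd
  have hC : ∀ (c : R) {q : PS n R}, q ∈ wfil R w (e + e) → C c * q ∈ wfil R w (e + e) :=
    fun c q hq => by rw [← smul_eq_C_mul]; exact Submodule.smul_mem _ _ hq
  have h1 : ∀ j, (X (iz j) : PS n R) ∈ wfil R w e := fun j => hz j ▸ wfil_X _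
  have h2 : ∀ j, (X (izb j) : PS n R) ∈ wfil R w e := fun j => hb j ▸ wfil_X _
  exact sum_mem fun k _ => sum_mem fun j _ => add_mem (add_mem (hC _ (wfil_mul (h1 _) (h1 _)))
    (hC _ (wfil_mul (h1 _) (h2 _)))) (hC _ (wfil_mul (h2 _) (h2 _)))

theorem subst_quad {h : Var n → PS n R} (hs : HasSubst h) (hz : ∀ j, h (iz j) = X (iz j))
    (hb : ∀ j, h (izb j) = X (izb j)) : subst h (quad p r s) = quad p r s := by
  simp only [quad, subst_sum hs, subst_add hs, subst_mul hs, subst_C_eq hs, subst_X hs, hz, hb]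

theorem pderiv_u_quad : pderiv R iu (quad p r s) = 0 := by
  simp [quad, map_sum]

theorem pderiv_z_quad (m : Fin n) : pderiv R (iz m) (quad p r s) =
    ∑ j, C (p m j + p j m) * X (iz j) + ∑ j, C (r m j) * X (izb j) := by
  classical
  simp only [quad, map_sum, map_add, pderiv_C_mul]
  simp only [Derivation.leibniz, smul_eq_mul, pderiv_X,
    Pi.single_apply, Sum.inl.injEq, mul_ite, mul_one, mul_zero, mul_add, reduceCtorEq, ite_false,
    Finset.sum_add_distrib, add_zero, zero_add, Finset.sum_const_zero, Finset.sum_ite_eq',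
    Finset.mem_univ, ite_true, add_mul, Finset.sum_ite_irrel]
  ring

end Linear

section Shear

variable {n : ℕ} {R : Type*} [CommRing R]

/-- The weights `2, 2, 1` of `z`, `z̄`, `u`. -/
def wshear {n : ℕ} : Var n → ℤ := Sum.elim 2 (Sum.elim 2 1)

theorem wshear_nonneg {n : ℕ} (i : Var n) : 0 ≤ wshear i := by
  rcases i with i | i | i <;> simp [wshear]

theorem subst_neg_of {h : Var n → PS n R} (hs : HasSubst h) (p : PS n R) :
    subst h (-p) = -subst h p := by
  rw [← coe_substAlgHom hs, map_neg]

theorem ncl_zero : ∀ j, NCL ((0 : Fin n → PS n R) j) := fun _ _ _ => coeff_zero _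

variable [StarRing R]

/-- The properties of the functions `q` used in shears `u ↦ u + q`. -/
structure ShearFn (q : PS n R) : Prop where
  real : bar q = q
  ncl : NCL q
  mem_wwt : q ∈ wfil R wwt 2
  mem_wshear : q ∈ wfil R wshear 4
  pderiv_u : pderiv R iu q = 0
  inv : ∀ {h : Var n → PS n R}, HasSubst h → (∀ j, h (iz j) = X (iz j)) →
    (∀ j, h (izb j) = X (izb j)) → subst h q = q

/-- The shear `u ↦ u + q`. -/
abbrev shr (q : PS n R) : Var n → PS n R := chg 0 q

theorem shr_z (q : PS n R) (j : Fin n) : shr q (iz j) = X (iz j) := by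
  rw [shr, chg_z, Pi.zero_apply, add_zero]

theorem shr_zb (q : PS n R) (j : Fin n) : shr q (izb j) = X (izb j) := by
  rw [shr, chg_zb, Pi.zero_apply, map_zero, add_zero]

theorem shr_u (q : PS n R) : shr q iu = X iu + q := rfl

namespace ShearFn

variable {q : PS n R} (hq : ShearFn q)

include hq

theorem neg : ShearFn (-q) where
  real := by rw [map_neg, hq.real]
  ncl α hα := by rw [map_neg, hq.ncl α hα, neg_zero]
  mem_wwt := neg_mem hq.mem_wwt
  mem_wshear := neg_mem hq.mem_wshear
  pderiv_u := by rw [map_neg, hq.pderiv_u, neg_zero]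
  inv hs hz hb := by rw [subst_neg_of hs, hq.inv hs hz hb]

theorem hasSubst : HasSubst (shr q) := hasSubst_chg ncl_zero hq.ncl

theorem subst_self : subst (shr q) q = q := hq.inv hq.hasSubst (shr_z q) (shr_zb q)

/-- As q involves only z and z̄, the shear by q leaves q unchanged, so the shears by q and −q are
inverse to each other. -/
theorem subst_neg_subst (p : PS n R) : subst (shr q) (subst (shr (-q)) p) = p := by
  rw [subst_comp_subst_apply hq.neg.hasSubst hq.hasSubst]
  have : (fun i => subst (shr q) (shr (-q) i)) = X := by
    funext i
    rcases i with j | j | j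
    · rw [shr_z, subst_X hq.hasSubst, shr_z]
    · rw [shr_zb, subst_X hq.hasSubst, shr_zb]
    · rw [shr_u, subst_add hq.hasSubst, subst_X hq.hasSubst, subst_neg_of hq.hasSubst,
        hq.subst_self, shr_u, add_neg_cancel_right]
  rw [this, subst_X_self]

theorem subst_subst_neg (p : PS n R) : subst (shr (-q)) (subst (shr q) p) = p := by
  have := hq.neg.subst_neg_subst p
  rwa [neg_neg] at this

theorem subst_injective : Function.Injective (subst (shr q) : PS n R → PS n R) := fun p p' h => by
  rw [← hq.subst_subst_neg p, h, hq.subst_subst_neg]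

theorem subst_mem_wone {d : ℤ} {p : PS n R} (hp : p ∈ wfil R wone d) :
    subst (shr q) p ∈ wfil R wone d := subst_chg_mem ncl_zero hq.ncl hp

theorem subst_ncl {p : PS n R} (hp : NCL p) : NCL (subst (shr q) p) :=
  ncl_iff.2 (hq.subst_mem_wone (ncl_iff.1 hp))

theorem bar_subst (p : PS n R) : bar (subst (shr q) p) = subst (shr q) (bar p) :=
  bar_subst_chg ncl_zero hq.ncl hq.real p

theorem subst_mem_wwt {d : ℤ} {p : PS n R} (hp : p ∈ wfil R wwt d) :
    subst (shr q) p ∈ wfil R wwt d := by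
  refine subst_mem_wfil hq.hasSubst (fun i => ?_) wwt_nonneg hp
  rcases i with j | j | j
  · rw [shr_z]; exact wfil_X _
  · rw [shr_zb]; exact wfil_X _
  · change X iu + q ∈ _
    exact add_mem (wfil_X _) hq.mem_wwt

/-- For the weights 2, 2, 1 the function q has order 4, three more than u. The shear thus changes a
series only in weights at least 3, whereas u² has weight 2. -/
theorem coeff_subst_u (p : PS n R) :
    coeff (Finsupp.single iu 2) (subst (shr q) p) = coeff (Finsupp.single iu 2) p := by
  have h3 : ∀ i, shr q i - X i ∈ wfil R wshear (wshear i + 3) := by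
    intro i
    rcases i with j | j | j
    · rw [shr_z, sub_self]; exact zero_mem _
    · rw [shr_zb, sub_self]; exact zero_mem _
    · change X iu + q - X iu ∈ _
      rw [add_sub_cancel_left]; exact hq.mem_wshear
  have h1 : ∀ i, shr q i ∈ wfil R wshear (wshear i) := fun i => by
    have := add_mem (wfil_anti (by omega) (h3 i)) (wfil_X (R := R) (w := wshear) i)
    rwa [sub_add_cancel] at this
  have h := subst_sub_mem_wfil hq.hasSubst hasSubst_X h1 (fun i => wfil_X i) h3 wshear_nonneg
    (mem_wfil_zero wshear_nonneg p)
  rw [subst_X_self] at h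
  have h2 := h (Finsupp.single iu 2) (by rw [Finsupp.weight_single]; simp [wshear])
  rwa [map_sub, sub_eq_zero] at h2

theorem coeff_u : coeff (Finsupp.single iu 2) q = 0 :=
  hq.mem_wshear _ (by rw [Finsupp.weight_single]; simp [wshear])

theorem subst_chg {f : Fin n → PS n R} {g : PS n R} (i : Var n) :
    subst (shr q) (chg f g i) = chg (fun j => subst (shr q) (f j)) (subst (shr q) g + q) i := by
  rcases i with j | j | j
  · rw [chg_z, subst_add hq.hasSubst, subst_X hq.hasSubst, shr_z, chg_z]
  · rw [chg_zb, subst_add hq.hasSubst, subst_X hq.hasSubst, shr_zb, chg_zb, hq.bar_subst]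
  · change subst (shr q) (X iu + g) = X iu + (subst (shr q) g + q)
    rw [subst_add hq.hasSubst, subst_X hq.hasSubst, shr_u]
    ring

end ShearFn

namespace CRMap

/-- The image of `L` under the shear `u ↦ u + q`. -/
def shear (L : CRMap n R) (q : PS n R) : CRMap n R :=
  ⟨fun j k => subst (shr (-q)) (L.zb j k), fun k => subst (shr (-q)) (L.vf k (X iu + q))⟩

variable {L L' : CRMap n R} {q : PS n R} (hq : ShearFn q)

include hq

/-- Chain rule: the sheared structure is defined as the one whose fields are the push-forwards of
those of L. -/
theorem vf_subst_shear (k : Fin n) (p : PS n R) :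
    L.vf k (subst (shr q) p) = subst (shr q) ((L.shear q).vf k p) := by
  rw [vf_subst L hq.hasSubst (chg_mem_wone ncl_zero hq.ncl)]
  simp only [Fintype.sum_sum_type, Finset.univ_unique, Finset.sum_singleton, PUnit.default_eq_unit]
  have hs := hq.hasSubst
  have e : (L.shear q).vf k p = pderiv R (iz k) p + (∑ j, (L.shear q).zb j k * pderiv R (izb j) p)
      + (L.shear q).w k * pderiv R iu p := rfl
  rw [e, subst_add hs, subst_add hs, subst_sum hs]
  simp only [subst_mul hs, shear, hq.subst_neg_subst]
  simp only [shr_z, shr_zb, vf_X_z, vf_X_zb]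
  rw [← add_assoc]
  congr 1
  · congr 1
    · simp
    · exact Finset.sum_congr rfl fun j _ => mul_comm _ _
  · exact mul_comm _ _

/-- The map on the left is the shear followed by id + (f, g). Pulling back by the shear is
injective, so the two systems of equations are equivalent. -/
theorem transf_shear_iff {f : Fin n → PS n R} {g : PS n R} (hf : ∀ j, NCL (f j)) (hg : NCL g) :
    L.Transf (fun j => subst (shr q) (f j)) (subst (shr q) g + q) L' ↔
      (L.shear q).Transf f g L' := by
  have hs := hq.hasSubst
  have hS : ∀ p : PS n R, subst (chg (fun j => subst (shr q) (f j)) (subst (shr q) g + q)) p =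
      subst (shr q) (subst (chg f g) p) := fun p => by
    rw [subst_comp_subst_apply (hasSubst_chg hf hg) hs]
    congr 1
    exact funext fun i => (hq.subst_chg i).symm
  simp only [Transf, ← hq.subst_chg, hS, vf_subst_shear hq, ← subst_mul hs, ← subst_sum hs,
    hq.subst_injective.eq_iff]

theorem NoCst.shear (hL : L.NoCst) : (L.shear q).NoCst := by
  refine ⟨fun j k => hq.neg.subst_mem_wone (hL.zb j k), fun k => hq.neg.subst_mem_wone ?_⟩
  rw [vf_add, vf_X_u]
  exact add_mem (hL.w k) (L.vf_mem_wone k (ncl_iff.1 hq.ncl))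

end CRMap

end Shear

namespace Frame

variable {n : ℕ} {R : Type*} [CommRing R] [StarRing R] [Algebra ℂ R] (Φ : Frame n R)

/-- The frame consists of the two forms of `L` at `0`. -/
structure Compat (L : CRMap n R) : Prop where
  c_eq : ∀ j k, Φ.c j k = algebraMap ℂ R (1 / (2 * Complex.I)) *
    (coeff (Finsupp.single (izb j) 1) (L.w k) - star (coeff (Finsupp.single (izb k) 1) (L.w j)))
  nn_eq : ∀ j k, Φ.nn j k = coeff (Finsupp.single (iz j) 1) (L.w k)
    - coeff (Finsupp.single (iz k) 1) (L.w j)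

variable [StarModule ℂ R]

/-- The z-derivative of q can cancel the symmetric part of the z-coefficients of L^w and the
hermitian part of its z̄-coefficients. What remains is ½N and i times the Levi form, which is the
model. -/
theorem exists_shearFn {L : CRMap n R} (hL : L.NoCst) (hΦ : Φ.Compat L) :
    ∃ q, ShearFn q ∧ ∀ k, L.w k + pderiv R (iz k) q - Φ.ellz k ∈ wfil R wwt 2 := by
  let h : R := algebraMap ℂ R (1 / 2)
  have hh : star h = h := by
    simp only [h]
    rw [← algebraMap_star_comm]
    congr 1
    simp
  have h1 : h + h = 1 := by
    simp only [h]
    rw [← map_add, ← map_one (algebraMap ℂ R)]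
    norm_num
  let A : Fin n → Fin n → R := fun k j => coeff (Finsupp.single (iz j) 1) (L.w k)
  let B : Fin n → Fin n → R := fun k j => coeff (Finsupp.single (izb j) 1) (L.w k)
  let p : Fin n → Fin n → R := fun k j => -(h * A k j)
  let r : Fin n → Fin n → R := fun k j => -(h * (B k j + star (B j k)))
  -- Forced by reality of q; this part has no z-derivative.
  let s : Fin n → Fin n → R := fun k j => star (p k j)
  refine ⟨quad p r s, ⟨?_, ncl_iff.2 (quad_mem _ _ _ (fun _ => rfl) (fun _ => rfl) rfl),
    quad_mem _ _ _ (fun _ => rfl) (fun _ => rfl) rfl,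
    quad_mem _ _ _ (fun _ => rfl) (fun _ => rfl) rfl, pderiv_u_quad _ _ _,
    fun hs hz hb => subst_quad _ _ _ hs hz hb⟩, fun k => ?_⟩
  · have hr : ∀ k j, star (r k j) = r j k := fun k j => by
      simp only [r, star_neg, star_mul', star_add, star_star, hh]
      ring
    have e : ∑ k, ∑ j, C (r j k) * (X (izb k) * X (iz j)) =
        (∑ k, ∑ j, C (r k j) * (X (iz k) * X (izb j)) : PS n R) := by
      rw [Finset.sum_comm]
      exact Finset.sum_congr rfl fun k _ => Finset.sum_congr rfl fun j _ => by
        rw [mul_comm (X (izb j))]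
    simp only [quad, map_sum, map_add, map_mul, bar_C, bar_X_z, bar_X_zb, hr, s, star_star,
      Finset.sum_add_distrib, e]
    ring
  · have h2 := sub_linear_mem ((mem_wfil_one_iff one_le_wone).1 (hL.w k))
    have hI : algebraMap ℂ R Complex.I * algebraMap ℂ R (1 / (2 * Complex.I)) = h := by
      rw [← map_mul]
      simp only [h]
      congr 1
      field_simp
    have h3 : ∑ j, C (A k j) * X (iz j) + ∑ j, C (B k j) * X (izb j)
        + pderiv R (iz k) (quad p r s) - Φ.ellz k = 0 := by
      rw [pderiv_z_quad, ellz, ell, Ic, cst_def, cst_def, Finset.mul_sum, Finset.mul_sum]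
      have e1 : ∀ j, (C (algebraMap ℂ R Complex.I) * (C (Φ.c j k) * X (izb j)) : PS n R) =
          C (B k j) * X (izb j) + C (r k j) * X (izb j) := fun j => by
        rw [← mul_assoc, ← map_mul, ← add_mul, ← map_add, hΦ.c_eq, ← mul_assoc, hI]
        congr 2
        simp only [r, B]
        linear_combination coeff (Finsupp.single (izb j) 1) (L.w k) * h1
      have e2 : ∀ j, (C (algebraMap ℂ R (1 / 2)) * (C (Φ.nn j k) * X (iz j)) : PS n R) =
          C (A k j) * X (iz j) + C (p k j + p j k) * X (iz j) := fun j => by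
        rw [← mul_assoc, ← map_mul, ← add_mul, ← map_add, hΦ.nn_eq]
        congr 2
        simp only [p, A]
        linear_combination coeff (Finsupp.single (iz j) 1) (L.w k) * h1
      simp only [e1, e2, Finset.sum_add_distrib]
      ring
    have e : L.w k + pderiv R (iz k) (quad p r s) - Φ.ellz k =
        (L.w k - (∑ j, C (A k j) * X (iz j) + ∑ j, C (B k j) * X (izb j)))
        + (∑ j, C (A k j) * X (iz j) + ∑ j, C (B k j) * X (izb j)
        + pderiv R (iz k) (quad p r s) - Φ.ellz k) := by ring
    rw [e, h3, add_zero]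
    exact h2

end Frame

end FormalCR

/-! ### Normalization of arbitrary structures over the coefficient ring -/

namespace FormalCR

open MvPowerSeries

namespace Frame

/-- The Euler operators act by a nonzero integer except on powers of u; below weight three these are
only 1 and u, which are excluded. -/
theorem mem_wfil_three {n : ℕ} {R : Type*} [CommRing R] [Algebra ℂ R] {g : PS n R} (hg : NCL g) (h : ee g + eb g ∈ wfil R wwt 3) :
    g ∈ wfil R wwt 3 := by
  intro α hα
  have h1 := h α hα
  rw [map_add, coeff_ee, coeff_eb, ← add_mul, ← Nat.cast_add] at h1
  by_cases h0 : (∑ j, α (iz j)) + ∑ j, α (izb j) = 0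
  · rw [weight_wwt] at hα
    exact hg α (by rw [degree_eq]; omega)
  · generalize (∑ j, α (iz j)) + ∑ j, α (izb j) = N at h0 h1
    have h2 : algebraMap ℂ R ((N : ℂ)⁻¹) * (N : R) = 1 := by
      rw [← map_natCast (algebraMap ℂ R), ← map_mul, inv_mul_cancel₀ (Nat.cast_ne_zero.2 h0),
        map_one]
    calc coeff α g = algebraMap ℂ R ((N : ℂ)⁻¹) * ((N : R) * coeff α g) := by
          rw [← mul_assoc, h2, one_mul]
      _ = 0 := by rw [h1, mul_zero]

variable {n : ℕ} {R : Type*} [CommRing R] [StarRing R] [Algebra ℂ R] (Φ : Frame n R)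

/-- `id + (f, g)` transforms `L` into `L'`, which is normalized. -/
structure Normalizing (L : CRMap n R) (ρ : R) (f : Fin n → PS n R) (g : PS n R)
    (L' : CRMap n R) : Prop where
  ncl_f : ∀ j, NCL (f j)
  ncl_g : NCL g
  real : bar g = g
  coeff_g : coeff (Finsupp.single iu 2) g = ρ
  transf : L.Transf f g L'
  tangential : ∀ j, ∑ k, L'.zb j k * X (iz k) = 0
  radial : Φ.RadNormal (∑ k, L'.w k * X (iz k))

theorem cp_Q (a b : ℤ) (h : ¬(a = 1 ∧ b = 1)) : cp a b Φ.Q = 0 := by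
  rw [← mul_one Φ.Q, cp_Q_mul, ← cp_one, cp_cp, if_neg (by omega), mul_zero]

theorem sum_perturb_w (v : Unknown n R) :
    ∑ k, (Φ.perturb v).w k * X (iz k) = Ic * Φ.Q + ∑ k, v.w k * X (iz k) := by
  simp only [perturb, add_mul, Finset.sum_add_distrib]
  rw [← sum_mul_ellz]
  simp only [mul_comm]

theorem shear_zb_mem {n : ℕ} {R : Type*} [CommRing R] [StarRing R] {L : CRMap n R} (hL : L.NoCst)
    {q : PS n R} (hq : ShearFn q) (j k : Fin n) : (L.shear q).zb j k ∈ wfil R wwt 1 :=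
  wfil_wone_le _ ((hL.shear hq).zb j k)

theorem shear_w_mem {Φ : Frame n R} {L : CRMap n R} (hL : L.NoCst) {q : PS n R} (hq : ShearFn q)
    (hw : ∀ k, L.w k + pderiv R (iz k) q - Φ.ellz k ∈ wfil R wwt 2) (k : Fin n) : (L.shear q).w k - Φ.ellz k ∈ wfil R wwt 2 := by
  have h1 : L.vf k (X iu + q) - Φ.ellz k ∈ wfil R wwt 2 := by
    have e : L.vf k (X iu + q) - Φ.ellz k = (L.w k + pderiv R (iz k) q - Φ.ellz k)
        + (L.vf k q - pderiv R (iz k) q) := by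
      rw [CRMap.vf_add, CRMap.vf_X_u]; ring
    rw [e]
    exact add_mem (hw k) (wfil_wone_le _ (hL.vf_sub_pderiv_mem k (ncl_iff.1 hq.ncl)))
  have h2 := hq.neg.subst_mem_wwt h1
  rw [subst_sub_of hq.neg.hasSubst, subst_ellz Φ hq.neg.hasSubst] at h2
  simpa [ell, CRMap.shear] using h2

/-- A normalization of a perturbation of the model is itself a perturbation of the model. -/
theorem fil_of_transf {L : CRMap n R} (hL : L.NoCst) (hw : ∀ k, L.w k - Φ.ellz k ∈ wfil R wwt 2)
    {v : Unknown n R} (hv : Φ.LinNormal v) (ht : L.Transf v.f v.g (Φ.perturb v)) : v.Fil 1 := by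
  have h1 : ∀ k, v.w k - pderiv R (iz k) v.g ∈ wfil R wwt 2 := fun k => by
    have h := add_mem (wfil_wone_le _ (ht.w_sub_mem hv.ncl_f hv.ncl_g hL k)) (hw k)
    have e : (Φ.perturb v).w k = Φ.ellz k + v.w k := rfl
    rw [e] at h
    convert h using 1
    ring
  -- Modulo weight three the radial part of w is ∑ z_k ∂g/∂z_k. Adding the conjugate and using
  -- skewness gives the Euler equation that removes the weight two terms of g.
  have h2 : ∑ k, v.w k * X (iz k) - ee v.g ∈ wfil R wwt 3 := by
    have e : ∑ k, v.w k * X (iz k) - ee v.g =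
        ∑ k, X (iz k) * (v.w k - pderiv R (iz k) v.g) := by
      simp only [ee_apply, mul_sub, Finset.sum_sub_distrib, mul_comm]
    rw [e]
    exact sum_mem fun k _ => wfil_X_mul _ (h1 k) (by rw [wwt_z]; norm_num)
  have h3 : v.g ∈ wfil R wwt 3 := by
    refine mem_wfil_three hv.ncl_g ?_
    have h4 := neg_mem (add_mem h2 (bar_mem_wfil h2))
    rw [map_sub, bar_ee, hv.real] at h4
    convert h4 using 1
    linear_combination hv.radial.skew
  refine ⟨fun j => (hv.ncl_f j).mem_wfil, h3,
    fun j k => wfil_wone_le _ ((ht.noCst hv.ncl_f hv.ncl_g hL).zb j k), fun k => ?_⟩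
  have := add_mem (h1 k) (wfil_pderiv' h3 (iz k) (k := 2) (by rw [wwt_z]; norm_num))
  rwa [sub_add_cancel] at this

variable [StarModule ℂ R]

/-- The radial part iQ of the model is purely of bidegree (1,1), skew and independent of u. The
model is therefore normalized, and normality of L' amounts to that of its deviation. -/
theorem radNormal_Q : Φ.RadNormal (Ic * Φ.Q) where
  skew := by rw [map_mul, bar_Ic, bar_Q]; ring
  one_one := by
    rw [cp_Ic_mul, pderiv_Ic_mul, ← mul_one Φ.Q, cp_Q_mul, pderiv_u_Q_mul, ← cp_one, cp_cp]
    norm_num [cp_one]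
  one a := by rw [cp_Ic_mul, cp_Q _ _ _ (by omega), mul_zero]
  trace_one := by rw [cp_Ic_mul, cp_Q _ _ _ (by omega), mul_zero, map_zero]
  trace_two := by rw [cp_Ic_mul, cp_Q _ _ _ (by omega), mul_zero, map_zero, map_zero]
  trace_three := by
    rw [cp_Ic_mul, cp_Q _ _ _ (by omega), mul_zero, map_zero, map_zero, map_zero]

theorem radNormal_perturb_iff (v : Unknown n R) :
    Φ.RadNormal (∑ k, (Φ.perturb v).w k * X (iz k)) ↔ Φ.RadNormal (∑ k, v.w k * X (iz k)) := by
  rw [sum_perturb_w]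
  have h := Φ.radNormal_Q
  constructor
  · intro h'
    simpa using RadNormal.sub Φ h' h
  · intro h'
    simpa using RadNormal.sub Φ h (RadNormal.sub Φ (RadNormal.sub Φ h h) h')

section Shear

variable {Φ} {L : CRMap n R} (hL : L.NoCst) {q : PS n R} (hq : ShearFn q)
  (hw : ∀ k, L.w k + pderiv R (iz k) q - Φ.ellz k ∈ wfil R wwt 2)

include hL hq hw

variable (hn : 1 ≤ n)

include hn

theorem exists_normalizing_of_shear {ρ : R} (hρ : star ρ = ρ) :
    ∃ f g L', Φ.Normalizing L ρ f g L' := by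
  obtain ⟨v, hv, hg, h1, ht⟩ := Φ.exists_perturb (shear_zb_mem hL hq)
    (shear_w_mem hL hq hw) hn hρ
  refine ⟨_, _, Φ.perturb v, fun j => hq.subst_ncl (hv.ncl_f j), fun α hα => ?_, ?_, ?_,
    (CRMap.transf_shear_iff hq hv.ncl_f hv.ncl_g).2 ht, hv.tangential,
    (Φ.radNormal_perturb_iff v).2 hv.radial⟩
  · rw [map_add, hq.subst_ncl hv.ncl_g α hα, hq.ncl α hα, add_zero]
  · rw [map_add, hq.bar_subst, hv.real, hq.real]
  · rw [map_add, hq.coeff_subst_u, hq.coeff_u, add_zero, hg]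

end Shear

variable {Φ}

/-- Undoing the shear turns any normalization of L into a normalization of the sheared structure;
together with `fil_of_transf` this extends uniqueness to all candidates. -/
theorem Normalizing.exists_unknown {L : CRMap n R} {q : PS n R} (hq : ShearFn q) {ρ : R}
    {f : Fin n → PS n R} {g : PS n R} {L' : CRMap n R} (h : Φ.Normalizing L ρ f g L') :
    ∃ v : Unknown n R, Φ.LinNormal v ∧ coeff (Finsupp.single iu 2) v.g = ρ ∧
      (L.shear q).Transf v.f v.g (Φ.perturb v) ∧ (f = fun j => subst (shr q) (v.f j)) ∧
      g = subst (shr q) v.g + q ∧ L' = Φ.perturb v := by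
  have hs := hq.neg.hasSubst
  let v : Unknown n R := ⟨fun j => subst (shr (-q)) (f j), subst (shr (-q)) (g - q), L'.zb,
    fun k => L'.w k - Φ.ellz k⟩
  have hL' : L' = Φ.perturb v := by
    ext1
    · rfl
    · funext k
      change L'.w k = Φ.ellz k + (L'.w k - Φ.ellz k)
      ring
  have e1 : f = fun j => subst (shr q) (v.f j) := funext fun j => (hq.subst_neg_subst _).symm
  have e2 : g = subst (shr q) v.g + q := by
    change g = subst (shr q) (subst (shr (-q)) (g - q)) + q
    rw [hq.subst_neg_subst, sub_add_cancel]
  have hvf : ∀ j, NCL (v.f j) := fun j => hq.neg.subst_ncl (h.ncl_f j)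
  have hvg : NCL v.g := hq.neg.subst_ncl (h.ncl_g.sub hq.ncl)
  refine ⟨v, ⟨hvf, hvg, ?_, h.tangential, ?_⟩, ?_, ?_, e1, e2, hL'⟩
  · change bar (subst (shr (-q)) (g - q)) = _
    rw [hq.neg.bar_subst, map_sub, h.real, hq.real]
  · rw [← radNormal_perturb_iff, ← hL']
    exact h.radial
  · change coeff _ (subst (shr (-q)) (g - q)) = ρ
    rw [hq.neg.coeff_subst_u, map_sub, hq.coeff_u, sub_zero, h.coeff_g]
  · rw [← CRMap.transf_shear_iff hq hvf hvg, ← e1, ← e2, ← hL']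
    exact h.transf

variable (Φ)

/-- Existence of the normalization. -/
theorem exists_normalizing (hn : 1 ≤ n) {L : CRMap n R} (hL : L.NoCst) (hΦ : Φ.Compat L) {ρ : R}
    (hρ : star ρ = ρ) : ∃ f g L', Φ.Normalizing L ρ f g L' := by
  obtain ⟨q, hq, hw⟩ := Φ.exists_shearFn hL hΦ
  exact exists_normalizing_of_shear hL hq hw hn hρ

/-- Uniqueness of the normalization. -/
theorem normalizing_unique (hn : 1 ≤ n) {L : CRMap n R} (hL : L.NoCst) (hΦ : Φ.Compat L) {ρ : R}
    {f f' : Fin n → PS n R} {g g' : PS n R} {L' L'' : CRMap n R} (h : Φ.Normalizing L ρ f g L')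
    (h' : Φ.Normalizing L ρ f' g' L'') : f = f' ∧ g = g' ∧ L' = L'' := by
  obtain ⟨q, hq, hw⟩ := Φ.exists_shearFn hL hΦ
  obtain ⟨v, hv, hc, ht, rfl, rfl, rfl⟩ := h.exists_unknown hq
  obtain ⟨v', hv', hc', ht', rfl, rfl, rfl⟩ := h'.exists_unknown hq
  have hw' := shear_w_mem hL hq hw
  have e := Φ.perturb_unique (shear_zb_mem hL hq) hw' hn
    (Φ.fil_of_transf (hL.shear hq) hw' hv ht) (Φ.fil_of_transf (hL.shear hq) hw' hv' ht')
    hv hv' (by rw [hc, hc']) ht ht'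
  rw [e]
  exact ⟨rfl, rfl, rfl⟩

end Frame

end FormalCR

/-! ### The forms at 0 and strong nondegeneracy over ℂ -/

namespace FormalCR

open MvPowerSeries

section Coefficients

variable {n : ℕ} {R : Type*} [CommRing R]

theorem CRMap.NoCst.constantCoeff_vf {L : CRMap n R} (hL : L.NoCst) (k : Fin n) (p : PS n R) :
    constantCoeff (L.vf k p) = coeff (Finsupp.single (iz k) 1) p := by
  have h1 : ∀ i, constantCoeff (L.zb i k) = 0 :=
    fun i => (mem_wfil_one_iff one_le_wone).1 (hL.zb i k)
  have h2 : constantCoeff (L.w k) = 0 := (mem_wfil_one_iff one_le_wone).1 (hL.w k)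
  rw [CRMap.vf, map_add, map_add, map_sum]
  simp only [map_mul, h1, h2, zero_mul, Finset.sum_const_zero, add_zero]
  rw [← coeff_zero_eq_constantCoeff_apply, coeff_pderiv]
  simp

variable [StarRing R]

theorem star_coeff_single_zb (j : Fin n) (p : PS n R) :
    star (coeff (Finsupp.single (izb j) 1) p) = coeff (Finsupp.single (iz j) 1) (bar p) := by
  rw [coeff_bar, swapIdx_single]
  rfl

variable [Algebra ℂ R]

/-- The linear part of L^w changes by second derivatives of g at 0. They are hermitian in (z, z̄),
because g is real, and symmetric in (z, z), so they drop out of both forms. -/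
theorem Frame.Compat.transf {Φ : Frame n R} {L L' : CRMap n R} {f : Fin n → PS n R} {g : PS n R}
    (hΦ : Φ.Compat L) (hL : L.NoCst) (hf : ∀ j, NCL (f j)) (hg : NCL g) (hr : bar g = g)
    (ht : L.Transf f g L') : Φ.Compat L' := by
  have key : ∀ (k : Fin n) (i : Var n), coeff (Finsupp.single i 1) (L'.w k) =
      coeff (Finsupp.single i 1) (L.w k) + coeff (Finsupp.single i 1) (pderiv R (iz k) g) := by
    intro k i
    have h := ht.w_sub_mem hf hg hL k (Finsupp.single i 1) (by
      rw [weight_wone, Finsupp.degree_single]; norm_num)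
    rw [map_sub, map_sub] at h
    linear_combination h
  have h1 : ∀ j k, star (coeff (Finsupp.single (izb k) 1) (pderiv R (iz j) g)) =
      coeff (Finsupp.single (izb j) 1) (pderiv R (iz k) g) := fun j k => by
    rw [star_coeff_single_zb, bar_pderiv_z, hr, coeff_pderiv, coeff_pderiv, add_comm]
    simp
  have h2 : ∀ j k, coeff (Finsupp.single (iz k) 1) (pderiv R (iz j) g) =
      coeff (Finsupp.single (iz j) 1) (pderiv R (iz k) g) := fun j k => by
    rw [coeff_pderiv, coeff_pderiv, add_comm]
    by_cases h : j = k
    · subst h; rfl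
    · simp [h, Ne.symm h]
  refine ⟨fun j k => ?_, fun j k => ?_⟩
  · rw [hΦ.c_eq, key, key, star_add, h1, add_sub_add_right_eq_sub]
  · rw [hΦ.nn_eq, key, key, h2, add_sub_add_right_eq_sub]

end Coefficients

namespace FormalMap

variable {n : ℕ}

/-- The components of a formal map. -/
def toCR (L : FormalMap n) : CRMap n ℂ := ⟨L.zb, L.w⟩

theorem X_eq_vf (L : FormalMap n) (k : Fin n) (p : FPS n) : L.X k p = L.toCR.vf k p := rfl

theorem conj_eq_bar (p : FPS n) : conj p = bar p := rfl

theorem NoConst.noCst {L : FormalMap n} (hL : L.NoConst) : L.toCR.NoCst :=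
  ⟨fun j k => (mem_wfil_one_iff one_le_wone).2 (hL.1 j k),
    fun k => (mem_wfil_one_iff one_le_wone).2 (hL.2 k)⟩

theorem coordChange_eq_chg (f : Fin n → FPS n) (g : FPS n) : coordChange f g = chg f g := by
  funext i
  rcases i with j | j | j <;> rfl

theorem transforms_iff (L : FormalMap n) (f : Fin n → FPS n) (g : FPS n) (L' : FormalMap n) :
    L.Transforms f g L' ↔ L.toCR.Transf f g L'.toCR := by
  rw [Transforms, coordChange_eq_chg]
  rfl

theorem levi_apply {L : FormalMap n} (hL : L.toCR.NoCst) (j k : Fin n) :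
    L.levi j k = 1 / (2 * Complex.I) * (coeff (Finsupp.single (izb j) 1) (L.w k)
      - star (coeff (Finsupp.single (izb k) 1) (L.w j))) := by
  have h1 : ∀ j (p : FPS n), constantCoeff (L.Xbar j p) =
      coeff (Finsupp.single (izb j) 1) p := fun j p => by
    change constantCoeff (bar (L.toCR.vf j (bar p))) = _
    rw [← coeff_zero_eq_constantCoeff_apply, coeff_bar,
      show swapIdx (0 : MIdx n) = 0 by ext i; simp [swapIdx_apply],
      coeff_zero_eq_constantCoeff_apply, hL.constantCoeff_vf, ← star_coeff_single_zb, star_star]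
  have h2 : L.Xbar j (MvPowerSeries.X iu) = bar (L.w j) := by
    change bar (L.toCR.vf j (bar (MvPowerSeries.X iu))) = _
    rw [bar_X_u, CRMap.vf_X_u]
    rfl
  rw [levi, Matrix.of_apply, map_sub, h1, h2, X_eq_vf, X_eq_vf, CRMap.vf_X_u, hL.constantCoeff_vf,
    star_coeff_single_zb]
  rfl

theorem nonint_apply {L : FormalMap n} (hL : L.toCR.NoCst) (j k : Fin n) :
    L.nonint j k = coeff (Finsupp.single (iz j) 1) (L.w k)
      - coeff (Finsupp.single (iz k) 1) (L.w j) := by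
  simp only [nonint, Matrix.of_apply, map_sub, X_eq_vf, CRMap.vf_X_u, hL.constantCoeff_vf]
  rfl

theorem star_levi {L : FormalMap n} (hL : L.toCR.NoCst) (j k : Fin n) :
    star (L.levi j k) = L.levi k j := by
  rw [levi_apply hL, levi_apply hL]
  simp only [star_mul', star_sub, star_star]
  have : star (1 / (2 * Complex.I)) = -(1 / (2 * Complex.I)) := by
    simp
  rw [this]
  ring

theorem nonint_anti {L : FormalMap n} (hL : L.toCR.NoCst) (j k : Fin n) :
    L.nonint j k = -L.nonint k j := by
  rw [nonint_apply hL, nonint_apply hL]; ring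

theorem StronglyNondegenerate.det_levi_ne {L : FormalMap n} (h : L.StronglyNondegenerate) :
    L.levi.det ≠ 0 := by
  intro h0
  obtain ⟨v, hv, hv0⟩ := Matrix.exists_vecMul_eq_zero_iff.2 h0
  have h1 := h.1 (fun j => star (v j)) fun η => by
    have h2 := fun k => congrFun hv0 k
    simp only [Matrix.vecMul, dotProduct, Pi.zero_apply] at h2
    simp only [leviForm, starRingEnd_apply, star_star]
    rw [Finset.sum_comm]
    refine Finset.sum_eq_zero fun k _ => ?_
    rw [← Finset.sum_mul]
    simp only [mul_comm (L.levi _ _), h2, zero_mul]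
  exact hv (funext fun j => star_eq_zero.1 (congrFun h1 j))

/-- If (x, y) is in the kernel over ℂ, so is its image (ȳ, x̄) under the real structure. Hence ξ = x
+ ȳ and ξ = i(x − ȳ) both satisfy the real-linear equation and vanish, which gives x = y = 0. -/
theorem StronglyNondegenerate.det_strongMatrix_ne {L : FormalMap n}
    (h : L.StronglyNondegenerate) : L.strongMatrix.det ≠ 0 := by
  intro h0
  obtain ⟨v, hv, hv0⟩ := Matrix.exists_vecMul_eq_zero_iff.2 h0
  let x : Fin n → ℂ := fun j => v (Sum.inl j)
  let y : Fin n → ℂ := fun j => v (Sum.inr j)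
  have e1 : ∀ k, ∑ j, x j * L.nonint j k + ∑ j, y j * (6 * Complex.I * L.levi j k) = 0 :=
    fun k => by
      have := congrFun hv0 (Sum.inl k)
      simpa [Matrix.vecMul, dotProduct, Fintype.sum_sum_type, strongMatrix] using this
  have e2 : ∀ k, ∑ j, star (x j) * (6 * Complex.I * L.levi j k)
      + ∑ j, star (y j) * L.nonint j k = 0 := fun k => by
    have := congrArg star (congrFun hv0 (Sum.inr k))
    simpa [Matrix.vecMul, dotProduct, Fintype.sum_sum_type, strongMatrix] using this
  have key : ∀ ξ : Fin n → ℂ, (∀ k, ∑ j, ξ j * L.nonint j k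
      + ∑ j, star (ξ j) * (6 * Complex.I * L.levi j k) = 0) → ξ = 0 := fun ξ hξ => by
    refine h.2 ξ fun η => ?_
    simp only [leviForm, nonintForm]
    rw [Finset.sum_comm, Finset.sum_comm (f := fun j k => L.nonint j k * ξ j * η k),
      Finset.mul_sum, ← Finset.sum_add_distrib]
    refine Finset.sum_eq_zero fun k _ => ?_
    have := congrArg (· * η k) (hξ k)
    simp only [zero_mul] at this
    rw [← this, add_mul, Finset.sum_mul, Finset.sum_mul, Finset.mul_sum, add_comm]
    congr 1
    · exact Finset.sum_congr rfl fun j _ => by ring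
    · exact Finset.sum_congr rfl fun j _ => by rw [starRingEnd_apply]; ring
  have k1 := key (fun j => x j + star (y j)) fun k => by
    simp only [star_add, star_star, add_mul, Finset.sum_add_distrib]
    linear_combination e1 k + e2 k
  have k2 := key (fun j => Complex.I * (x j - star (y j))) fun k => by
    have a1 := e1 k
    have a2 := e2 k
    have hI : star Complex.I = -Complex.I := Complex.conj_I
    simp only [star_mul', star_sub, star_star, hI, mul_sub, sub_mul, Finset.sum_sub_distrib]
    simp only [mul_assoc, ← Finset.mul_sum, neg_mul, Finset.sum_neg_distrib] at a1 a2 ⊢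
    linear_combination Complex.I * a1 - Complex.I * a2
  have hx : ∀ j, x j = 0 ∧ y j = 0 := fun j => by
    have b1 := congrFun k1 j
    have b2 := congrFun k2 j
    simp only [Pi.zero_apply, mul_eq_zero, Complex.I_ne_zero, false_or] at b1 b2
    have hx : x j = 0 := by linear_combination (1 / 2) * b1 + (1 / 2) * b2
    have hy : star (y j) = 0 := by linear_combination (1 / 2) * b1 - (1 / 2) * b2
    exact ⟨hx, star_eq_zero.1 hy⟩
  refine hv (funext fun i => ?_)
  rcases i with j | j
  · exact (hx j).1
  · exact (hx j).2

/-- The frame of a strongly nondegenerate formal map. -/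
def frame (L : FormalMap n) (hL : L.NoConst) (h : L.StronglyNondegenerate) : Frame n ℂ where
  c := L.levi
  nn := L.nonint
  cinv := L.levi⁻¹
  star_c := star_levi hL.noCst
  nn_anti := nonint_anti hL.noCst
  c_mul_cinv := Matrix.mul_nonsing_inv _ (isUnit_iff_ne_zero.2 h.det_levi_ne)
  strong := isUnit_iff_ne_zero.2 h.det_strongMatrix_ne

theorem frame_compat (L : FormalMap n) (hL : L.NoConst) (h : L.StronglyNondegenerate) :
    (L.frame hL h).Compat L.toCR :=
  ⟨levi_apply hL.noCst, nonint_apply hL.noCst⟩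

theorem det_levi_real {L : FormalMap n} (hL : L.NoConst) : star L.levi.det = L.levi.det := by
  rw [← Matrix.det_conjTranspose]
  congr 1
  ext j k
  exact star_levi hL.noCst k j

/-- Conjugating the matrix amounts to exchanging its two blocks of rows and of columns
simultaneously. -/
theorem det_strongMatrix_real (L : FormalMap n) :
    star L.strongMatrix.det = L.strongMatrix.det := by
  have h1 : star L.strongMatrix.det = (L.strongMatrix.map (starRingEnd ℂ)).det :=
    (starRingEnd ℂ).map_det L.strongMatrix
  rw [h1, ← Matrix.det_reindex_self (Equiv.sumComm (Fin n) (Fin n))]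
  have h6 : (starRingEnd ℂ) 6 = 6 := map_ofNat _ _
  congr 1
  ext i j
  rcases i with i | i <;> rcases j with j | j <;> simp [strongMatrix, h6]

end FormalMap

end FormalCR

/-! ### Translation of the derivative conditions into conditions on bidegree components -/

namespace FormalCR

open MvPowerSeries

/-- The degree in `u`. -/
def wu {n : ℕ} : Var n → ℤ := Sum.elim 0 (Sum.elim 0 1)

theorem weight_wu {n : ℕ} (α : MIdx n) : Finsupp.weight (R := ℕ) wu α = (α iu : ℤ) := by
  rw [Finsupp.weight_eq_sum, Fintype.sum_sum_type, Fintype.sum_sum_type]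
  simp [wu]

section

variable {n : ℕ} {R : Type*} [CommRing R]

theorem eq_zero_iff_comp_wu {p : PS n R} : (∀ c : ℕ, comp wu (c : ℤ) p = 0) ↔ p = 0 := by
  refine ⟨fun h => ?_, fun h c => by rw [h, map_zero]⟩
  ext α
  have := congrArg (coeff α) (h (α iu))
  rwa [coeff_comp, weight_wu, if_pos rfl] at this

theorem comp_wu_pderiv_u (c : ℤ) (p : PS n R) :
    comp wu c (pderiv R iu p) = pderiv R iu (comp wu (c + 1) p) := comp_pderiv _ _ _ _

theorem pderiv_u_eq_zero_iff [Algebra ℂ R] {p : PS n R} :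
    (∀ c : ℕ, comp wu ((c + 1 : ℕ) : ℤ) p = 0) ↔ pderiv R iu p = 0 := by
  constructor
  · intro h
    rw [← eq_zero_iff_comp_wu]
    intro c
    have := h c
    push_cast at this
    rw [comp_wu_pderiv_u, this, map_zero]
  · intro h c
    ext α
    rw [coeff_comp, weight_wu, coeff_zero]
    split_ifs with h1
    · have hle : Finsupp.single iu 1 ≤ α := Finsupp.single_le_iff.2 (by omega)
      obtain ⟨β, rfl⟩ := exists_add_of_le hle
      have h2 := congrArg (coeff β) h
      rw [coeff_pderiv, coeff_zero, add_comm β] at h2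
      have h3 : (algebraMap ℂ R) (((β iu : ℂ) + 1)⁻¹) * ((β iu : R) + 1) = 1 := by
        rw [← map_natCast (algebraMap ℂ R), ← map_one (algebraMap ℂ R), ← map_add, ← map_mul,
          inv_mul_cancel₀ (by exact_mod_cast (β iu).succ_ne_zero)]
      linear_combination (algebraMap ℂ R) (((β iu : ℂ) + 1)⁻¹) * h2
        - coeff (Finsupp.single iu 1 + β) p * h3
    · rfl

theorem Frame.comp_wu_tr [StarRing R] [Algebra ℂ R] (Φ : Frame n R) (c : ℤ) (p : PS n R) :
    comp wu c (Φ.tr p) = Φ.tr (comp wu c p) := by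
  simp only [tr_apply, map_sum, comp_C_mul, comp_pderiv]
  simp [wu]

theorem comp_wu_bar [StarRing R] (c : ℤ) (p : PS n R) :
    comp wu c (bar p) = bar (comp wu c p) := by
  ext α
  have : swapIdx α iu = α iu := by rw [swapIdx_apply]; rfl
  simp only [coeff_comp, coeff_bar, weight_wu, this]
  split_ifs <;> simp

end

section DerPart

variable {n : ℕ}

/-- The factor `a! b! c!`. -/
def facABC (a b c : ℕ) : ℂ := (a.factorial : ℂ) * b.factorial * c.factorial

theorem facABC_ne_zero (a b c : ℕ) : facABC a b c ≠ 0 := by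
  simp [facABC, Nat.factorial_ne_zero]

theorem C_mul_eq_zero_iff {x : ℂ} (hx : x ≠ 0) {p : FPS n} : C x * p = 0 ↔ p = 0 := by
  rw [← smul_eq_C_mul, smul_eq_zero, or_iff_right hx]

theorem derPart_eq (a b c : ℕ) (p : FPS n) :
    derPart a b c p = C (facABC a b c) * comp wu (c : ℤ) (cp (a : ℤ) (b : ℤ) p) := by
  ext α
  rw [coeff_C_mul, coeff_comp, weight_wu, coeff_cp]
  change (if _ then _ else _) = _
  simp only [Nat.cast_inj, facABC]
  split_ifs <;> simp_all

theorem derPart_eq_zero_iff (a b c : ℕ) (p : FPS n) :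
    derPart a b c p = 0 ↔ comp wu (c : ℤ) (cp (a : ℤ) (b : ℤ) p) = 0 := by
  rw [derPart_eq, C_mul_eq_zero_iff (facABC_ne_zero _ _ _)]

theorem eq_zero_iff_cp {p : FPS n} : (∀ a b c : ℕ, derPart a b c p = 0) ↔ p = 0 := by
  simp only [derPart_eq_zero_iff, eq_zero_iff_comp_wu]
  exact ⟨fun h => cp_ext fun a b => by rw [h, map_zero], fun h a b => by rw [h, map_zero]⟩

theorem Frame.tr_C_mul {R : Type*} [CommRing R] [StarRing R] [Algebra ℂ R] (Φ : Frame n R) (x : R)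
    (p : PS n R) : Φ.tr (C x * p) = C x * Φ.tr p := by
  rw [← smul_eq_C_mul, map_smul, smul_eq_C_mul]

namespace FormalMap

variable {L : FormalMap n} {Φ : Frame n ℂ}

theorem tr_eq (hΦ : Φ.cinv = L.levi⁻¹) (p : FPS n) : L.tr p = Φ.tr p := by
  rw [Frame.tr_apply, tr, hΦ]
  simp only [smul_eq_C_mul]

/-- Conditions for all c combine into one condition on the component of fixed bidegree: the
factorials are units and the trace preserves the degree in u. Excluding c = 0 in bidegree (1,1)
corresponds to the u-derivative. -/
theorem isNormal_iff (hΦ : Φ.cinv = L.levi⁻¹) : L.IsNormal ↔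
    (∀ j, ∑ k, L.toCR.zb j k * MvPowerSeries.X (iz k) = 0) ∧
      Φ.RadNormal (∑ k, L.toCR.w k * MvPowerSeries.X (iz k)) := by
  have e1 : ∀ j, ∑ k, L.toCR.zb j k * MvPowerSeries.X (iz k) = L.radialZb j := fun j => rfl
  have e2 : ∑ k, L.toCR.w k * MvPowerSeries.X (iz k) = L.radialW := rfl
  simp only [e1, e2]
  have hb : ∀ a b c : ℕ, derPart a b c L.radialW + conj (derPart b a c L.radialW) =
      derPart a b c (L.radialW + bar L.radialW) := fun a b c => by
    have hf : star (facABC b a c) = facABC a b c := by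
      simp only [facABC, star_mul', star_natCast]; ring
    rw [derPart_eq, derPart_eq, derPart_eq, conj_eq_bar, map_mul, bar_C, hf, ← comp_wu_bar,
      ← cp_bar, map_add, map_add, mul_add]
  have h1 : (∀ a b c : ℕ, ∀ j, derPart a b c (L.radialZb j) = 0) ↔ ∀ j, L.radialZb j = 0 :=
    ⟨fun h j => eq_zero_iff_cp.1 fun a b c => h a b c j,
      fun h a b c j => eq_zero_iff_cp.2 (h j) a b c⟩
  have h2 : (∀ a b c : ℕ, derPart a b c L.radialW + conj (derPart b a c L.radialW) = 0) ↔
      L.radialW + bar L.radialW = 0 := by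
    simp only [hb, eq_zero_iff_cp]
  have h3 : (∀ c : ℕ, derPart 1 1 (c + 1) L.radialW = 0) ↔
      pderiv ℂ iu (cp 1 1 L.radialW) = 0 := by
    rw [← pderiv_u_eq_zero_iff]
    exact forall_congr' fun c => derPart_eq_zero_iff 1 1 (c + 1) _
  have h4 : (∀ a c : ℕ, derPart (a + 2) 1 c L.radialW = 0) ↔
      ∀ a : ℕ, cp (a + 2) 1 L.radialW = 0 := by
    refine forall_congr' fun a => ?_
    rw [← eq_zero_iff_comp_wu]
    refine forall_congr' fun c => ?_
    rw [derPart_eq_zero_iff]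
    push_cast
    rfl
  have h5 : (∀ c : ℕ, L.tr (derPart 2 2 c L.radialW) = 0) ↔ Φ.tr (cp 2 2 L.radialW) = 0 := by
    rw [← eq_zero_iff_comp_wu]
    refine forall_congr' fun c => ?_
    rw [tr_eq hΦ, derPart_eq, Φ.tr_C_mul, C_mul_eq_zero_iff (facABC_ne_zero _ _ _), Φ.comp_wu_tr]
    rfl
  have h6 : (∀ c : ℕ, L.tr (L.tr (derPart 3 2 c L.radialW)) = 0) ↔
      Φ.tr (Φ.tr (cp 3 2 L.radialW)) = 0 := by
    rw [← eq_zero_iff_comp_wu]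
    refine forall_congr' fun c => ?_
    simp only [tr_eq hΦ, derPart_eq, Φ.tr_C_mul, C_mul_eq_zero_iff (facABC_ne_zero _ _ _),
      Φ.comp_wu_tr]
    rfl
  have h7 : (∀ c : ℕ, L.tr (L.tr (L.tr (derPart 3 3 c L.radialW))) = 0) ↔
      Φ.tr (Φ.tr (Φ.tr (cp 3 3 L.radialW))) = 0 := by
    rw [← eq_zero_iff_comp_wu]
    refine forall_congr' fun c => ?_
    simp only [tr_eq hΦ, derPart_eq, Φ.tr_C_mul, C_mul_eq_zero_iff (facABC_ne_zero _ _ _),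
      Φ.comp_wu_tr]
    rfl
  constructor
  · intro h
    exact ⟨h1.1 h.tangential, h2.1 h.reality, h3.1 h.deg_one_one, h4.1 h.deg_one, h5.1 h.trace_one,
      h6.1 h.trace_two, h7.1 h.trace_three⟩
  · rintro ⟨ht, hT⟩
    exact ⟨h1.2 ht, h2.2 hT.skew, h3.2 hT.one_one, h4.2 hT.one, h5.2 hT.trace_one,
      h6.2 hT.trace_two, h7.2 hT.trace_three⟩

end FormalMap

/-- The factor `α!`. -/
def facIdx (α : MIdx n) : ℂ := ∏ i, ((α i).factorial : ℂ)

theorem facIdx_ne_zero (α : MIdx n) : facIdx α ≠ 0 :=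
  Finset.prod_ne_zero_iff.2 fun _ _ => Nat.cast_ne_zero.2 (Nat.factorial_ne_zero _)

theorem deriv0_eq (α : MIdx n) (p : FPS n) : deriv0 α p = facIdx α * coeff α p := rfl

theorem deriv0_u_two (p : FPS n) (x : ℂ) :
    deriv0 (Finsupp.single iu 2) p = x ↔ coeff (Finsupp.single iu 2) p = x / 2 := by
  have : facIdx (Finsupp.single (iu : Var n) 2) = 2 := by
    rw [facIdx, Fintype.prod_sum_type, Fintype.prod_sum_type]
    simp
  rw [deriv0_eq, this, eq_div_iff two_ne_zero, mul_comm]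

namespace FormalMap

theorem normalizes_iff {L : FormalMap n} (hL : L.NoConst) (h : L.StronglyNondegenerate) (r : ℝ)
    (f : Fin n → FPS n) (g : FPS n) (L' : FormalMap n) : L.Normalizes r f g L' ↔
      (L.frame hL h).Normalizing L.toCR ((r : ℂ) / 2) f g L'.toCR := by
  -- The traces in the normalization are those of L', the frame is that of L; they agree because the
  -- transformation preserves the Levi form at 0.
  have key : (∀ j, NCL (f j)) → NCL g → bar g = g → L.Transforms f g L' →
      (L.frame hL h).cinv = L'.levi⁻¹ := fun hf hg hr ht => by
    rw [transforms_iff] at ht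
    have hc := (L.frame_compat hL h).transf hL.noCst hf hg hr ht
    change L.levi⁻¹ = _
    congr 1
    ext j k
    rw [levi_apply (ht.noCst hf hg hL.noCst)]
    exact hc.c_eq j k
  constructor
  · intro hN
    obtain ⟨h1, h2⟩ := (isNormal_iff (key hN.noConstLin_f hN.noConstLin_g hN.real_g
      hN.transforms)).1 hN.normal
    exact ⟨hN.noConstLin_f, hN.noConstLin_g, hN.real_g, (deriv0_u_two _ _).1 hN.second_g,
      (transforms_iff _ _ _ _).1 hN.transforms, h1, h2⟩
  · intro hN
    have ht := (transforms_iff _ _ _ _).2 hN.transf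
    exact ⟨hN.ncl_f, hN.ncl_g, hN.real, (deriv0_u_two _ _).2 hN.coeff_g, ht,
      (isNormal_iff (key hN.ncl_f hN.ncl_g hN.real ht)).2 ⟨hN.tangential, hN.radial⟩⟩

theorem toCR_surjective (M : CRMap n ℂ) : ∃ L : FormalMap n, L.toCR = M := ⟨⟨M.zb, M.w⟩, rfl⟩

theorem existsUnique_normalizes (hn : 1 ≤ n) {L : FormalMap n} (hL : L.NoConst)
    (h : L.StronglyNondegenerate) (r : ℝ) :
    ∃! fg : (Fin n → FPS n) × FPS n, ∃ L', L.Normalizes r fg.1 fg.2 L' := by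
  have hc := L.frame_compat hL h
  obtain ⟨f, g, M, hM⟩ := (L.frame hL h).exists_normalizing hn hL.noCst hc (ρ := (r : ℂ) / 2)
    (by simp)
  obtain ⟨L', rfl⟩ := toCR_surjective M
  refine ⟨(f, g), ⟨L', (normalizes_iff hL h r _ _ _).2 hM⟩, ?_⟩
  rintro ⟨f', g'⟩ ⟨L'', hN⟩
  obtain ⟨rfl, rfl, -⟩ := (L.frame hL h).normalizing_unique hn hL.noCst hc
    ((normalizes_iff hL h r _ _ _).1 hN) hM
  rfl

end FormalMap

end DerPart

end FormalCR

/-! ### Change of coefficients and the universal normalization -/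

namespace FormalCR

open MvPowerSeries

section Map

variable {n : ℕ} {R S : Type*} [CommRing R] [CommRing S]

/-- Change of the coefficients of a formal map. -/
def CRMap.map (φ : R →+* S) (L : CRMap n R) : CRMap n S :=
  ⟨fun j k => MvPowerSeries.map φ (L.zb j k), fun k => MvPowerSeries.map φ (L.w k)⟩

theorem map_pderiv (φ : R →+* S) (i : Var n) (p : PS n R) :
    MvPowerSeries.map φ (pderiv R i p) = pderiv S i (MvPowerSeries.map φ p) := by
  ext α
  simp [coeff_pderiv]

theorem map_cp (φ : R →+* S) (a b : ℤ) (p : PS n R) :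
    MvPowerSeries.map φ (cp a b p) = cp a b (MvPowerSeries.map φ p) := by
  ext α
  simp only [coeff_map, coeff_cp]
  split_ifs <;> simp

theorem CRMap.map_vf (φ : R →+* S) (L : CRMap n R) (k : Fin n) (p : PS n R) :
    MvPowerSeries.map φ (L.vf k p) = (L.map φ).vf k (MvPowerSeries.map φ p) := by
  simp only [vf, map, map_add, map_sum, map_mul, map_pderiv]

theorem NCL.map (φ : R →+* S) {p : PS n R} (hp : NCL p) : NCL (MvPowerSeries.map φ p) :=
  fun α hα => by rw [coeff_map, hp α hα, map_zero]

variable [StarRing R] [StarRing S]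

section

variable {φ : R →+* S} (hφ : ∀ x, φ (star x) = star (φ x))

include hφ

theorem map_bar (p : PS n R) : MvPowerSeries.map φ (bar p) = bar (MvPowerSeries.map φ p) := by
  ext α
  simp only [coeff_map, coeff_bar, hφ]

theorem map_chg (f : Fin n → PS n R) (g : PS n R) (i : Var n) :
    MvPowerSeries.map φ (chg f g i) =
      chg (fun j => MvPowerSeries.map φ (f j)) (MvPowerSeries.map φ g) i := by
  rcases i with j | j | j
  · rw [chg_z, chg_z, map_add, map_X]
  · rw [chg_zb, chg_zb, map_add, map_X, map_bar hφ]
  · change MvPowerSeries.map φ (X iu + g) = X iu + MvPowerSeries.map φ g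
    rw [map_add, map_X]

theorem CRMap.Transf.map {L L' : CRMap n R} {f : Fin n → PS n R} {g : PS n R}
    (hf : ∀ j, NCL (f j)) (hg : NCL g) (h : L.Transf f g L') :
    (L.map φ).Transf (fun j => MvPowerSeries.map φ (f j)) (MvPowerSeries.map φ g)
      (L'.map φ) := by
  have hs : ∀ p : PS n R, subst (chg (fun j => MvPowerSeries.map φ (f j)) (MvPowerSeries.map φ g))
      (MvPowerSeries.map φ p) = MvPowerSeries.map φ (subst (chg f g) p) := fun p => by
    rw [map_subst (hasSubst_chg hf hg)]
    congr 1
    exact funext fun i => (map_chg hφ f g i).symm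
  constructor
  · intro k
    have := congrArg (MvPowerSeries.map φ) (h.1 k)
    rw [map_sum] at this
    simp only [map_mul, map_vf, map_chg hφ, ← hs] at this
    exact this
  · intro j k
    have := congrArg (MvPowerSeries.map φ) (h.2 j k)
    rw [map_sum] at this
    simp only [map_mul, map_vf, map_chg hφ, ← hs] at this
    exact this

variable [Algebra ℂ R] [Algebra ℂ S] {Φ : Frame n R} {Ψ : Frame n S}
  (hΦ : ∀ j k, Ψ.c j k = φ (Φ.c j k))

include hΦ

omit hφ in
theorem Frame.cinv_map (j k : Fin n) : Ψ.cinv j k = φ (Φ.cinv j k) := by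
  have hc : Ψ.c = Φ.c.map φ := Matrix.ext hΦ
  have h1 : Ψ.c * Φ.cinv.map φ = 1 := by
    rw [hc, ← Matrix.map_mul, Φ.c_mul_cinv]
    exact Matrix.map_one _ (map_zero φ) (map_one φ)
  have h2 : Ψ.cinv = Φ.cinv.map φ := by
    rw [← Matrix.mul_one Ψ.cinv, ← h1, ← Matrix.mul_assoc, Ψ.cinv_mul_c, Matrix.one_mul]
  rw [h2, Matrix.map_apply]

omit hφ in
theorem Frame.map_tr (p : PS n R) :
    MvPowerSeries.map φ (Φ.tr p) = Ψ.tr (MvPowerSeries.map φ p) := by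
  simp only [tr_apply, map_sum, map_mul, map_C, map_pderiv, cinv_map hΦ]

theorem Frame.RadNormal.map {T : PS n R} (h : Φ.RadNormal T) :
    Ψ.RadNormal (MvPowerSeries.map φ T) where
  skew := by rw [← map_bar hφ, ← map_add, h.skew, map_zero]
  one_one := by rw [← map_cp, ← map_pderiv, h.one_one, map_zero]
  one a := by rw [← map_cp, h.one, map_zero]
  trace_one := by rw [← map_cp, ← map_tr hΦ, h.trace_one, map_zero]
  trace_two := by rw [← map_cp, ← map_tr hΦ, ← map_tr hΦ, h.trace_two, map_zero]
  trace_three := by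
    rw [← map_cp, ← map_tr hΦ, ← map_tr hΦ, ← map_tr hΦ, h.trace_three, map_zero]

/-- Normalizations are preserved by changes of the coefficients. -/
theorem Frame.Normalizing.map {L L' : CRMap n R} {ρ : R} {f : Fin n → PS n R} {g : PS n R}
    (h : Φ.Normalizing L ρ f g L') : Ψ.Normalizing (L.map φ) (φ ρ)
      (fun j => MvPowerSeries.map φ (f j)) (MvPowerSeries.map φ g) (L'.map φ) where
  ncl_f j := (h.ncl_f j).map φ
  ncl_g := h.ncl_g.map φ
  real := by rw [← map_bar hφ, h.real]
  coeff_g := by rw [coeff_map, h.coeff_g]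
  transf := h.transf.map hφ h.ncl_f h.ncl_g
  tangential j := by
    have := congrArg (MvPowerSeries.map φ) (h.tangential j)
    rw [map_sum, map_zero] at this
    simp only [map_mul, map_X] at this
    exact this
  radial := by
    have := RadNormal.map hφ hΦ h.radial
    rw [map_sum] at this
    simp only [map_mul, map_X] at this
    exact this

end

end Map

section Universal

variable (n : ℕ)

/-- The strongly nondegenerate formal maps, together with a real parameter. -/
def Adm : Type := {p : FormalMap n × ℝ // p.1.NoConst ∧ p.1.StronglyNondegenerate}

variable {n}

/-- The formal map of an admissible pair. -/
abbrev Adm.map (t : Adm n) : FormalMap n := t.1.1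

/-- The real parameter of an admissible pair. -/
abbrev Adm.par (t : Adm n) : ℝ := t.1.2

/-- The conjugate datum. -/
def Datum.conj : Datum n → Datum n
  | .r => .r
  | .zb j k α => .zbConj j k α
  | .zbConj j k α => .zb j k α
  | .w k α => .wConj k α
  | .wConj k α => .w k α
  | .leviDetInv => .leviDetInv
  | .strongDetInv => .strongDetInv

theorem Datum.star_value (t : Adm n) (d : Datum n) :
    star (d.value t.map t.par) = d.conj.value t.map t.par := by
  cases d with
  | r => simp [value, conj]
  | zb j k α => rfl
  | zbConj j k α => exact star_star _
  | w k α => rfl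
  | wConj k α => exact star_star _
  | leviDetInv => simp only [value, conj, star_inv₀, FormalMap.det_levi_real t.2.1]
  | strongDetInv => simp only [value, conj, star_inv₀, FormalMap.det_strongMatrix_real]

/-- The function on admissible pairs given by a polynomial in the data. -/
def polyFun : MvPolynomial (Datum n) ℂ →ₐ[ℂ] (Adm n → ℂ) :=
  MvPolynomial.aeval fun d t => d.value t.map t.par

theorem polyFun_apply (P : MvPolynomial (Datum n) ℂ) (t : Adm n) :
    polyFun P t = MvPolynomial.eval (Datum.value t.map t.par) P := by
  induction P using MvPolynomial.induction_on with
  | C a => simp [polyFun]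
  | add p q hp hq => rw [map_add, Pi.add_apply, hp, hq, map_add]
  | mul_X p d hp => rw [map_mul, Pi.mul_apply, hp, map_mul]; simp [polyFun]

/-- The data are closed under conjugation: derivatives come with their conjugates, and r and both
determinants are real. -/
theorem star_polyFun (P : MvPolynomial (Datum n) ℂ) : ∃ P', polyFun P' = star (polyFun P) := by
  induction P using MvPolynomial.induction_on with
  | C a =>
    refine ⟨MvPolynomial.C (star a), funext fun t => ?_⟩
    rw [Pi.star_apply, polyFun_apply, polyFun_apply, MvPolynomial.eval_C, MvPolynomial.eval_C]
  | add p q hp hq =>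
    obtain ⟨p', hp⟩ := hp
    obtain ⟨q', hq⟩ := hq
    exact ⟨p' + q', by rw [map_add, map_add, hp, hq, star_add]⟩
  | mul_X p d hp =>
    obtain ⟨p', hp⟩ := hp
    refine ⟨p' * MvPolynomial.X d.conj, ?_⟩
    rw [map_mul, map_mul, hp, star_mul']
    congr 1
    funext t
    rw [Pi.star_apply, polyFun_apply, polyFun_apply, MvPolynomial.eval_X, MvPolynomial.eval_X,
      Datum.star_value]

variable (n) in
/-- The algebra of functions on admissible pairs that are polynomial in the data. -/
def dataAlg : StarSubalgebra ℂ (Adm n → ℂ) :=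
  { (polyFun (n := n)).range with
    star_mem' := by
      rintro x ⟨P, rfl⟩
      obtain ⟨P', h⟩ := star_polyFun P
      exact ⟨P', h⟩ }

/-- Evaluation at an admissible pair. -/
def evalAt (t : Adm n) : dataAlg n →+* ℂ where
  toFun x := x.1 t
  map_one' := rfl
  map_mul' _ _ := rfl
  map_zero' := rfl
  map_add' _ _ := rfl

/-- Elements are functions rather than formal polynomials, so relations such as hermitian symmetry
or invertibility of the determinants can be checked at each admissible pair, where the results over
ℂ apply. -/
theorem dataAlg_ext {x y : dataAlg n} (h : ∀ t, evalAt t x = evalAt t y) : x = y :=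
  Subtype.ext (funext h)

theorem evalAt_star (t : Adm n) (x : dataAlg n) : evalAt t (star x) = star (evalAt t x) := rfl

theorem evalAt_algebraMap (t : Adm n) (z : ℂ) : evalAt t (algebraMap ℂ (dataAlg n) z) = z := rfl

/-- The element of `dataAlg n` given by a polynomial. -/
def elt (P : MvPolynomial (Datum n) ℂ) : dataAlg n := ⟨polyFun P, P, rfl⟩

theorem evalAt_elt (t : Adm n) (P : MvPolynomial (Datum n) ℂ) :
    evalAt t (elt P) = MvPolynomial.eval (Datum.value t.map t.par) P := polyFun_apply P t

theorem exists_elt (x : dataAlg n) : ∃ P, elt P = x := by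
  obtain ⟨P, h⟩ := x.2
  exact ⟨P, Subtype.ext h⟩

variable (n) in
/-- The universal formal map. -/
def univMap : CRMap n (dataAlg n) where
  zb j k := ofCoeff fun α =>
    elt (MvPolynomial.C (facIdx α)⁻¹ * MvPolynomial.X (Datum.zb j k α))
  w k := ofCoeff fun α => elt (MvPolynomial.C (facIdx α)⁻¹ * MvPolynomial.X (Datum.w k α))

theorem univMap_map (t : Adm n) : (univMap n).map (evalAt t) = t.map.toCR := by
  have h : ∀ (α : MIdx n) (p : FPS n), (facIdx α)⁻¹ * deriv0 α p = coeff α p := fun α p => by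
    rw [deriv0_eq, inv_mul_cancel_left₀ (facIdx_ne_zero α)]
  ext1
  · funext j k
    ext α
    change evalAt t (elt _) = _
    rw [evalAt_elt, map_mul, MvPolynomial.eval_C, MvPolynomial.eval_X]
    exact h _ _
  · funext k
    ext α
    change evalAt t (elt _) = _
    rw [evalAt_elt, map_mul, MvPolynomial.eval_C, MvPolynomial.eval_X]
    exact h _ _

theorem evalAt_coeff_zb (t : Adm n) (j k : Fin n) (α : MIdx n) :
    evalAt t (coeff α ((univMap n).zb j k)) = coeff α (t.map.zb j k) :=
  congrArg (fun L : CRMap n ℂ => coeff α (L.zb j k)) (univMap_map t)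

theorem evalAt_coeff_w (t : Adm n) (k : Fin n) (α : MIdx n) :
    evalAt t (coeff α ((univMap n).w k)) = coeff α (t.map.w k) :=
  congrArg (fun L : CRMap n ℂ => coeff α (L.w k)) (univMap_map t)

theorem univMap_noCst : (univMap n).NoCst := by
  refine ⟨fun j k => (mem_wfil_one_iff one_le_wone).2 (dataAlg_ext fun t => ?_),
    fun k => (mem_wfil_one_iff one_le_wone).2 (dataAlg_ext fun t => ?_)⟩
  · rw [← coeff_zero_eq_constantCoeff_apply, evalAt_coeff_zb, map_zero]
    exact t.2.1.1 j k
  · rw [← coeff_zero_eq_constantCoeff_apply, evalAt_coeff_w, map_zero]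
    exact t.2.1.2 k

variable (n) in
/-- The Levi form of the universal formal map. -/
def univLevi : Matrix (Fin n) (Fin n) (dataAlg n) := Matrix.of fun j k =>
  algebraMap ℂ (dataAlg n) (1 / (2 * Complex.I)) *
    (coeff (Finsupp.single (izb j) 1) ((univMap n).w k)
      - star (coeff (Finsupp.single (izb k) 1) ((univMap n).w j)))

variable (n) in
/-- The form `𝓝^w` of the universal formal map. -/
def univNonint : Matrix (Fin n) (Fin n) (dataAlg n) := Matrix.of fun j k =>
  coeff (Finsupp.single (iz j) 1) ((univMap n).w k)
    - coeff (Finsupp.single (iz k) 1) ((univMap n).w j)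

theorem evalAt_univLevi (t : Adm n) (j k : Fin n) :
    evalAt t (univLevi n j k) = t.map.levi j k := by
  rw [FormalMap.levi_apply t.2.1.noCst, univLevi, Matrix.of_apply, map_mul, map_sub, evalAt_star,
    evalAt_coeff_w, evalAt_coeff_w, evalAt_algebraMap]

theorem evalAt_univNonint (t : Adm n) (j k : Fin n) :
    evalAt t (univNonint n j k) = t.map.nonint j k := by
  rw [FormalMap.nonint_apply t.2.1.noCst, univNonint, Matrix.of_apply, map_sub, evalAt_coeff_w,
    evalAt_coeff_w]

variable (n) in
/-- The frame of the universal formal map. -/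
def univFrame : Frame n (dataAlg n) where
  c := univLevi n
  nn := univNonint n
  cinv := (elt (MvPolynomial.X Datum.leviDetInv) : dataAlg n) • (univLevi n).adjugate
  star_c j k := dataAlg_ext fun t => by
    rw [evalAt_star, evalAt_univLevi, evalAt_univLevi, FormalMap.star_levi t.2.1.noCst]
  nn_anti j k := dataAlg_ext fun t => by
    rw [map_neg, evalAt_univNonint, evalAt_univNonint, FormalMap.nonint_anti t.2.1.noCst]
  c_mul_cinv := by
    rw [Matrix.mul_smul, Matrix.mul_adjugate, smul_smul]
    have : (elt (MvPolynomial.X Datum.leviDetInv) : dataAlg n) * (univLevi n).det = 1 :=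
      dataAlg_ext fun t => by
        have h : (evalAt t).mapMatrix (univLevi n) = t.map.levi :=
          Matrix.ext fun j k => evalAt_univLevi t j k
        rw [map_mul, evalAt_elt, MvPolynomial.eval_X, RingHom.map_det, h, map_one]
        exact inv_mul_cancel₀ t.2.2.det_levi_ne
    rw [this, one_smul]
  strong := by
    refine IsUnit.of_mul_eq_one (elt (MvPolynomial.X Datum.strongDetInv)) (dataAlg_ext fun t => ?_)
    rw [map_mul, evalAt_elt, MvPolynomial.eval_X, RingHom.map_det, map_one]
    refine Eq.trans (congrArg₂ (· * ·) (congrArg Matrix.det ?_) rfl)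
      (mul_inv_cancel₀ t.2.2.det_strongMatrix_ne)
    ext i j
    rcases i with i | i <;> rcases j with j | j
    · exact evalAt_univNonint t i j
    · change evalAt t (algebraMap ℂ (dataAlg n) _ * star (univLevi n i j)) = _
      rw [map_mul, evalAt_algebraMap, evalAt_star, evalAt_univLevi]
      rfl
    · change evalAt t (algebraMap ℂ (dataAlg n) _ * univLevi n i j) = _
      rw [map_mul, evalAt_algebraMap, evalAt_univLevi]
      rfl
    · change evalAt t (star (univNonint n i j)) = _
      rw [evalAt_star, evalAt_univNonint]
      rfl

theorem univFrame_compat : (univFrame n).Compat (univMap n) := ⟨fun _ _ => rfl, fun _ _ => rfl⟩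

/-- The universal normalization. -/
theorem exists_universal (hn : 1 ≤ n) : ∃ (f : Fin n → PS n (dataAlg n)) (g : PS n (dataAlg n))
    (L' : CRMap n (dataAlg n)), ∀ (t : Adm n) (f₀ : Fin n → FPS n) (g₀ : FPS n)
      (L₀ : FormalMap n), t.map.Normalizes t.par f₀ g₀ L₀ →
      f₀ = (fun j => MvPowerSeries.map (evalAt t) (f j)) ∧ g₀ = MvPowerSeries.map (evalAt t) g ∧
        L₀.toCR = L'.map (evalAt t) := by
  let ρ : dataAlg n := elt (MvPolynomial.C (1 / 2) * MvPolynomial.X Datum.r)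
  have hρt : ∀ t : Adm n, evalAt t ρ = (t.par : ℂ) / 2 := fun t => by
    rw [evalAt_elt, map_mul, MvPolynomial.eval_C, MvPolynomial.eval_X]
    change 1 / 2 * (t.par : ℂ) = _
    ring
  have hρ : star ρ = ρ := dataAlg_ext fun t => by
    rw [evalAt_star, hρt]
    simp
  obtain ⟨f, g, L', h⟩ := (univFrame n).exists_normalizing hn univMap_noCst univFrame_compat hρ
  refine ⟨f, g, L', fun t f₀ g₀ L₀ hN => ?_⟩
  have h1 := (FormalMap.normalizes_iff t.2.1 t.2.2 _ _ _ _).1 hN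
  have hc : ∀ j k, (t.map.frame t.2.1 t.2.2).c j k = evalAt t ((univFrame n).c j k) :=
    fun j k => (evalAt_univLevi t j k).symm
  have h2 := h.map (φ := evalAt t) (Ψ := t.map.frame t.2.1 t.2.2) (evalAt_star t) hc
  rw [univMap_map, hρt] at h2
  -- The specialization of the universal normalization is a normalization over ℂ, hence equals the
  -- given one.
  exact (t.map.frame t.2.1 t.2.2).normalizing_unique hn t.2.1.noCst
    (t.map.frame_compat t.2.1 t.2.2) h1 h2

theorem exists_polynomial (x : dataAlg n) (α : MIdx n) : ∃ P : MvPolynomial (Datum n) ℂ,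
    ∀ t : Adm n, facIdx α * evalAt t x = MvPolynomial.eval (Datum.value t.map t.par) P := by
  obtain ⟨P, rfl⟩ := exists_elt x
  exact ⟨MvPolynomial.C (facIdx α) * P, fun t => by
    rw [map_mul, MvPolynomial.eval_C, evalAt_elt]⟩

end Universal

end FormalCR

end

theorem theorem7p2 (n : ℕ) (hn : 1 ≤ n) :
    (∀ L : FormalCR.FormalMap n, L.NoConst → L.StronglyNondegenerate → ∀ r : ℝ,
      ∃! fg : (Fin n → FormalCR.FPS n) × FormalCR.FPS n,
        ∃ L' : FormalCR.FormalMap n, L.Normalizes r fg.1 fg.2 L') ∧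
    ∃ (Pf : Fin n → FormalCR.MIdx n → MvPolynomial (FormalCR.Datum n) ℂ)
      (Pg : FormalCR.MIdx n → MvPolynomial (FormalCR.Datum n) ℂ)
      (Pzb : Fin n → Fin n → FormalCR.MIdx n → MvPolynomial (FormalCR.Datum n) ℂ)
      (Pw : Fin n → FormalCR.MIdx n → MvPolynomial (FormalCR.Datum n) ℂ),
      ∀ L : FormalCR.FormalMap n, L.NoConst → L.StronglyNondegenerate →
        ∀ (r : ℝ) (f : Fin n → FormalCR.FPS n) (g : FormalCR.FPS n) (L' : FormalCR.FormalMap n),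
          L.Normalizes r f g L' →
          ∀ α : FormalCR.MIdx n,
            (∀ j, FormalCR.deriv0 α (f j) =
              MvPolynomial.eval (FormalCR.Datum.value L r) (Pf j α)) ∧
            FormalCR.deriv0 α g =
              MvPolynomial.eval (FormalCR.Datum.value L r) (Pg α) ∧
            (∀ j k, FormalCR.deriv0 α (L'.zb j k) =
              MvPolynomial.eval (FormalCR.Datum.value L r) (Pzb j k α)) ∧
            (∀ k, FormalCR.deriv0 α (L'.w k) =
              MvPolynomial.eval (FormalCR.Datum.value L r) (Pw k α)) := by
  refine ⟨fun L hL h r => FormalCR.FormalMap.existsUnique_normalizes hn hL h r, ?_⟩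
  obtain ⟨f, g, M, hM⟩ := FormalCR.exists_universal (n := n) hn
  -- Each coefficient of the universal normalization is the function given by some polynomial; the
  -- derivative differs from it by the factor α!.
  choose P hP using fun (x : FormalCR.dataAlg n) (α : FormalCR.MIdx n) =>
    FormalCR.exists_polynomial x α
  refine ⟨fun j α => P (MvPowerSeries.coeff α (f j)) α, fun α => P (MvPowerSeries.coeff α g) α,
    fun j k α => P (MvPowerSeries.coeff α (M.zb j k)) α,
    fun k α => P (MvPowerSeries.coeff α (M.w k)) α, fun L hL h r f₀ g₀ L' hN α => ?_⟩
  let t : FormalCR.Adm n := ⟨(L, r), hL, h⟩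
  obtain ⟨rfl, rfl, hL'⟩ := hM t f₀ g₀ L' hN
  refine ⟨fun j => hP _ α t, hP _ α t, fun j k => ?_, fun k => ?_⟩
  · rw [← hP _ α t]
    change _ * MvPowerSeries.coeff α (L'.toCR.zb j k) = _
    rw [hL']
    rfl
  · rw [← hP _ α t]
    change _ * MvPowerSeries.coeff α (L'.toCR.w k) = _
    rw [hL']
    rfl
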